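/- All graphs are finite and simple, and $|G|$ denotes the number of vertices of $G$. A graph $H$ has branch-length at least $\ell$ if every cycle of $H$ has length at least $\ell$ and every two distinct vertices of $H$ of degree at least three have distance at least $\ell$ in $H$ (the distance between vertices in different components is infinite). A graph $G$ is $\varepsilon$-sparse if every vertex of $G$ has degree less than $\varepsilon|G|$, and $(\alpha,\beta)$-coherent if there do not exist disjoint sets $A,B\subseteq V(G)$ with no edge of $G$ between $A$ and $B$ such that $|A|\ge\alpha$ and $|B|\ge\beta$. Let $c>0$ be a real number such that $1/c$ is an integer, and let $H$ be a graph with branch-length at least $4/c+5$. Then there exists $\varepsilon>0$ such that every $\varepsilon$-sparse, $(\varepsilon|G|^{1-c},\varepsilon|G|)$-coherent graph $G$ with $|G|>1$ contains $H$; that is, some induced subgraph of $G$ is isomorphic to $H$. -/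

import Mathlib

namespace PurePairs

/-- A finite graph `H` has branch-length at least `ℓ`: every cycle has length at least `ℓ`, and every
two distinct vertices of degree at least three have distance at least `ℓ` (vertices in different
components have infinite distance, so they are not constrained). -/
def HasBranchLengthAtLeast {W : Type*} [Fintype W] (H : SimpleGraph W) [DecidableRel H.Adj]
    (ℓ : ℝ) : Prop :=
  (∀ (w : W) (p : H.Walk w w), p.IsCycle → ℓ ≤ (p.length : ℝ)) ∧
  (∀ u v : W, u ≠ v → 3 ≤ H.degree u → 3 ≤ H.degree v → H.Reachable u v → ℓ ≤ (H.dist u v : ℝ))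

/-- `G` is `ε`-sparse: every vertex has degree less than `ε|G|`. -/
def IsSparse {V : Type*} [Fintype V] (G : SimpleGraph V) [DecidableRel G.Adj] (ε : ℝ) : Prop :=
  ∀ v : V, (G.degree v : ℝ) < ε * (Fintype.card V : ℝ)

/-- Disjoint vertex sets with no edge between them. -/
def IsAnticompletePair {V : Type*} (G : SimpleGraph V) (A B : Finset V) : Prop :=
  Disjoint A B ∧ ∀ a ∈ A, ∀ b ∈ B, ¬ G.Adj a b

/-- `G` is `(α, β)`-coherent: there is no anticomplete pair `A, B` with `|A| ≥ α`, `|B| ≥ β`. -/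
def IsCoherent {V : Type*} (G : SimpleGraph V) (α β : ℝ) : Prop :=
  ¬ ∃ A B : Finset V, IsAnticompletePair G A B ∧ α ≤ (A.card : ℝ) ∧ β ≤ (B.card : ℝ)

end PurePairs

/-! Write `n = |G|`, `k = 1/c`, `α = ε n^(1-c)`, `β = ε n`, `s = n^(c/2)`. Then `α s² = β` and
`s^(2k) = n`. Call a set linear if its size is at least a fixed fraction of `n`, chosen before `ε`.
Coherence says that a set of size `α` sees all but fewer than `β` of the other vertices.
Consequently, after deleting fewer than `α` vertices, smaller sets expand by a factor `s²`
(`Coh.exists_core`).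

On the side of `H`, large branch-length lets `H` be assembled from isolated centers, long induced
threads between centers (a cycle component is a thread from a center to itself) and pendant paths
(`exists_buildable`). The pieces are then embedded one at a time, keeping the image induced.

To leave a center along a route that avoids everything used so far, a hub is prepared
(`Coh.exists_hub`). It consists of a linear set `W`, in which all centers are placed, a linear set
`R`, and many connected sets `D`, pairwise anticomplete and anticomplete to `R`, each with
neighbours at every vertex of `W`. By expansion each `D` can be taken of depth at most `k - 1`
around a root. So two nonadjacent vertices of `W` are joined through `D` by an induced path, a leg,
of length between 2 and `2k + 1`. Every thread consumes two fresh sets `D`, one for each end.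

The lengths of legs are not under control, but by pigeonhole a linear set of end vertices is reached
by legs of one common length. The remaining length is supplied by `Coh.exists_link`, which joins
some end of a first leg to some end of a second one through `R` by an induced path of any prescribed
length at least 3. Two legs and a link can have any total length from `2(2k + 1) + 3 = 4k + 5` up to
a fixed bound, and this is the source of the constant `4/c + 5`.

The link needs a linear set in which degrees are regular up to a factor `s` (`Coh.exists_regular`).
It exists because the maximum degree can drop by a factor `s` at most `2k` times before an edgeless
linear set would appear. Unwanted adjacencies between legs are recorded by the relation `Conf`. Each
vertex has only a constant times the maximum degree of conflicts, so they can always be avoided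
(`Hub.exists_generic`). `Setup.exists_thread` puts legs and link together. -/

namespace PurePairs

open Finset
open scoped Classical

variable {V : Type*}

/-! ### Expansion from coherence, and rooted sets of small depth -/

/-- The vertices of `Y` with a neighbour in `X`. -/
noncomputable def nb (G : SimpleGraph V) (X Y : Finset V) : Finset V :=
  Y.filter fun y => ∃ x ∈ X, G.Adj x y

/-- The neighbours of `v` in `Y`. -/
noncomputable def nv (G : SimpleGraph V) (v : V) (Y : Finset V) : Finset V :=
  Y.filter fun y => G.Adj v y

/-- Coherence, in the form used throughout. -/
def Coh (G : SimpleGraph V) (α β : ℝ) : Prop :=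
  ∀ A B : Finset V, Disjoint A B → (∀ a ∈ A, ∀ b ∈ B, ¬ G.Adj a b) → α ≤ (#A : ℝ) → (#B : ℝ) < β

variable {G : SimpleGraph V} {α β t : ℝ}

@[simp] lemma mem_nb {X Y : Finset V} {y : V} : y ∈ nb G X Y ↔ y ∈ Y ∧ ∃ x ∈ X, G.Adj x y := by
  simp [nb]

@[simp] lemma mem_nv {v y : V} {Y : Finset V} : y ∈ nv G v Y ↔ y ∈ Y ∧ G.Adj v y := by
  simp [nv]

lemma nb_subset (X Y : Finset V) : nb G X Y ⊆ Y := filter_subset _ _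

lemma nv_subset (v : V) (Y : Finset V) : nv G v Y ⊆ Y := filter_subset _ _

lemma nv_mono (v : V) {Y Z : Finset V} (h : Y ⊆ Z) : nv G v Y ⊆ nv G v Z := filter_subset_filter _ h

lemma card_nv_mono (v : V) {Y Z : Finset V} (h : Y ⊆ Z) : (#(nv G v Y) : ℝ) ≤ #(nv G v Z) := by
  exact_mod_cast card_le_card (nv_mono v h)

lemma card_nb_le (X Y : Finset V) {d : ℝ} (h : ∀ x ∈ X, (#(nv G x Y) : ℝ) ≤ d) :
    (#(nb G X Y) : ℝ) ≤ #X * d := by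
  have h1 : nb G X Y ⊆ X.biUnion fun x => nv G x Y := by
    intro y hy
    obtain ⟨hy, x, hx, hxy⟩ := mem_nb.1 hy
    exact mem_biUnion.2 ⟨x, hx, mem_nv.2 ⟨hy, hxy⟩⟩
  have h2 : #(nb G X Y) ≤ ∑ x ∈ X, #(nv G x Y) := (card_le_card h1).trans card_biUnion_le
  calc (#(nb G X Y) : ℝ) ≤ ∑ x ∈ X, (#(nv G x Y) : ℝ) := by exact_mod_cast h2
    _ ≤ ∑ _x ∈ X, d := sum_le_sum h
    _ = #X * d := by simp

lemma card_sdiff_ge (A B : Finset V) : (#A : ℝ) - #B ≤ #(A \ B) := by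
  have := le_card_sdiff B A
  have h2 : #A ≤ #(A \ B) + #B := by omega
  have : (#A : ℝ) ≤ #(A \ B) + #B := by exact_mod_cast h2
  linarith

lemma Coh.card_miss_lt (h : Coh G α β) {A : Finset V} (B : Finset V) (hA : α ≤ (#A : ℝ)) :
    (#(B \ (A ∪ nb G A B)) : ℝ) < β := by
  refine h A _ ?_ ?_ hA
  · rw [disjoint_left]; intro a ha; simp [ha]
  · intro a ha b hb hab
    simp only [mem_sdiff, mem_union, mem_nb, not_or, not_and] at hb
    exact hb.2.2 hb.1 ⟨a, ha, hab⟩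

lemma Coh.card_nb_gt (h : Coh G α β) {A B : Finset V} (hd : Disjoint A B) (hA : α ≤ (#A : ℝ)) :
    (#B : ℝ) - β < #(nb G A B) := by
  have h1 := h.card_miss_lt B hA
  have h2 : B \ (A ∪ nb G A B) = B \ nb G A B := by
    ext x; simp only [mem_sdiff, mem_union, not_or]
    constructor
    · tauto
    · intro hx; exact ⟨hx.1, fun hxA => (disjoint_left.1 hd hxA hx.1), hx.2⟩
  rw [h2] at h1
  have := card_sdiff_ge B (nb G A B)
  linarith

/-- After deleting fewer than `α` vertices from `A`, all small sets expand into `B` by a factor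
`t`. -/
lemma Coh.exists_core (h : Coh G α β) (hα : 0 < α) (ht : 1 ≤ t) (hαβ : α * t = β)
    (A B : Finset V) (hB : 5 * β ≤ (#B : ℝ)) :
    ∃ K ⊆ A, (#K : ℝ) < α ∧ ∀ X ⊆ A \ K, (#X : ℝ) ≤ α → t * #X ≤ #(nb G X (B \ (K ∪ X))) := by
  -- `K` is a largest set of size below `α` with at most `t * #K` outside neighbours. If `X` fails
  -- to expand, so does `K ∪ X`, hence by maximality its size lies between `α` and `2α`. It then
  -- sees at most `2β` of `B` and, by coherence, misses fewer than `β`, which is impossible when `#B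
  -- ≥ 5β`.
  let F : Finset (Finset V) := A.powerset.filter fun K =>
    (#K : ℝ) < α ∧ (#(nb G K (B \ K)) : ℝ) ≤ t * #K
  have hF : F.Nonempty := ⟨∅, mem_filter.2 ⟨by simp, by simpa using hα, by simp [nb]⟩⟩
  obtain ⟨K, hK, hmax⟩ := exists_max_image F card hF
  simp only [F, mem_filter, mem_powerset] at hK hmax
  obtain ⟨hKA, hKα, hKt⟩ := hK
  refine ⟨K, hKA, hKα, fun X hX hXα => ?_⟩
  by_contra hbad
  push Not at hbad
  have hdis : Disjoint K X := by
    rw [disjoint_left]; intro x hx hx'; exact (mem_sdiff.1 (hX hx')).2 hx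
  have hcard : (#(K ∪ X) : ℝ) = #K + #X := by rw [card_union_of_disjoint hdis]; push_cast; rfl
  have hsub : nb G (K ∪ X) (B \ (K ∪ X)) ⊆ nb G K (B \ K) ∪ nb G X (B \ (K ∪ X)) := by
    intro y hy
    simp only [mem_nb, mem_sdiff, mem_union, not_or] at hy ⊢
    obtain ⟨⟨hy1, hy2, hy3⟩, x, hx | hx, hxy⟩ := hy
    · exact Or.inl ⟨⟨hy1, hy2⟩, x, hx, hxy⟩
    · exact Or.inr ⟨⟨hy1, hy2, hy3⟩, x, hx, hxy⟩
  have hle : (#(nb G (K ∪ X) (B \ (K ∪ X))) : ℝ) ≤ t * #(K ∪ X) := by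
    have : (#(nb G (K ∪ X) (B \ (K ∪ X))) : ℝ) ≤ #(nb G K (B \ K)) + #(nb G X (B \ (K ∪ X))) := by
      exact_mod_cast (card_le_card hsub).trans (card_union_le _ _)
    rw [hcard]; linarith
  have hX0 : 0 < #X := by
    rcases Nat.eq_zero_or_pos #X with h0 | h0
    · rw [h0] at hbad
      have : (0 : ℝ) ≤ #(nb G X (B \ (K ∪ X))) := by positivity
      simp at hbad; linarith
    · exact h0
  by_cases hlt : (#(K ∪ X) : ℝ) < α
  · have h3 := hmax (K ∪ X) ⟨union_subset hKA (hX.trans sdiff_subset), hlt, hle⟩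
    rw [card_union_of_disjoint hdis] at h3
    omega
  · push Not at hlt
    have h4 := h.card_miss_lt (B \ (K ∪ X)) hlt
    have h5 := card_sdiff_ge (B \ (K ∪ X)) (nb G (K ∪ X) (B \ (K ∪ X)))
    have h6 := card_sdiff_ge B (K ∪ X)
    have h7 : (B \ (K ∪ X)) \ ((K ∪ X) ∪ nb G (K ∪ X) (B \ (K ∪ X))) =
        (B \ (K ∪ X)) \ nb G (K ∪ X) (B \ (K ∪ X)) := by
      ext x; simp only [mem_sdiff, mem_union]; tauto
    rw [h7] at h4
    have h8 : (#(K ∪ X) : ℝ) ≤ 2 * α := by rw [hcard]; linarith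
    have h9 : t * #(K ∪ X) ≤ t * (2 * α) := mul_le_mul_of_nonneg_left h8 (by linarith)
    have h10 : α ≤ β := by nlinarith
    nlinarith

/-- `D` is rooted with depth at most `r`: every vertex of `D` is joined to the root by a path of `D`
along which a bounded rank decreases. -/
def IsRooted (G : SimpleGraph V) (r : ℕ) (D : Finset V) : Prop :=
  D.Nonempty ∧ ∃ (w : V) (f : V → ℕ), ∀ x ∈ D, f x ≤ r ∧ (x = w ∨ ∃ y ∈ D, G.Adj y x ∧ f y < f x)

lemma IsRooted.mono {r r' : ℕ} {D : Finset V} (h : IsRooted G r D) (hr : r ≤ r') :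
    IsRooted G r' D := by
  obtain ⟨h0, w, f, hf⟩ := h
  exact ⟨h0, w, f, fun x hx => ⟨(hf x hx).1.trans hr, (hf x hx).2⟩⟩

lemma isRooted_singleton (w : V) : IsRooted G 0 {w} :=
  ⟨⟨w, by simp⟩, w, fun _ => 0, fun x hx => ⟨le_rfl, Or.inl (by simpa using hx)⟩⟩

lemma IsRooted.union_nb {r : ℕ} {D : Finset V} (h : IsRooted G r D) (Y : Finset V) :
    IsRooted G (r + 1) (D ∪ nb G D Y) := by
  obtain ⟨h0, w, f, hf⟩ := h
  refine ⟨h0.mono subset_union_left, w, fun x => if x ∈ D then f x else r + 1, fun x hx => ?_⟩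
  by_cases hxD : x ∈ D
  · simp only [hxD, if_true]
    refine ⟨(hf x hxD).1.trans (Nat.le_succ r), ?_⟩
    rcases (hf x hxD).2 with h | ⟨y, hy, hyx, hlt⟩
    · exact Or.inl h
    · exact Or.inr ⟨y, mem_union_left _ hy, hyx, by simpa [hy] using hlt⟩
  · simp only [hxD, if_false]
    refine ⟨le_rfl, Or.inr ?_⟩
    rcases mem_union.1 hx with h | h
    · exact absurd h hxD
    · obtain ⟨_, y, hy, hyx⟩ := mem_nb.1 h
      refine ⟨y, mem_union_left _ hy, hyx, ?_⟩
      simp only [hy, if_true]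
      have := (hf y hy).1
      omega

/-- A vertex of maximal rank is never needed as a predecessor, so it can be removed. Rooted sets can
thus be shrunk one vertex at a time. -/
lemma IsRooted.exists_erase {r : ℕ} {D : Finset V} (h : IsRooted G r D) :
    ∃ x ∈ D, D.erase x = ∅ ∨ IsRooted G r (D.erase x) := by
  obtain ⟨h0, w, f, hf⟩ := h
  obtain ⟨x, hx, hmax⟩ := exists_max_image D f h0
  refine ⟨x, hx, ?_⟩
  rcases (D.erase x).eq_empty_or_nonempty with h1 | h1
  · exact Or.inl h1
  · refine Or.inr ⟨h1, w, f, fun z hz => ?_⟩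
    have hzD := mem_of_mem_erase hz
    refine ⟨(hf z hzD).1, ?_⟩
    rcases (hf z hzD).2 with h | ⟨y, hy, hyx, hlt⟩
    · exact Or.inl h
    · refine Or.inr ⟨y, mem_erase.2 ⟨?_, hy⟩, hyx, hlt⟩
      rintro rfl
      exact absurd (hmax z hzD) (by omega)

/-- Breadth-first growth from one vertex outside the core of `W`: while the ball is smaller than
`α`, each round multiplies its size by at least `t`, so `r` rounds suffice. -/
lemma Coh.exists_ball (h : Coh G α β) (hα : 0 < α) (ht : 1 ≤ t) (hαβ : α * t = β)
    {r : ℕ} (hr : α ≤ t ^ r) (W : Finset V) (hW : 5 * β ≤ (#W : ℝ)) :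
    ∃ D ⊆ W, IsRooted G r D ∧ α ≤ (#D : ℝ) := by
  obtain ⟨K, hKW, hK, hexp⟩ := h.exists_core hα ht hαβ W W hW
  have hαβ' : α ≤ β := by nlinarith
  have hne : (W \ K).Nonempty := by
    rw [← card_pos]
    have := card_sdiff_ge W K
    have h2 : (0 : ℝ) < #(W \ K) := by linarith
    exact_mod_cast h2
  obtain ⟨w, hw⟩ := hne
  have key : ∀ i : ℕ, ∃ D ⊆ W \ K, IsRooted G i D ∧ (α ≤ (#D : ℝ) ∨ t ^ i ≤ (#D : ℝ)) := by
    intro i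
    induction i with
    | zero => exact ⟨{w}, by simpa using hw, isRooted_singleton w, Or.inr (by simp)⟩
    | succ i ih =>
      obtain ⟨D, hD, hroot, hor⟩ := ih
      by_cases hDα : α ≤ (#D : ℝ)
      · exact ⟨D, hD, hroot.mono (Nat.le_succ i), Or.inl hDα⟩
      · have hti : t ^ i ≤ (#D : ℝ) := hor.resolve_left hDα
        have hx := hexp D hD (not_le.1 hDα).le
        refine ⟨D ∪ nb G D (W \ (K ∪ D)), ?_, hroot.union_nb _, Or.inr ?_⟩
        · refine union_subset hD ((nb_subset _ _).trans ?_)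
          exact sdiff_subset_sdiff Subset.rfl subset_union_left
        · have h1 : (#(nb G D (W \ (K ∪ D))) : ℝ) ≤ #(D ∪ nb G D (W \ (K ∪ D))) := by
            exact_mod_cast card_le_card subset_union_right
          rw [pow_succ]
          nlinarith
  obtain ⟨D, hD, hroot, hor⟩ := key r
  refine ⟨D, hD.trans sdiff_subset, hroot, ?_⟩
  rcases hor with h | h
  · exact h
  · linarith

/-- A rooted set inside one block that covers a quarter of some other block, and at most half of
every other block. -/
lemma Coh.exists_grow (h : Coh G α β) (hα : 0 < α) (ht : 1 ≤ t) (hαβ : α * t = β)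
    {r : ℕ} (hr : α ≤ t ^ r) (W : Finset V) (hW : 5 * β ≤ (#W : ℝ))
    {ι : Type*} (J : Finset ι) (hJ : J.Nonempty) (B : ι → Finset V)
    (hd : ∀ j ∈ J, Disjoint W (B j)) (hB : ∀ j ∈ J, 5 * β ≤ (#(B j) : ℝ))
    (hdeg : ∀ v, ∀ j ∈ J, (#(nv G v (B j)) : ℝ) ≤ β) :
    ∃ D ⊆ W, IsRooted G r D ∧ (∃ j ∈ J, (#(B j) : ℝ) ≤ 4 * #(nb G D (B j))) ∧
      ∀ j ∈ J, 2 * (#(nb G D (B j)) : ℝ) ≤ #(B j) := by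
  obtain ⟨D₀, hD₀W, hD₀, hD₀α⟩ := h.exists_ball hα ht hαβ hr W hW
  have hβ : 0 < β := by nlinarith
  -- Take a smallest rooted `D` that covers a quarter of some block. Without a vertex of top rank it
  -- covers at most a quarter of every block, and that vertex adds at most `β`, a fifth of a block;
  -- the sum stays below one half.
  let F : Finset (Finset V) := W.powerset.filter fun D =>
    IsRooted G r D ∧ ∃ j ∈ J, (#(B j) : ℝ) ≤ 4 * #(nb G D (B j))
  have hF : F.Nonempty := by
    refine ⟨D₀, mem_filter.2 ⟨mem_powerset.2 hD₀W, hD₀, ?_⟩⟩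
    obtain ⟨j, hj⟩ := hJ
    refine ⟨j, hj, ?_⟩
    have := h.card_nb_gt (disjoint_of_subset_left hD₀W (hd j hj)) hD₀α
    have := hB j hj
    linarith
  obtain ⟨D, hD, hmin⟩ := exists_min_image F card hF
  simp only [F, mem_filter, mem_powerset] at hD hmin
  obtain ⟨hDW, hroot, hcov⟩ := hD
  refine ⟨D, hDW, hroot, hcov, fun j hj => ?_⟩
  obtain ⟨x, hx, herase⟩ := hroot.exists_erase
  have hlt : 4 * (#(nb G (D.erase x) (B j)) : ℝ) ≤ #(B j) := by
    rcases herase with h0 | h0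
    · rw [h0]; simp [nb]
    · by_contra hcon
      push Not at hcon
      have := hmin (D.erase x) ⟨(erase_subset _ _).trans hDW, h0, j, hj, hcon.le⟩
      have := card_erase_lt_of_mem hx
      omega
  have hsub : nb G D (B j) ⊆ nb G (D.erase x) (B j) ∪ nv G x (B j) := by
    intro y hy
    obtain ⟨hy, z, hz, hzy⟩ := mem_nb.1 hy
    by_cases hzx : z = x
    · subst hzx; exact mem_union_right _ (mem_nv.2 ⟨hy, hzy⟩)
    · exact mem_union_left _ (mem_nb.2 ⟨hy, z, mem_erase.2 ⟨hzx, hz⟩, hzy⟩)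
  have h1 : (#(nb G D (B j)) : ℝ) ≤ #(nb G (D.erase x) (B j)) + #(nv G x (B j)) := by
    exact_mod_cast (card_le_card hsub).trans (card_union_le _ _)
  have := hdeg x j hj
  have := hB j hj
  linarith

end PurePairs

/-! ### Construction of the hub by merging blocks -/

namespace PurePairs

open Finset
open scoped Classical

variable {V : Type*} {G : SimpleGraph V} {α β t : ℝ}

/-- `X` and `Y` are disjoint with no edges between them. -/
def Apart (G : SimpleGraph V) (X Y : Finset V) : Prop :=
  Disjoint X Y ∧ ∀ x ∈ X, ∀ y ∈ Y, ¬ G.Adj x y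

lemma Apart.symm {X Y : Finset V} (h : Apart G X Y) : Apart G Y X :=
  ⟨h.1.symm, fun y hy x hx hxy => h.2 x hx y hy hxy.symm⟩

lemma Apart.mono {X Y X' Y' : Finset V} (h : Apart G X Y) (hX : X' ⊆ X) (hY : Y' ⊆ Y) :
    Apart G X' Y' :=
  ⟨disjoint_of_subset_left hX (disjoint_of_subset_right hY h.1),
    fun x hx y hy => h.2 x (hX hx) y (hY hy)⟩

/-- Disjoint blocks `W i`, each with a set `S i` of pairwise anticomplete rooted sets that cover
`W i` and are anticomplete to the other blocks. -/
structure Blocks (G : SimpleGraph V) (r : ℕ) (U : Finset V) (σ : ℝ) {ι : Type*} (I : Finset ι)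
    (W : ι → Finset V) (S : ι → Finset (Finset V)) : Prop where
  size : ∀ i ∈ I, σ ≤ (#(W i) : ℝ)
  sub : ∀ i ∈ I, W i ⊆ U
  disj : ∀ i ∈ I, ∀ j ∈ I, i ≠ j → Disjoint (W i) (W j)
  rooted : ∀ i ∈ I, ∀ D ∈ S i, IsRooted G r D ∧ D ⊆ U
  cover : ∀ i ∈ I, ∀ D ∈ S i, Disjoint D (W i) ∧ ∀ z ∈ W i, ∃ x ∈ D, G.Adj x z
  other : ∀ i ∈ I, ∀ D ∈ S i, ∀ j ∈ I, j ≠ i → Apart G D (W j)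
  pair : ∀ i ∈ I, ∀ D ∈ S i, ∀ D' ∈ S i, D ≠ D' → Apart G D D'

/-- The block `i₀` with the fewest sets is sacrificed to supply a new rooted set `D`. The block `j`
of which `D` covers a quarter keeps its covered part and gains `D`; every other block keeps its
uncovered part, at least half. `D` is anticomplete to the older sets of `j` because it lies in `W
i₀`. The potential `∑ 2 ^ #(S i)` does not decrease: the gain `2 ^ #(S j)` is at least the loss `2 ^
#(S i₀)`. -/
lemma Blocks.step (h : Coh G α β) (hα : 0 < α) (ht : 1 ≤ t) (hαβ : α * t = β)
    {r : ℕ} (hr : α ≤ t ^ r) {U : Finset V} (hdeg : ∀ v, (#(nv G v U) : ℝ) ≤ β)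
    {ι : Type*} {I : Finset ι} {W : ι → Finset V} {S : ι → Finset (Finset V)} {σ : ℝ}
    (hb : Blocks G r U σ I W S) (hI : 2 ≤ #I) (hσ : 5 * β ≤ σ) :
    ∃ i₀ ∈ I, ∃ W' S', Blocks G r U (σ / 4) (I.erase i₀) W' S' ∧
      ∑ i ∈ I, 2 ^ #(S i) ≤ ∑ i ∈ I.erase i₀, 2 ^ #(S' i) := by
  have hβ : 0 < β := by nlinarith
  have hIne : I.Nonempty := card_pos.1 (by omega)
  obtain ⟨i₀, hi₀, hmin⟩ := exists_min_image I (fun i => #(S i)) hIne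
  have hJne : (I.erase i₀).Nonempty := by
    rw [← card_pos, card_erase_of_mem hi₀]; omega
  obtain ⟨D, hDW, hroot, ⟨j, hj, hcov⟩, hhalf⟩ := h.exists_grow hα ht hαβ hr (W i₀)
    (hσ.trans (hb.size i₀ hi₀)) (I.erase i₀) hJne W
    (fun j hj => hb.disj i₀ hi₀ j (mem_of_mem_erase hj) (ne_of_mem_erase hj).symm)
    (fun j hj => hσ.trans (hb.size j (mem_of_mem_erase hj)))
    (fun v j hj => (card_nv_mono v (hb.sub j (mem_of_mem_erase hj))).trans (hdeg v))
  have hjI := mem_of_mem_erase hj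
  have hj0 : j ≠ i₀ := ne_of_mem_erase hj
  let W' : ι → Finset V := fun i => if i = j then nb G D (W j) else W i \ nb G D (W i)
  let S' : ι → Finset (Finset V) := fun i => if i = j then insert D (S j) else S i
  have hW'sub : ∀ i, W' i ⊆ W i := by
    intro i
    by_cases hij : i = j
    · subst hij; simpa [W'] using nb_subset _ _
    · simp [W', hij]
  have hDapart : ∀ D' ∈ S j, Apart G D D' := fun D' hD' =>
    (((hb.other j hjI D' hD' i₀ hi₀ hj0.symm).mono Subset.rfl hDW)).symm
  have hDnot : D ∉ S j := by
    intro hD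
    obtain ⟨x, hx⟩ := hroot.1
    exact disjoint_left.1 (hDapart D hD).1 hx hx
  have hDnew : ∀ i ∈ I.erase i₀, i ≠ j → Apart G D (W' i) := by
    intro i hi hij
    refine ⟨?_, ?_⟩
    · exact disjoint_of_subset_left hDW (disjoint_of_subset_right (hW'sub i)
        (hb.disj i₀ hi₀ i (mem_of_mem_erase hi) (ne_of_mem_erase hi).symm))
    · intro x hx z hz hxz
      simp only [W', hij, if_false, mem_sdiff, mem_nb, not_and] at hz
      exact hz.2 hz.1 ⟨x, hx, hxz⟩
  refine ⟨i₀, hi₀, W', S', ⟨?_, ?_, ?_, ?_, ?_, ?_, ?_⟩, ?_⟩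
  · intro i hi
    have hs := hb.size i (mem_of_mem_erase hi)
    by_cases hij : i = j
    · subst hij; simp only [W', if_true]; linarith
    · simp only [W', hij, if_false]
      have := hhalf i hi
      have := card_sdiff_ge (W i) (nb G D (W i))
      linarith
  · exact fun i hi => (hW'sub i).trans (hb.sub i (mem_of_mem_erase hi))
  · exact fun i hi i' hi' hne => disjoint_of_subset_left (hW'sub i) (disjoint_of_subset_right
      (hW'sub i') (hb.disj i (mem_of_mem_erase hi) i' (mem_of_mem_erase hi') hne))
  · intro i hi D' hD'
    by_cases hij : i = j
    · subst hij
      simp only [S', if_true, mem_insert] at hD'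
      rcases hD' with rfl | hD'
      · exact ⟨hroot, hDW.trans (hb.sub i₀ hi₀)⟩
      · exact hb.rooted i hjI D' hD'
    · simp only [S', hij, if_false] at hD'
      exact hb.rooted i (mem_of_mem_erase hi) D' hD'
  · intro i hi D' hD'
    have hold : D' ∈ S i → Disjoint D' (W' i) ∧ ∀ z ∈ W' i, ∃ x ∈ D', G.Adj x z := fun hD' =>
      ⟨disjoint_of_subset_right (hW'sub i) (hb.cover i (mem_of_mem_erase hi) D' hD').1,
        fun z hz => (hb.cover i (mem_of_mem_erase hi) D' hD').2 z (hW'sub i hz)⟩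
    by_cases hij : i = j
    · subst hij
      simp only [S', if_true, mem_insert] at hD'
      rcases hD' with rfl | hD'
      · refine ⟨disjoint_of_subset_left hDW (disjoint_of_subset_right (hW'sub i)
          (hb.disj i₀ hi₀ i hjI hj0.symm)), fun z hz => ?_⟩
        simp only [W', if_true] at hz
        exact (mem_nb.1 hz).2
      · exact hold hD'
    · simp only [S', hij, if_false] at hD'
      exact hold hD'
  · intro i hi D' hD' l hl hli
    have hold : D' ∈ S i → Apart G D' (W' l) := fun hD' =>
      (hb.other i (mem_of_mem_erase hi) D' hD' l (mem_of_mem_erase hl) hli).mono Subset.rfl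
        (hW'sub l)
    by_cases hij : i = j
    · subst hij
      simp only [S', if_true, mem_insert] at hD'
      rcases hD' with rfl | hD'
      · exact hDnew l hl hli
      · exact hold hD'
    · simp only [S', hij, if_false] at hD'
      exact hold hD'
  · intro i hi D₁ hD₁ D₂ hD₂ hne
    by_cases hij : i = j
    · subst hij
      simp only [S', if_true, mem_insert] at hD₁ hD₂
      rcases hD₁ with rfl | hD₁ <;> rcases hD₂ with rfl | hD₂
      · exact absurd rfl hne
      · exact hDapart D₂ hD₂
      · exact (hDapart D₁ hD₁).symm
      · exact hb.pair i hjI D₁ hD₁ D₂ hD₂ hne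
    · simp only [S', hij, if_false] at hD₁ hD₂
      exact hb.pair i (mem_of_mem_erase hi) D₁ hD₁ D₂ hD₂ hne
  · rw [← add_sum_erase I _ hi₀, ← add_sum_erase (I.erase i₀) _ hj,
      ← add_sum_erase (I.erase i₀) (fun i => 2 ^ #(S' i)) hj]
    have h1 : ∑ x ∈ (I.erase i₀).erase j, 2 ^ #(S' x) = ∑ x ∈ (I.erase i₀).erase j, 2 ^ #(S x) := by
      refine sum_congr rfl fun x hx => ?_
      simp [S', ne_of_mem_erase hx]
    have h2 : #(S' j) = #(S j) + 1 := by simp [S', card_insert_of_notMem hDnot]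
    have h3 : 2 ^ #(S i₀) ≤ 2 ^ #(S j) := Nat.pow_le_pow_right (by norm_num) (hmin j hjI)
    rw [h1]
    simp only [h2, pow_succ]
    omega

lemma Blocks.reduce (h : Coh G α β) (hα : 0 < α) (ht : 1 ≤ t) (hαβ : α * t = β)
    {r : ℕ} (hr : α ≤ t ^ r) {U : Finset V} (hdeg : ∀ v, (#(nv G v U) : ℝ) ≤ β)
    {ι : Type*} (m : ℕ) : ∀ {I : Finset ι} {W : ι → Finset V} {S : ι → Finset (Finset V)} {σ : ℝ},
    Blocks G r U σ I W S → #I = m + 2 → 5 * β * 4 ^ m ≤ σ →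
    ∃ I' ⊆ I, #I' = 2 ∧ ∃ W' S', Blocks G r U (σ / 4 ^ m) I' W' S' ∧
      ∑ i ∈ I, 2 ^ #(S i) ≤ ∑ i ∈ I', 2 ^ #(S' i) := by
  have hβ : 0 < β := by nlinarith
  induction m with
  | zero =>
    intro I W S σ hb hI _
    exact ⟨I, Subset.rfl, hI, W, S, by simpa using hb, le_rfl⟩
  | succ m ih =>
    intro I W S σ hb hI hσ
    have h4 : (1 : ℝ) ≤ 4 ^ (m + 1) := one_le_pow₀ (by norm_num)
    obtain ⟨i₀, hi₀, W₁, S₁, hb₁, hsum₁⟩ := hb.step h hα ht hαβ hr hdeg (by omega)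
      (le_trans (by nlinarith) hσ)
    obtain ⟨I', hI', hc, W', S', hb', hsum'⟩ := ih hb₁ (by rw [card_erase_of_mem hi₀]; omega)
      (by rw [le_div_iff₀ (by norm_num)]; calc _ = 5 * β * 4 ^ (m + 1) := by ring
            _ ≤ σ := hσ)
    refine ⟨I', hI'.trans (erase_subset _ _), hc, W', S', ?_, hsum₁.trans hsum'⟩
    have : σ / 4 / 4 ^ m = σ / 4 ^ (m + 1) := by rw [div_div, pow_succ, mul_comm]
    rwa [this] at hb'

lemma exists_disjoint_subsets (q : ℕ) (m : ℕ) : ∀ U : Finset V, m * q ≤ #U →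
    ∃ W : Fin m → Finset V, (∀ i, W i ⊆ U ∧ #(W i) = q) ∧ ∀ i j, i ≠ j → Disjoint (W i) (W j) := by
  induction m with
  | zero => exact fun U _ => ⟨fun i => i.elim0, fun i => i.elim0, fun i => i.elim0⟩
  | succ m ih =>
    intro U hU
    obtain ⟨T, hTU, hT⟩ := exists_subset_card_eq (show q ≤ #U by nlinarith)
    obtain ⟨W, hW, hd⟩ := ih (U \ T) (by
      rw [card_sdiff_of_subset hTU, hT]; rw [Nat.succ_mul] at hU; omega)
    have hTW : ∀ i, Disjoint T (W i) := fun i =>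
      disjoint_of_subset_right (hW i).1 disjoint_sdiff
    refine ⟨Fin.cons T W, fun i => ?_, fun i j => ?_⟩
    · refine Fin.cases ?_ (fun i => ?_) i
      · exact ⟨by simpa using hTU, by simpa using hT⟩
      · exact ⟨by simpa using (hW i).1.trans sdiff_subset, by simpa using (hW i).2⟩
    · refine Fin.cases ?_ (fun i => ?_) i <;> refine Fin.cases ?_ (fun j => ?_) j
      · intro h; exact absurd rfl h
      · intro _; simpa using hTW j
      · intro _; simpa using (hTW i).symm
      · intro hij; simpa using hd i j (fun h => hij (by rw [h]))

/-- A linear set `W` covered by `N` pairwise anticomplete rooted sets, all anticomplete to a linear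
set `R`. -/
lemma Coh.exists_hub (h : Coh G α β) (hα : 0 < α) (ht : 1 ≤ t) (hαβ : α * t = β)
    {r : ℕ} (hr : α ≤ t ^ r) {U : Finset V} (hdeg : ∀ v, (#(nv G v U) : ℝ) ≤ β) (N : ℕ)
    {q : ℕ} (hU : 2 ^ (N + 1) * q ≤ #U) (hq : 5 * β * 4 ^ 2 ^ (N + 1) ≤ q) :
    ∃ (W R : Finset V) (𝒟 : Finset (Finset V)), W ⊆ U ∧ R ⊆ U ∧ Disjoint W R ∧
      (q : ℝ) / 4 ^ 2 ^ (N + 1) ≤ #W ∧ (q : ℝ) / 4 ^ 2 ^ (N + 1) ≤ #R ∧ #𝒟 = N ∧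
      (∀ D ∈ 𝒟, IsRooted G r D ∧ D ⊆ U ∧ Disjoint D W ∧ (∀ z ∈ W, ∃ x ∈ D, G.Adj x z) ∧
        Apart G D R) ∧
      ∀ D ∈ 𝒟, ∀ D' ∈ 𝒟, D ≠ D' → Apart G D D' := by
  have hβ : 0 < β := by nlinarith
  -- Starting from `2 ^ (N + 1)` blocks with empty families, the potential is `2 ^ (N + 1)`. When
  -- two blocks are left, one of them must own at least `N` sets; it becomes `W` and the other
  -- becomes `R`.
  obtain ⟨W₀, hW₀, hd₀⟩ := exists_disjoint_subsets q (2 ^ (N + 1)) U hU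
  have hb₀ : Blocks G r U q (univ : Finset (Fin (2 ^ (N + 1)))) W₀ (fun _ => ∅) :=
    ⟨fun i _ => by rw [(hW₀ i).2], fun i _ => (hW₀ i).1, fun i _ j _ hij => hd₀ i j hij,
      by simp, by simp, by simp, by simp⟩
  obtain ⟨m, hm⟩ : ∃ m, 2 ^ (N + 1) = m + 2 :=
    ⟨2 ^ (N + 1) - 2, by have := Nat.one_le_two_pow (n := N); rw [pow_succ]; omega⟩
  have h4m : (4 : ℝ) ^ m ≤ 4 ^ 2 ^ (N + 1) := pow_le_pow_right₀ (by norm_num) (by omega)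
  obtain ⟨I, -, hI2, W, S, hb, hsum⟩ := hb₀.reduce h hα ht hαβ hr hdeg m (by simp [hm])
    (le_trans (mul_le_mul_of_nonneg_left h4m (by positivity)) hq)
  have hsize : (q : ℝ) / 4 ^ 2 ^ (N + 1) ≤ q / 4 ^ m :=
    div_le_div_of_nonneg_left (by positivity) (by positivity) h4m
  obtain ⟨a, ha, b, hbI, hne, hN⟩ : ∃ a ∈ I, ∃ b ∈ I, a ≠ b ∧ N ≤ #(S a) := by
    obtain ⟨a, b, hne, hab⟩ := card_eq_two.1 hI2
    have hs : 2 ^ (N + 1) ≤ 2 ^ #(S a) + 2 ^ #(S b) := by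
      rw [hab, sum_pair hne] at hsum
      simpa using hsum
    have ha : a ∈ I := by simp [hab]
    have hbI : b ∈ I := by simp [hab]
    by_cases hN : N ≤ #(S a)
    · exact ⟨a, ha, b, hbI, hne, hN⟩
    · refine ⟨b, hbI, a, ha, hne.symm, ?_⟩
      by_contra hN'
      have h1 : 2 ^ #(S a) < 2 ^ N := Nat.pow_lt_pow_right (by norm_num) (by omega)
      have h2 : 2 ^ #(S b) < 2 ^ N := Nat.pow_lt_pow_right (by norm_num) (by omega)
      rw [pow_succ] at hs
      omega
  obtain ⟨𝒟, h𝒟, hc⟩ := exists_subset_card_eq hN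
  exact ⟨W a, W b, 𝒟, hb.sub a ha, hb.sub b hbI, hb.disj a ha b hbI hne,
    hsize.trans (hb.size a ha), hsize.trans (hb.size b hbI), hc,
    fun D hD => ⟨(hb.rooted a ha D (h𝒟 hD)).1, (hb.rooted a ha D (h𝒟 hD)).2,
      (hb.cover a ha D (h𝒟 hD)).1, (hb.cover a ha D (h𝒟 hD)).2,
      hb.other a ha D (h𝒟 hD) b hbI hne.symm⟩,
    fun D hD D' hD' hne' => hb.pair a ha D (h𝒟 hD) D' (h𝒟 hD') hne'⟩

end PurePairs

/-! ### Regular linear sets, and operations on induced paths -/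

namespace PurePairs

open Finset
open scoped Classical

variable {V : Type*} {G : SimpleGraph V} {α β : ℝ}

/-- Cut off `⌈α⌉` vertices of `Y`: the rest is anticomplete to them, hence smaller than `β`, and `α
+ 1 + β ≤ 3β`. -/
lemma Coh.card_lt_of_edgeless (h : Coh G α β) (hα : 0 < α) (hαβ : α ≤ β) (hβ : 1 ≤ β)
    {Y : Finset V} (hY : ∀ y ∈ Y, nv G y Y = ∅) : (#Y : ℝ) < 3 * β := by
  by_contra hcon
  push Not at hcon
  have h1 : (⌈α⌉₊ : ℝ) < α + 1 := Nat.ceil_lt_add_one hα.le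
  have h2 : ⌈α⌉₊ ≤ #Y := by
    have : (⌈α⌉₊ : ℝ) ≤ #Y := by linarith
    exact_mod_cast this
  obtain ⟨A, hAY, hA⟩ := exists_subset_card_eq h2
  have h3 := h A (Y \ A) disjoint_sdiff (fun a ha b hb hab => by
      have hmem : b ∈ nv G a Y := mem_nv.2 ⟨(mem_sdiff.1 hb).1, hab⟩
      rw [hY a (hAY ha)] at hmem
      simp at hmem) (by rw [hA]; exact Nat.le_ceil α)
  have h4 := card_sdiff_ge Y A
  rw [hA] at h4
  linarith

/-- A linear set in which the degrees into all linear subsets are regular up to a factor `s`. -/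
lemma Coh.exists_regular (h : Coh G α β) (hα : 0 < α) (hαβ : α ≤ β) (hβ : 1 ≤ β)
    {s κ : ℝ} (hs : 1 ≤ s) (hκ : 0 < κ) (I : ℕ) (hI : β < s ^ I)
    (U₀ : Finset V) (hdeg : ∀ v, (#(nv G v U₀) : ℝ) ≤ β) (hκ1 : κ ≤ 1)
    (hU₀ : 3 * β ≤ κ ^ I * #U₀) :
    ∃ U ⊆ U₀, ∃ Δ : ℝ, κ ^ I * #U₀ ≤ #U ∧ 1 ≤ Δ ∧ Δ ≤ β ∧ (∀ u ∈ U, (#(nv G u U) : ℝ) ≤ Δ) ∧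
      ∀ Y ⊆ U, κ * #U ≤ #Y → ∃ y ∈ Y, Δ ≤ s * #(nv G y Y) := by
  by_contra hno
  -- Every failure of regularity yields a subset of relative size `κ` whose maximum degree is
  -- smaller by a factor `s`. After `I` failures the degrees are below 1, giving an edgeless set
  -- that is too large.
  have key : ∀ i ≤ I, ∃ U ⊆ U₀, κ ^ i * #U₀ ≤ #U ∧ ∀ u ∈ U, (#(nv G u U) : ℝ) ≤ β / s ^ i := by
    intro i
    induction i with
    | zero => exact fun _ => ⟨U₀, Subset.rfl, by simp, fun u _ => by simpa using hdeg u⟩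
    | succ i ih =>
      intro hi
      obtain ⟨U, hU, hc, hd⟩ := ih (by omega)
      have hcI : κ ^ I * #U₀ ≤ #U := le_trans (mul_le_mul_of_nonneg_right
        (pow_le_pow_of_le_one hκ.le hκ1 (by omega)) (by positivity)) hc
      have h1 : 1 ≤ β / s ^ i := by
        by_contra hlt
        push Not at hlt
        have := h.card_lt_of_edgeless hα hαβ hβ (Y := U) (fun y hy => by
          have h2 : (#(nv G y U) : ℝ) < 1 := lt_of_le_of_lt (hd y hy) hlt
          have h3 : #(nv G y U) < 1 := by exact_mod_cast h2
          exact card_eq_zero.1 (by omega))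
        linarith
      have hspos : (0 : ℝ) < s ^ i := by positivity
      by_contra hno'
      refine hno ⟨U, hU, β / s ^ i, hcI, h1, ?_, hd, fun Y hY hYc => ?_⟩
      · rw [div_le_iff₀ hspos]
        have : 1 ≤ s ^ i := one_le_pow₀ hs
        nlinarith
      · by_contra hall
        push Not at hall
        refine hno' ⟨Y, hY.trans hU, ?_, fun y hy => ?_⟩
        · calc κ ^ (i + 1) * #U₀ = κ * (κ ^ i * #U₀) := by ring
            _ ≤ κ * #U := mul_le_mul_of_nonneg_left hc hκ.le
            _ ≤ #Y := hYc
        · have h5 := hall y hy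
          rw [le_div_iff₀ (by positivity)]
          rw [lt_div_iff₀ hspos] at h5
          calc (#(nv G y Y) : ℝ) * s ^ (i + 1) = s * #(nv G y Y) * s ^ i := by ring
            _ ≤ β := h5.le
  obtain ⟨U, hU, hc, hd⟩ := key I le_rfl
  have := h.card_lt_of_edgeless hα hαβ hβ (Y := U) (fun y hy => by
    have h2 : (#(nv G y U) : ℝ) < 1 := lt_of_le_of_lt (hd y hy)
      (by rw [div_lt_one (by positivity)]; exact hI)
    have h3 : #(nv G y U) < 1 := by exact_mod_cast h2
    exact card_eq_zero.1 (by omega))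
  linarith

/-- `p 0, …, p L` is an induced path. -/
def IndPath (G : SimpleGraph V) (p : ℕ → V) (L : ℕ) : Prop :=
  (∀ i j, i ≤ L → j ≤ L → p i = p j → i = j) ∧
    ∀ i j, i < j → j ≤ L → (G.Adj (p i) (p j) ↔ j = i + 1)

lemma indPath_zero (p : ℕ → V) : IndPath G p 0 :=
  ⟨fun i j hi hj _ => by omega, fun i j hi hj => by omega⟩

lemma IndPath.snoc {p : ℕ → V} {L : ℕ} (h : IndPath G p L) {v : V} (hne : ∀ i ≤ L, p i ≠ v)
    (hadj : G.Adj (p L) v) (hnadj : ∀ i < L, ¬ G.Adj (p i) v) :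
    ∃ q, IndPath G q (L + 1) ∧ (∀ i ≤ L, q i = p i) ∧ q (L + 1) = v := by
  have h1 : ∀ i ≤ L, (fun i => if i ≤ L then p i else v) i = p i := fun i hi => by simp [hi]
  have h2 : (fun i => if i ≤ L then p i else v) (L + 1) = v := by simp
  refine ⟨fun i => if i ≤ L then p i else v, ⟨fun i j hi hj hij => ?_, fun i j hij hj => ?_⟩, h1, h2⟩
  · rcases Nat.lt_or_ge L i with hi' | hi' <;> rcases Nat.lt_or_ge L j with hj' | hj'
    · omega
    · obtain rfl : i = L + 1 := by omega
      rw [h2, h1 j hj'] at hij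
      exact absurd hij.symm (hne j hj')
    · obtain rfl : j = L + 1 := by omega
      rw [h2, h1 i hi'] at hij
      exact absurd hij (hne i hi')
    · rw [h1 i hi', h1 j hj'] at hij
      exact h.1 i j hi' hj' hij
  · rcases Nat.lt_or_ge L j with hj' | hj'
    · obtain rfl : j = L + 1 := by omega
      rw [h2, h1 i (by omega)]
      rcases Nat.lt_or_ge i L with hi | hi
      · exact ⟨fun h => absurd h (hnadj i hi), fun h => by omega⟩
      · obtain rfl : i = L := by omega
        simp [hadj]
    · rw [h1 i (by omega), h1 j hj']
      exact h.2 i j hij hj'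

lemma IndPath.reverse {p : ℕ → V} {L : ℕ} (h : IndPath G p L) :
    IndPath G (fun i => p (L - i)) L := by
  refine ⟨fun i j hi hj hij => ?_, fun i j hij hj => ?_⟩
  · have := h.1 _ _ (Nat.sub_le L i) (Nat.sub_le L j) hij; omega
  · rw [G.adj_comm, h.2 (L - j) (L - i) (by omega) (Nat.sub_le L i)]; omega

lemma IndPath.shift {p : ℕ → V} {a L : ℕ} (h : IndPath G p (a + L)) :
    IndPath G (fun i => p (a + i)) L := by
  refine ⟨fun i j hi hj hij => ?_, fun i j hij hj => ?_⟩
  · have := h.1 _ _ (by omega) (by omega) hij; omega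
  · rw [h.2 (a + i) (a + j) (by omega) (by omega)]; omega

lemma IndPath.take {p : ℕ → V} {L L' : ℕ} (h : IndPath G p L) (hL : L' ≤ L) : IndPath G p L' :=
  ⟨fun i j hi hj => h.1 i j (hi.trans hL) (hj.trans hL), fun i j hij hj => h.2 i j hij (hj.trans hL)⟩

lemma IndPath.glue {p q : ℕ → V} {a b : ℕ} (hp : IndPath G p a) (hq : IndPath G q b)
    (h0 : p a = q 0) (hne : ∀ i j, i < a → 0 < j → j ≤ b → p i ≠ q j)
    (hnadj : ∀ i j, i < a → 0 < j → j ≤ b → ¬ G.Adj (p i) (q j)) :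
    IndPath G (fun i => if i ≤ a then p i else q (i - a)) (a + b) := by
  have h1 : ∀ i ≤ a, (fun i => if i ≤ a then p i else q (i - a)) i = p i := fun i hi => by simp [hi]
  have h2 : ∀ i, a ≤ i → (fun i => if i ≤ a then p i else q (i - a)) i = q (i - a) := by
    intro i hi
    rcases Nat.lt_or_ge a i with h | h
    · simp [not_le.2 h]
    · obtain rfl : i = a := by omega
      simp [h0]
  refine ⟨fun i j hi hj hij => ?_, fun i j hij hj => ?_⟩
  · rcases Nat.lt_or_ge i a with hi' | hi' <;> rcases Nat.lt_or_ge a j with hj' | hj'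
    · rw [h1 i hi'.le, h2 j hj'.le] at hij
      exact absurd hij (hne i (j - a) hi' (by omega) (by omega))
    · rw [h1 i hi'.le, h1 j hj'] at hij
      exact hp.1 i j hi'.le hj' hij
    · rw [h2 i hi', h2 j hj'.le] at hij
      have := hq.1 _ _ (by omega) (by omega) hij; omega
    · rcases Nat.lt_or_ge j a with hj'' | hj''
      · rcases Nat.lt_or_ge a i with hi'' | hi''
        · rw [h2 i hi', h1 j hj'] at hij
          exact absurd hij.symm (hne j (i - a) hj'' (by omega) (by omega))
        · rw [h1 i hi'', h1 j hj'] at hij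
          exact hp.1 i j hi'' hj' hij
      · rw [h2 i hi', h2 j hj''] at hij
        have := hq.1 _ _ (by omega) (by omega) hij; omega
  · rcases Nat.lt_or_ge i a with hi' | hi' <;> rcases Nat.lt_or_ge a j with hj' | hj'
    · rw [h1 i hi'.le, h2 j hj'.le]
      exact ⟨fun h => absurd h (hnadj i (j - a) hi' (by omega) (by omega)), fun h => by omega⟩
    · rw [h1 i hi'.le, h1 j hj']; exact hp.2 i j hij hj'
    · rw [h2 i hi', h2 j hj'.le, hq.2 _ _ (by omega) (by omega)]; omega
    · omega

end PurePairs

/-! ### Induced links of prescribed length -/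

namespace PurePairs

open Finset
open scoped Classical

variable {V : Type*} {G : SimpleGraph V} {α β : ℝ}

/-- Markov's inequality, from counting the pairs `(r, b)` with `K r b` in two ways. -/
lemma card_bad_le {L B : Finset V} {K : V → V → Prop} {c c' : ℝ}
    (hK : ∀ r ∈ L, (#(B.filter (K r)) : ℝ) ≤ c) :
    c' * #(B.filter fun b => c' < (#(L.filter fun r => K r b) : ℝ)) ≤ c * #L := by
  have h1 : ∑ r ∈ L, #(B.filter (K r)) = ∑ b ∈ B, #(L.filter fun r => K r b) :=
    sum_card_bipartiteAbove_eq_sum_card_bipartiteBelow K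
  have h2 : (∑ r ∈ L, (#(B.filter (K r)) : ℝ)) = ∑ b ∈ B, (#(L.filter fun r => K r b) : ℝ) := by
    exact_mod_cast h1
  calc c' * #(B.filter fun b => c' < (#(L.filter fun r => K r b) : ℝ))
      = ∑ b ∈ B.filter (fun b => c' < (#(L.filter fun r => K r b) : ℝ)), c' := by
        rw [sum_const, nsmul_eq_mul, mul_comm]
    _ ≤ ∑ b ∈ B.filter (fun b => c' < (#(L.filter fun r => K r b) : ℝ)),
        (#(L.filter fun r => K r b) : ℝ) := sum_le_sum fun b hb => (mem_filter.1 hb).2.le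
    _ ≤ ∑ b ∈ B, (#(L.filter fun r => K r b) : ℝ) :=
        sum_le_sum_of_subset_of_nonneg (filter_subset _ _) fun _ _ _ => by positivity
    _ = ∑ r ∈ L, (#(B.filter (K r)) : ℝ) := h2.symm
    _ ≤ ∑ _r ∈ L, c := sum_le_sum hK
    _ = c * #L := by rw [sum_const, nsmul_eq_mul, mul_comm]

/-- Every `r ∈ L` is the end of an induced path of length `j` from `A` through `R`, whose other
vertices are anticomplete to `Rest`. -/
def Reach (G : SimpleGraph V) (A R : Finset V) (j : ℕ) (L Rest : Finset V) : Prop :=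
  ∀ r ∈ L, ∃ p, IndPath G p j ∧ p 0 ∈ A ∧ p j = r ∧ (∀ i, 0 < i → i ≤ j → p i ∈ R) ∧
    ∀ i < j, p i ∉ Rest ∧ ∀ q ∈ Rest, ¬ G.Adj (p i) q

/-- Let `X ⊆ L` be a smallest set that covers a third of `Rest`. It covers at most `1/3 + 1/6` of
it, by removing one vertex and using `6β ≤ #Rest`. The covered part is the next layer and the
uncovered part the new remainder; `X` has no neighbour in the latter, so the extended paths stay
induced and away from it. -/
lemma Reach.step (h : Coh G α β) (hβ : 0 < β) {A R L Rest : Finset V} {j : ℕ}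
    (hr : Reach G A R j L Rest) (hL : α ≤ (#L : ℝ)) (hd : Disjoint L Rest) (hRest : Rest ⊆ R)
    (hc : 6 * β ≤ (#Rest : ℝ)) (hdeg : ∀ x ∈ L, (#(nv G x Rest) : ℝ) ≤ β) :
    ∃ L' ⊆ Rest, ∃ Rest' ⊆ Rest, Disjoint L' Rest' ∧ (#Rest : ℝ) ≤ 3 * #L' ∧
      (#Rest : ℝ) ≤ 3 * #Rest' ∧ Reach G A R (j + 1) L' Rest' := by
  let F : Finset (Finset V) := L.powerset.filter fun X => (#Rest : ℝ) ≤ 3 * #(nb G X Rest)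
  have hF : F.Nonempty := by
    refine ⟨L, mem_filter.2 ⟨mem_powerset.2 Subset.rfl, ?_⟩⟩
    have := h.card_nb_gt hd hL
    linarith
  obtain ⟨X, hX, hmin⟩ := exists_min_image F card hF
  simp only [F, mem_filter, mem_powerset] at hX hmin
  obtain ⟨hXL, hXc⟩ := hX
  have hXne : X.Nonempty := by
    rw [nonempty_iff_ne_empty]
    rintro rfl
    simp [nb] at hXc
    simp [hXc] at hc
    linarith
  obtain ⟨x, hx⟩ := hXne
  have hlt : 3 * (#(nb G (X.erase x) Rest) : ℝ) ≤ #Rest := by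
    by_contra hcon
    push Not at hcon
    have := hmin (X.erase x) ⟨(erase_subset _ _).trans hXL, hcon.le⟩
    have := card_erase_lt_of_mem hx
    omega
  have hsub : nb G X Rest ⊆ nb G (X.erase x) Rest ∪ nv G x Rest := by
    intro y hy
    obtain ⟨hy, z, hz, hzy⟩ := mem_nb.1 hy
    by_cases hzx : z = x
    · subst hzx; exact mem_union_right _ (mem_nv.2 ⟨hy, hzy⟩)
    · exact mem_union_left _ (mem_nb.2 ⟨hy, z, mem_erase.2 ⟨hzx, hz⟩, hzy⟩)
  have h1 : (#(nb G X Rest) : ℝ) ≤ #(nb G (X.erase x) Rest) + #(nv G x Rest) := by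
    exact_mod_cast (card_le_card hsub).trans (card_union_le _ _)
  have h2 := hdeg x (hXL hx)
  refine ⟨nb G X Rest, nb_subset _ _, Rest \ nb G X Rest, sdiff_subset, disjoint_sdiff, hXc, ?_, ?_⟩
  · have := card_sdiff_ge Rest (nb G X Rest)
    linarith
  · intro r hrL
    obtain ⟨hrR, z, hz, hzr⟩ := mem_nb.1 hrL
    obtain ⟨p, hp, hp0, hpj, hpR, hpRest⟩ := hr z (hXL hz)
    obtain ⟨q, hq, hqp, hqr⟩ := hp.snoc (v := r)
      (fun i hi => by
        rcases Nat.lt_or_ge i j with h | h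
        · exact fun he => (hpRest i h).1 (he ▸ hrR)
        · obtain rfl : i = j := by omega
          rw [hpj]; rintro rfl
          exact disjoint_left.1 hd (hXL hz) hrR)
      (by rw [hpj]; exact hzr) (fun i hi => (hpRest i hi).2 r hrR)
    refine ⟨q, hq, by rw [hqp 0 (by omega)]; exact hp0, hqr, fun i hi0 hi => ?_, fun i hi => ?_⟩
    · rcases Nat.lt_or_ge j i with h | h
      · obtain rfl : i = j + 1 := by omega
        rw [hqr]; exact hRest hrR
      · rw [hqp i h]; exact hpR i hi0 h
    · rw [hqp i (by omega)]
      rcases Nat.lt_or_ge i j with h | h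
      · exact ⟨fun hm => (hpRest i h).1 (mem_sdiff.1 hm).1,
          fun y hy => (hpRest i h).2 y (mem_sdiff.1 hy).1⟩
      · obtain rfl : i = j := by omega
        rw [hpj]
        refine ⟨fun hm => disjoint_left.1 hd (hXL hz) (mem_sdiff.1 hm).1, fun y hy hzy => ?_⟩
        exact (mem_sdiff.1 hy).2 (mem_nb.2 ⟨(mem_sdiff.1 hy).1, z, hz, hzy⟩)

lemma Coh.exists_reach (h : Coh G α β) (hβ : 0 < β) (hαβ : α ≤ β) {A R U : Finset V}
    (hA : A ⊆ U) (hR : R ⊆ U) (hd : Disjoint A R) (hdeg : ∀ x ∈ U, (#(nv G x U) : ℝ) ≤ β) {y : ℝ}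
    (hy : 6 * β ≤ y) (hyA : y ≤ #A) (j : ℕ) (hyR : y * 3 ^ j ≤ #R) :
    ∃ L Rest, L ⊆ U ∧ Rest ⊆ R ∧ Disjoint L Rest ∧ y ≤ #L ∧ (#R : ℝ) ≤ 3 ^ j * #Rest ∧
      Reach G A R j L Rest := by
  induction j with
  | zero =>
    refine ⟨A, R, hA, Subset.rfl, hd, hyA, by simp, fun r hr => ⟨fun _ => r, indPath_zero _, hr, rfl,
      fun i h0 h1 => by omega, fun i hi => by omega⟩⟩
  | succ j ih =>
    have h3 : (0 : ℝ) < 3 ^ j := by positivity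
    have hy0 : 0 < y := by linarith
    obtain ⟨L, Rest, hLU, hRest, hdis, hyL, hRc, hreach⟩ := ih (by
      refine le_trans ?_ hyR
      rw [pow_succ]; nlinarith)
    have hyRest : 3 * y ≤ #Rest := by
      have : 3 ^ j * (3 * y) ≤ 3 ^ j * (#Rest : ℝ) := by
        calc _ = y * 3 ^ (j + 1) := by ring
          _ ≤ _ := hyR.trans hRc
      exact le_of_mul_le_mul_left this h3
    obtain ⟨L', hL', Rest', hRest', hd', hc1, hc2, hr'⟩ := hreach.step h hβ (by linarith) hdis hRest
      (by linarith) (fun x hx => (card_nv_mono x (hRest.trans hR)).trans (hdeg x (hLU hx)))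
    refine ⟨L', Rest', hL'.trans (hRest.trans hR), hRest'.trans hRest, hd', by linarith, ?_, hr'⟩
    calc (#R : ℝ) ≤ 3 ^ j * #Rest := hRc
      _ ≤ 3 ^ j * (3 * #Rest') := mul_le_mul_of_nonneg_left hc2 h3.le
      _ = 3 ^ (j + 1) * #Rest' := by ring

/-- Only few `b` conflict with the chosen paths of many `r ∈ L`. -/
lemma Reach.exists_paths {A R L Rest B U : Finset V} {j : ℕ} {Δ C : ℝ} (hr : Reach G A R j L Rest)
    (hA : A ⊆ U) (hR : R ⊆ U) (hB : B ⊆ U) (hdeg : ∀ x ∈ U, (#(nv G x U) : ℝ) ≤ Δ)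
    {conf : V → V → Prop} (hconf : ∀ a ∈ A, (#(B.filter (conf a)) : ℝ) ≤ C * Δ) :
    ∃ K : V → V → Prop, (∀ r ∈ L, (#(B.filter (K r)) : ℝ) ≤ (C + j) * Δ) ∧
      ∀ r ∈ L, ∀ b ∈ B, ¬ K r b → ∃ p, IndPath G p j ∧ p 0 ∈ A ∧ p j = r ∧
        (∀ i, 0 < i → i ≤ j → p i ∈ R) ∧
        (∀ i < j, p i ∉ Rest ∧ ∀ q ∈ Rest, ¬ G.Adj (p i) q) ∧
        ¬ conf (p 0) b ∧ ∀ i < j, ¬ G.Adj (p i) b := by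
  -- One path is fixed for each `r`. Adjacency of the last vertex `r` itself to `b` is not part of
  -- `K`; in the link it is excluded, or wanted, separately.
  choose! p hp using hr
  refine ⟨fun r b => conf (p r 0) b ∨ ∃ i < j, G.Adj (p r i) b, fun r hrL => ?_,
    fun r hrL b hb hK => ?_⟩
  · have hsub : (B.filter fun b => conf (p r 0) b ∨ ∃ i < j, G.Adj (p r i) b) ⊆
        B.filter (conf (p r 0)) ∪ nb G ((range j).image (p r)) U := by
      intro b hb
      obtain ⟨hb, h | ⟨i, hi, hib⟩⟩ := mem_filter.1 hb
      · exact mem_union_left _ (mem_filter.2 ⟨hb, h⟩)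
      · exact mem_union_right _ (mem_nb.2 ⟨hB hb, p r i, mem_image_of_mem _ (mem_range.2 hi), hib⟩)
    have h1 := hconf (p r 0) (hp r hrL).2.1
    have hmem : ∀ x ∈ (range j).image (p r), x ∈ U := by
      intro x hx
      obtain ⟨i, hi, rfl⟩ := mem_image.1 hx
      rcases Nat.eq_zero_or_pos i with rfl | h0
      · exact hA (hp r hrL).2.1
      · exact hR ((hp r hrL).2.2.2.1 i h0 (mem_range.1 hi).le)
    have h2 := card_nb_le (G := G) ((range j).image (p r)) U (fun x hx => hdeg x (hmem x hx))
    have h3 : (#((range j).image (p r)) : ℝ) ≤ j := by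
      exact_mod_cast card_image_le.trans (card_range j).le
    have h4 : (#(B.filter fun b => conf (p r 0) b ∨ ∃ i < j, G.Adj (p r i) b) : ℝ) ≤
        #(B.filter (conf (p r 0))) + #(nb G ((range j).image (p r)) U) := by
      exact_mod_cast (card_le_card hsub).trans (card_union_le _ _)
    rcases Nat.eq_zero_or_pos j with rfl | hj
    · simp [nb] at h4 ⊢
      linarith
    · have hΔ : 0 ≤ Δ := le_trans (by positivity) (hdeg (p r 0) (hA (hp r hrL).2.1))
      have h5 := mul_le_mul_of_nonneg_right h3 hΔ
      have h6 : (#(B.filter fun b => conf (p r 0) b ∨ ∃ i < j, G.Adj (p r i) b) : ℝ) ≤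
          (C + j) * Δ := by
        rw [add_mul]
        linarith
      convert h6
  · obtain ⟨h1, h2, h3, h4, h5⟩ := hp r hrL
    simp only [not_or, not_exists, not_and] at hK
    exact ⟨p r, h1, h2, h3, h4, h5, hK.1, hK.2⟩

/-- `S` will be half of the neighbourhood of a vertex of degree at least `Δ / s`. If `S` is small,
expansion by `s ^ 2` gives at least `s * Δ / 2` neighbours; if it is large, coherence gives nearly
all of `L`. The bound `(C' + 2) * Δ` leaves room to avoid `C' * Δ` conflicts and the neighbourhoods
of two further vertices. -/
lemma Coh.card_nb_gt_of_expand (h : Coh G α β) {s Δ C' y : ℝ} (hΔ : 1 ≤ Δ)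
    (hΔβ : Δ ≤ β) (hC'y : (C' + 3) * β ≤ y) (hC's : 2 * (C' + 2) < s) (hC'0 : 0 < C')
    {L K S Rest : Finset V} (hLd : Disjoint L Rest) (hLy : y ≤ #L) (hS : S ⊆ Rest \ K)
    (hSΔ : Δ ≤ 2 * s * #S)
    (hexp : ∀ X ⊆ Rest \ K, (#X : ℝ) ≤ α → s ^ 2 * #X ≤ #(nb G X (L \ (K ∪ X)))) :
    (C' + 2) * Δ < #(nb G S L) := by
  rcases le_or_gt (#S : ℝ) α with hSα | hSα
  · have h1 := hexp S hS hSα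
    have h2 : (#(nb G S (L \ (K ∪ S))) : ℝ) ≤ #(nb G S L) := by
      exact_mod_cast card_le_card (filter_subset_filter _ sdiff_subset)
    have h3 : s * Δ ≤ s * (2 * s * #S) := mul_le_mul_of_nonneg_left hSΔ (by linarith)
    have h4 : 2 * (C' + 2) * Δ < s * Δ := mul_lt_mul_of_pos_right hC's (by linarith)
    have h5 : s * (2 * s * #S) = 2 * (s ^ 2 * #S) := by ring
    linarith
  · have h1 := h.card_nb_gt (A := S) (B := L)
      (disjoint_of_subset_left (hS.trans sdiff_subset) hLd.symm) hSα.le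
    have h2 : (C' + 2) * Δ ≤ (C' + 2) * β := mul_le_mul_of_nonneg_left hΔβ (by linarith)
    linarith

/-- Averaging: there are at most `c * Δ * #U` conflicting pairs, and `C'` is chosen so large that at
most a quarter of `B` can take part in more than `C' * Δ` of them. With two layers, half of `B`
remains usable. -/
lemma card_bad_quarter {B U L : Finset V} {N : V → V → Prop} {C C' y c Δ : ℝ} {j : ℕ} (hc0 : 0 ≤ c)
    (hc : c ≤ C + j + 1) (hLU : L ⊆ U) (hN : ∀ r ∈ L, (#(B.filter (N r)) : ℝ) ≤ c * Δ)
    (hΔ : 1 ≤ Δ) (hyB : y ≤ #B) (hC' : 4 * (C + j + 1) * #U ≤ C' * y) (hC'0 : 0 < C') :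
    4 * (#(B.filter fun b => C' * Δ < (#(L.filter fun r => N r b) : ℝ)) : ℝ) ≤ #B := by
  have h1 := card_bad_le (c' := C' * Δ) hN
  have h2 : (#L : ℝ) ≤ #U := by exact_mod_cast card_le_card hLU
  have h3 : c * Δ * #L ≤ (C + j + 1) * Δ * #U := by
    have h0 : 0 ≤ C + j + 1 := hc0.trans hc
    gcongr
  have h4 : C' * Δ * (4 * (#(B.filter fun b => C' * Δ < (#(L.filter fun r => N r b) : ℝ)) : ℝ)) ≤
      C' * Δ * #B := by
    calc _ ≤ 4 * ((C + j + 1) * Δ * #U) := by linarith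
      _ = Δ * (4 * (C + j + 1) * #U) := by ring
      _ ≤ Δ * (C' * y) := by gcongr
      _ ≤ Δ * (C' * #B) := by gcongr
      _ = _ := by ring
  exact le_of_mul_le_mul_left h4 (by positivity)

set_option maxHeartbeats 1000000 in
/-- In a regular linear set, any two linear sets are joined through a third one by an induced path
of any prescribed length at least three. -/
lemma Coh.exists_link (h : Coh G α β) (hα : 0 < α) {s : ℝ} (hs : 1 ≤ s) (hαβ : α * s ^ 2 = β)
    {U : Finset V} {Δ ζ : ℝ} (hΔ : 1 ≤ Δ) (hΔβ : Δ ≤ β) (hdeg : ∀ u ∈ U, (#(nv G u U) : ℝ) ≤ Δ)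
    (hreg : ∀ Y ⊆ U, ζ ≤ #Y → ∃ y ∈ Y, Δ ≤ s * #(nv G y Y))
    {A B R : Finset V} (hA : A ⊆ U) (hB : B ⊆ U) (hR : R ⊆ U) (hAR : Disjoint A R)
    (hBR : Disjoint B R) {conf : V → V → Prop} {C C' y : ℝ}
    (hconf : ∀ a ∈ A, (#(B.filter (conf a)) : ℝ) ≤ C * Δ)
    (hconf_eq : ∀ a, conf a a) (j : ℕ) (hC : 0 ≤ C) (hC'0 : 0 < C')
    (hy : 8 * β ≤ y) (hyζ : 4 * ζ ≤ y) (hyA : y ≤ #A) (hyB : y ≤ #B) (hyR : y * 3 ^ (j + 1) ≤ #R)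
    (hC' : 4 * (C + j + 1) * #U ≤ C' * y) (hC'y : (C' + 3) * β ≤ y) (hC's : 2 * (C' + 2) < s) :
    ∃ p, IndPath G p (j + 3) ∧ p 0 ∈ A ∧ p (j + 3) ∈ B ∧ ¬ conf (p 0) (p (j + 3)) ∧
      ∀ i, 0 < i → i < j + 3 → p i ∈ R := by
  have ht : 1 ≤ s ^ 2 := one_le_pow₀ hs
  have hαβ' : α ≤ β := hαβ ▸ le_mul_of_one_le_right hα.le ht
  have hβ : 0 < β := by linarith
  have hy0 : 0 < y := by linarith
  have hdegβ : ∀ u ∈ U, (#(nv G u U) : ℝ) ≤ β := fun u hu => (hdeg u hu).trans hΔβ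
  have h3j : (0 : ℝ) < 3 ^ j := by positivity
  -- the two consecutive layers and the remainder
  obtain ⟨L₁, Rest₁, hL₁U, hRest₁, hdis₁, hyL₁, hRc₁, hreach₁⟩ := h.exists_reach hβ hαβ' hA hR hAR
    hdegβ (by linarith) hyA j (le_trans (by rw [pow_succ]; nlinarith) hyR)
  have hyRest₁ : 3 * y ≤ #Rest₁ := by
    have : 3 ^ j * (3 * y) ≤ 3 ^ j * (#Rest₁ : ℝ) := by
      calc _ = y * 3 ^ (j + 1) := by ring
        _ ≤ _ := hyR.trans hRc₁
    exact le_of_mul_le_mul_left this h3j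
  obtain ⟨L₂, hL₂, Rest, hRest, hdis₂, hc1, hc2, hreach₂⟩ := hreach₁.step h hβ (by linarith) hdis₁
    hRest₁ (by linarith)
    (fun x hx => (card_nv_mono x (hRest₁.trans hR)).trans (hdegβ x (hL₁U hx)))
  have hL₂U : L₂ ⊆ U := hL₂.trans (hRest₁.trans hR)
  have hRestR : Rest ⊆ R := hRest.trans hRest₁
  have hRestU : Rest ⊆ U := hRestR.trans hR
  have hdis₁' : Disjoint L₁ Rest := disjoint_of_subset_right hRest hdis₁
  have hyRest : y ≤ #Rest := by linarith
  have hyL₂ : y ≤ #L₂ := by linarith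
  obtain ⟨K₁, hK₁R, hK₁, hexp₁⟩ := h.exists_core hα ht hαβ Rest L₁ (by linarith)
  obtain ⟨K₂, hK₂R, hK₂, hexp₂⟩ := h.exists_core hα ht hαβ Rest L₂ (by linarith)
  -- Both cores are removed, so that small subsets of `P` expand into `L₁` and into `L₂`.
  set P := Rest \ (K₁ ∪ K₂) with hP
  have hPRest : P ⊆ Rest := sdiff_subset
  have hPU : P ⊆ U := hPRest.trans hRestU
  have hPc : y / 2 ≤ #P := by
    have h1 := card_sdiff_ge Rest (K₁ ∪ K₂)
    have h2 : (#(K₁ ∪ K₂) : ℝ) ≤ #K₁ + #K₂ := by exact_mod_cast card_union_le _ _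
    linarith
  -- These vertices have nearly full degree inside `P`. By regularity fewer than `ζ` vertices of `P`
  -- lack the property, so `P'` still has size `α` and sees almost all of `B`.
  set P' := P.filter fun r => Δ ≤ s * #(nv G r P) with hP'
  have hP'c : α ≤ #P' := by
    have h1 : (#(P \ P') : ℝ) < ζ := by
      by_contra hcon
      push Not at hcon
      obtain ⟨r, hr, hrΔ⟩ := hreg (P \ P') (sdiff_subset.trans hPU) hcon
      obtain ⟨hrP, hrP'⟩ := mem_sdiff.1 hr
      refine hrP' (mem_filter.2 ⟨hrP, hrΔ.trans ?_⟩)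
      exact mul_le_mul_of_nonneg_left (card_nv_mono r sdiff_subset) (by linarith)
    have h2 := card_sdiff_ge P P'
    linarith
  obtain ⟨N₁, hN₁, hpath₁⟩ := hreach₁.exists_paths hA hR hB hdeg hconf
  obtain ⟨N₂, hN₂, hpath₂⟩ := hreach₂.exists_paths hA hR hB hdeg hconf
  have hbad₁ := card_bad_quarter (c := C + j) (by positivity) (by linarith) hL₁U hN₁ hΔ hyB hC' hC'0
  have hbad₂ := card_bad_quarter (c := C + (j + 1 : ℕ)) (by positivity) (by push_cast; linarith) hL₂U hN₂
    hΔ hyB hC' hC'0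
  obtain ⟨b, hbB, hb₁, hb₂, r₄, hr₄, hr₄b⟩ : ∃ b ∈ B,
      (#(L₁.filter fun r => N₁ r b) : ℝ) ≤ C' * Δ ∧ (#(L₂.filter fun r => N₂ r b) : ℝ) ≤ C' * Δ ∧
      ∃ r ∈ P', G.Adj r b := by
    by_contra hcon
    push Not at hcon
    have hsub : B ⊆ (B.filter fun b => C' * Δ < (#(L₁.filter fun r => N₁ r b) : ℝ)) ∪
        (B.filter fun b => C' * Δ < (#(L₂.filter fun r => N₂ r b) : ℝ)) ∪ (B \ nb G P' B) := by
      intro b hb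
      by_contra hnot
      simp only [mem_union, mem_filter, mem_sdiff, not_or, not_and, not_lt, not_not] at hnot
      obtain ⟨⟨h1, h2⟩, h3⟩ := hnot
      obtain ⟨_, r, hr, hrb⟩ := mem_nb.1 (h3 hb)
      exact hcon b hb (h1 hb) (h2 hb) r hr hrb
    have h1 : (#B : ℝ) ≤ #(B.filter fun b => C' * Δ < (#(L₁.filter fun r => N₁ r b) : ℝ)) +
        #(B.filter fun b => C' * Δ < (#(L₂.filter fun r => N₂ r b) : ℝ)) + #(B \ nb G P' B) := by
      have := (card_le_card hsub).trans ((card_union_le _ _).trans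
        (Nat.add_le_add_right (card_union_le _ _) _))
      exact_mod_cast this
    have h2 : (#(B \ nb G P' B) : ℝ) < β := by
      refine h P' _ ?_ (fun a ha b hb hab => ?_) hP'c
      · exact disjoint_of_subset_left ((filter_subset _ _).trans (hPRest.trans hRestR))
          (disjoint_of_subset_right sdiff_subset hBR.symm)
      · exact (mem_sdiff.1 hb).2 (mem_nb.2 ⟨(mem_sdiff.1 hb).1, a, ha, hab⟩)
    linarith
  have hr₄P : r₄ ∈ P := (mem_filter.1 hr₄).1
  have hr₄Δ : Δ ≤ s * #(nv G r₄ P) := (mem_filter.1 hr₄).2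
  have hbU := hB hbB
  have hBnotR : ∀ v ∈ R, v ≠ b := fun v hv he => disjoint_left.1 hBR hbB (he ▸ hv)
  have hsplit : (#(nv G r₄ P) : ℝ) = #((nv G r₄ P).filter fun r => G.Adj r b) +
      #((nv G r₄ P).filter fun r => ¬ G.Adj r b) := by
    have := card_filter_add_card_filter_not (s := nv G r₄ P) (fun r => G.Adj r b)
    exact_mod_cast this.symm
  -- The parity of the length is settled here. If half of the neighbours of `r₄` in `P` are adjacent
  -- to `b`, one of them serves as the last inner vertex, after a path of length `j + 1` to `L₂`. If
  -- half are nonadjacent to `b`, one of them followed by `r₄` ends the path, after a path of length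
  -- `j` to `L₁`. Either way the length is `j + 3`.
  have hcase : Δ ≤ 2 * s * #((nv G r₄ P).filter fun r => G.Adj r b) ∨
      Δ ≤ 2 * s * #((nv G r₄ P).filter fun r => ¬ G.Adj r b) := by
    by_contra hcon
    push Not at hcon
    rw [hsplit, mul_add] at hr₄Δ
    linarith
  rcases hcase with hS | hS
  · set S := (nv G r₄ P).filter fun r => G.Adj r b with hSdef
    have hSP : S ⊆ P := (filter_subset _ _).trans (nv_subset _ _)
    have hbig := h.card_nb_gt_of_expand hΔ hΔβ hC'y hC's hC'0 hdis₂ hyL₂ (hSP.trans (sdiff_subset_sdiff Subset.rfl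
      subset_union_right)) hS hexp₂
    -- More than `(C' + 2) * Δ` vertices of `L₂` are available, and at most `C' * Δ` conflict with
    -- `b` while at most `Δ` are adjacent to it.
    obtain ⟨r₁, hr₁, hr₁not⟩ : ∃ r ∈ nb G S L₂,
        r ∉ (L₂.filter fun r => N₂ r b) ∪ nv G b U := by
      by_contra hcon
      push Not at hcon
      have h1 : (#(nb G S L₂) : ℝ) ≤ #(L₂.filter fun r => N₂ r b) + #(nv G b U) := by
        exact_mod_cast (card_le_card hcon).trans (card_union_le _ _)
      have := hdeg b hbU
      linarith
    obtain ⟨hr₁L, r₃, hr₃S, hr₃r₁⟩ := mem_nb.1 hr₁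
    simp only [mem_union, mem_filter, mem_nv, not_or, not_and] at hr₁not
    obtain ⟨p, hp, hp0, hpj, hpR, hpRest, hpc, hpb⟩ := hpath₂ r₁ hr₁L b hbB (hr₁not.1 hr₁L)
    have hr₃Rest : r₃ ∈ Rest := hPRest (hSP hr₃S)
    obtain ⟨q, hq, hqp, hqr⟩ := hp.snoc (v := r₃)
      (fun i hi => by
        rcases Nat.lt_or_ge i (j + 1) with h | h
        · exact fun he => (hpRest i h).1 (he ▸ hr₃Rest)
        · obtain rfl : i = j + 1 := by omega
          rw [hpj]; rintro rfl
          exact disjoint_left.1 hdis₂ hr₁L hr₃Rest)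
      (by rw [hpj]; exact hr₃r₁.symm) (fun i hi => (hpRest i hi).2 r₃ hr₃Rest)
    have hq0 : q 0 = p 0 := hqp 0 (by omega)
    have hqR : ∀ i, 0 < i → i ≤ j + 2 → q i ∈ R := by
      intro i h0 hi
      rcases Nat.lt_or_ge (j + 1) i with h | h
      · obtain rfl : i = j + 2 := by omega
        rw [hqr]; exact hRestR hr₃Rest
      · rw [hqp i h]; exact hpR i h0 h
    obtain ⟨q', hq', hqq', hq'b⟩ := hq.snoc (v := b)
      (fun i hi => by
        rcases Nat.eq_zero_or_pos i with rfl | h0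
        · rw [hq0]; intro he; rw [he] at hpc; exact hpc (hconf_eq b)
        · exact hBnotR _ (hqR i h0 hi))
      (by rw [hqr]; exact (mem_filter.1 hr₃S).2)
      (fun i hi => by
        rw [hqp i (by omega)]
        rcases Nat.lt_or_ge i (j + 1) with h | h
        · exact hpb i h
        · obtain rfl : i = j + 1 := by omega
          rw [hpj]; exact fun hadj => hr₁not.2 (hL₂U hr₁L) hadj.symm)
    refine ⟨q', hq', ?_, ?_, ?_, fun i h0 hi => ?_⟩
    · rw [hqq' 0 (by omega), hq0]; exact hp0
    · rw [hq'b]; exact hbB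
    · rw [hqq' 0 (by omega), hq0, hq'b]; exact hpc
    · rw [hqq' i (by omega)]; exact hqR i h0 (by omega)
  · set S := (nv G r₄ P).filter fun r => ¬ G.Adj r b with hSdef
    have hSP : S ⊆ P := (filter_subset _ _).trans (nv_subset _ _)
    have hbig := h.card_nb_gt_of_expand hΔ hΔβ hC'y hC's hC'0 hdis₁' hyL₁ (hSP.trans (sdiff_subset_sdiff Subset.rfl
      subset_union_left)) hS hexp₁
    have hr₄U := hPU hr₄P
    -- Here `r₁` must also avoid the neighbours of `r₄`, which uses up the second spare `Δ`.
    obtain ⟨r₁, hr₁, hr₁not⟩ : ∃ r ∈ nb G S L₁,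
        r ∉ (L₁.filter fun r => N₁ r b) ∪ (nv G b U ∪ nv G r₄ U) := by
      by_contra hcon
      push Not at hcon
      have h1 : (#(nb G S L₁) : ℝ) ≤ #(L₁.filter fun r => N₁ r b) +
          (#(nv G b U) + #(nv G r₄ U)) := by
        have := (card_le_card hcon).trans ((card_union_le _ _).trans
          (Nat.add_le_add_left (card_union_le _ _) _))
        exact_mod_cast this
      have := hdeg b hbU
      have := hdeg r₄ hr₄U
      linarith
    obtain ⟨hr₁L, r₃, hr₃S, hr₃r₁⟩ := mem_nb.1 hr₁
    simp only [mem_union, mem_filter, mem_nv, not_or, not_and] at hr₁not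
    obtain ⟨hr₁N, hr₁b, hr₁r₄⟩ := hr₁not
    obtain ⟨p, hp, hp0, hpj, hpR, hpRest, hpc, hpb⟩ := hpath₁ r₁ hr₁L b hbB (hr₁N hr₁L)
    have hpRest' : ∀ i < j, p i ∉ Rest ∧ ∀ q ∈ Rest, ¬ G.Adj (p i) q := fun i hi =>
      ⟨fun hm => (hpRest i hi).1 (hRest hm), fun q hq => (hpRest i hi).2 q (hRest hq)⟩
    have hr₃Rest : r₃ ∈ Rest := hPRest (hSP hr₃S)
    have hr₄Rest : r₄ ∈ Rest := hPRest hr₄P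
    have hr₃r₄ : G.Adj r₄ r₃ := (mem_nv.1 (mem_filter.1 hr₃S).1).2
    have hnot : ∀ v ∈ Rest, ∀ i ≤ j, p i ≠ v := by
      intro v hv i hi
      rcases Nat.lt_or_ge i j with h | h
      · exact fun he => (hpRest' i h).1 (he ▸ hv)
      · obtain rfl : i = j := by omega
        rw [hpj]; rintro rfl
        exact disjoint_left.1 hdis₁' hr₁L hv
    obtain ⟨q, hq, hqp, hqr⟩ := hp.snoc (v := r₃) (hnot r₃ hr₃Rest)
      (by rw [hpj]; exact hr₃r₁.symm) (fun i hi => (hpRest' i hi).2 r₃ hr₃Rest)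
    obtain ⟨q₂, hq₂, hqq₂, hq₂r⟩ := hq.snoc (v := r₄)
      (fun i hi => by
        rcases Nat.lt_or_ge j i with h | h
        · obtain rfl : i = j + 1 := by omega
          rw [hqr]; exact hr₃r₄.ne'
        · rw [hqp i h]; exact hnot r₄ hr₄Rest i h)
      (by rw [hqr]; exact hr₃r₄.symm)
      (fun i hi => by
        rw [hqp i (by omega)]
        rcases Nat.lt_or_ge i j with h | h
        · exact (hpRest' i h).2 r₄ hr₄Rest
        · obtain rfl : i = j := by omega
          rw [hpj]; exact fun hadj => hr₁r₄ (hL₁U hr₁L) hadj.symm)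
    have hq0 : q₂ 0 = p 0 := by rw [hqq₂ 0 (by omega), hqp 0 (by omega)]
    have hqR : ∀ i, 0 < i → i ≤ j + 2 → q₂ i ∈ R := by
      intro i h0 hi
      rcases Nat.lt_or_ge (j + 1) i with h | h
      · obtain rfl : i = j + 2 := by omega
        rw [hq₂r]; exact hRestR hr₄Rest
      · rw [hqq₂ i h]
        rcases Nat.lt_or_ge j i with h' | h'
        · obtain rfl : i = j + 1 := by omega
          rw [hqr]; exact hRestR hr₃Rest
        · rw [hqp i h']; exact hpR i h0 h'
    obtain ⟨q', hq', hqq', hq'b⟩ := hq₂.snoc (v := b)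
      (fun i hi => by
        rcases Nat.eq_zero_or_pos i with rfl | h0
        · rw [hq0]; intro he; rw [he] at hpc; exact hpc (hconf_eq b)
        · exact hBnotR _ (hqR i h0 hi))
      (by rw [hq₂r]; exact hr₄b)
      (fun i hi => by
        rw [hqq₂ i (by omega)]
        rcases Nat.lt_or_ge j i with h | h
        · obtain rfl : i = j + 1 := by omega
          rw [hqr]; exact (mem_filter.1 hr₃S).2
        · rw [hqp i h]
          rcases Nat.lt_or_ge i j with h' | h'
          · exact hpb i h'
          · obtain rfl : i = j := by omega
            rw [hpj]; exact fun hadj => hr₁b (hL₁U hr₁L) hadj.symm)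
    refine ⟨q', hq', ?_, ?_, ?_, fun i h0 hi => ?_⟩
    · rw [hqq' 0 (by omega), hq0]; exact hp0
    · rw [hq'b]; exact hbB
    · rw [hqq' 0 (by omega), hq0, hq'b]; exact hpc
    · rw [hqq' i (by omega)]; exact hqR i h0 (by omega)

end PurePairs

/-! ### Hubs and conflicts -/

namespace PurePairs

open Finset
open scoped Classical

variable {V : Type*} {G : SimpleGraph V} {α β : ℝ}

/-- Adjacency inside `Y`. -/
def AdjIn (G : SimpleGraph V) (Y : Finset V) (a b : V) : Prop := a ∈ Y ∧ b ∈ Y ∧ G.Adj a b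

lemma AdjIn.mono {Y Z : Finset V} (h : Y ⊆ Z) {a b : V} (hab : AdjIn G Y a b) : AdjIn G Z a b :=
  ⟨h hab.1, h hab.2.1, hab.2.2⟩

lemma AdjIn.symm {Y : Finset V} {a b : V} (h : AdjIn G Y a b) : AdjIn G Y b a :=
  ⟨h.2.1, h.1, h.2.2.symm⟩

lemma reflTransGen_adjIn_mono {Y Z : Finset V} (h : Y ⊆ Z) {a b : V}
    (hab : Relation.ReflTransGen (AdjIn G Y) a b) : Relation.ReflTransGen (AdjIn G Z) a b := by
  induction hab with
  | refl => exact .refl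
  | tail _ hbc ih => exact ih.tail (hbc.mono h)

lemma reflTransGen_adjIn_symm {Y : Finset V} {a b : V}
    (hab : Relation.ReflTransGen (AdjIn G Y) a b) : Relation.ReflTransGen (AdjIn G Y) b a := by
  induction hab with
  | refl => exact .refl
  | tail _ hbc ih => exact (Relation.ReflTransGen.single hbc.symm).trans ih

/-- When a vertex `c` is appended, the path is cut at its first vertex equal or adjacent to `c`;
this keeps it induced. -/
lemma exists_indPath_of_reflTransGen {Y : Finset V} {u v : V} (hu : u ∈ Y)
    (h : Relation.ReflTransGen (AdjIn G Y) u v) :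
    ∃ p L, IndPath G p L ∧ p 0 = u ∧ p L = v ∧ ∀ i ≤ L, p i ∈ Y := by
  induction h with
  | refl => exact ⟨fun _ => u, 0, indPath_zero _, rfl, rfl, fun _ _ => hu⟩
  | @tail b c _ hbc ih =>
    obtain ⟨p, L, hp, hp0, hpL, hpY⟩ := ih
    have hex : ∃ i, i ≤ L ∧ (p i = c ∨ G.Adj (p i) c) := ⟨L, le_rfl, Or.inr (hpL ▸ hbc.2.2)⟩
    obtain ⟨hi, hic⟩ := Nat.find_spec hex
    have hmin : ∀ m < Nat.find hex, p m ≠ c ∧ ¬ G.Adj (p m) c := by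
      intro m hm
      have := Nat.find_min hex hm
      simp only [not_and, not_or] at this
      exact this (hm.le.trans hi)
    set i := Nat.find hex
    by_cases hc : p i = c
    · exact ⟨p, i, hp.take hi, hp0, hc, fun m hm => hpY m (hm.trans hi)⟩
    · obtain ⟨q, hq, hqp, hqc⟩ := (hp.take hi).snoc (v := c)
        (fun m hm => by
          rcases hm.lt_or_eq with h | h
          · exact (hmin m h).1
          · rw [h]; exact hc)
        (hic.resolve_left hc) (fun m hm => (hmin m hm).2)
      refine ⟨q, i + 1, hq, by rw [hqp 0 (by omega), hp0], hqc, fun m hm => ?_⟩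
      rcases Nat.lt_or_ge i m with h | h
      · obtain rfl : m = i + 1 := by omega
        rw [hqc]; exact hbc.2.1
      · rw [hqp m h]; exact hpY m (h.trans hi)

lemma IndPath.lt_card {p : ℕ → V} {L : ℕ} {Y : Finset V} (h : IndPath G p L)
    (hY : ∀ i ≤ L, p i ∈ Y) : L < #Y := by
  have h1 : #((range (L + 1)).image p) = L + 1 := by
    rw [card_image_of_injOn, card_range]
    intro i hi j hj hij
    simp only [coe_range, Set.mem_Iio] at hi hj
    exact h.1 i j (by omega) (by omega) hij
  have h2 : (range (L + 1)).image p ⊆ Y := by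
    intro x hx
    obtain ⟨i, hi, rfl⟩ := mem_image.1 hx
    exact hY i (by have := mem_range.1 hi; omega)
  have := card_le_card h2
  omega

/-- Following predecessors, the rank strictly decreases from at most `r`, so the route to the root
has at most `r + 1` vertices. -/
lemma IsRooted.exists_root {r : ℕ} {D : Finset V} (h : IsRooted G r D) :
    ∃ w, ∀ x ∈ D, ∃ Q ⊆ D, x ∈ Q ∧ w ∈ Q ∧ #Q ≤ r + 1 ∧
      Relation.ReflTransGen (AdjIn G Q) w x := by
  obtain ⟨-, w, f, hf⟩ := h
  refine ⟨w, ?_⟩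
  have key : ∀ m, ∀ x ∈ D, f x = m → ∃ Q ⊆ D, x ∈ Q ∧ w ∈ Q ∧ #Q ≤ m + 1 ∧
      Relation.ReflTransGen (AdjIn G Q) w x := by
    intro m
    induction m using Nat.strong_induction_on with
    | _ m ih =>
      intro x hx hm
      rcases (hf x hx).2 with rfl | ⟨y, hy, hyx, hlt⟩
      · exact ⟨{x}, by simpa using hx, by simp, by simp, by simp, .refl⟩
      · obtain ⟨Q, hQ, hyQ, hwQ, hc, hr⟩ := ih (f y) (by omega) y hy rfl
        refine ⟨insert x Q, insert_subset hx hQ, mem_insert_self _ _, mem_insert_of_mem hwQ,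
          (card_insert_le _ _).trans (by omega), ?_⟩
        refine Relation.ReflTransGen.tail (b := y) ?_
          ⟨mem_insert_of_mem hyQ, mem_insert_self _ _, hyx⟩
        exact reflTransGen_adjIn_mono (subset_insert _ _) hr
  intro x hx
  obtain ⟨Q, h1, h2, h3, h4, h5⟩ := key (f x) x hx rfl
  exact ⟨Q, h1, h2, h3, h4.trans (by have := (hf x hx).1; omega), h5⟩

/-- A set `W` covered by connected pairwise anticomplete sets `D ∈ 𝒟`, all anticomplete to `R`; the
set `Q D z` joins `z` to the root of `D`. -/
structure Hub (G : SimpleGraph V) (k : ℕ) (U W R : Finset V) (𝒟 : Finset (Finset V))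
    (Q : Finset V → V → Finset V) : Prop where
  WU : W ⊆ U
  RU : R ⊆ U
  WR : Disjoint W R
  DU : ∀ D ∈ 𝒟, D ⊆ U
  DW : ∀ D ∈ 𝒟, Disjoint D W
  DR : ∀ D ∈ 𝒟, Apart G D R
  DD : ∀ D ∈ 𝒟, ∀ D' ∈ 𝒟, D ≠ D' → Apart G D D'
  Qsub : ∀ D ∈ 𝒟, ∀ z ∈ W, Q D z ⊆ D
  Qcard : ∀ D ∈ 𝒟, ∀ z ∈ W, #(Q D z) ≤ k
  Qpath : ∀ D ∈ 𝒟, ∀ v ∈ W, ∀ z ∈ W, v ≠ z → ¬ G.Adj v z → ∃ p L, IndPath G p L ∧ p 0 = v ∧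
    p L = z ∧ 2 ≤ L ∧ L ≤ 2 * k + 1 ∧ ∀ i, 0 < i → i < L → p i ∈ Q D v ∪ Q D z

/-- Two vertices of a hub conflict if they coincide, are adjacent, or one is adjacent to the
root path of the other. -/
def Conf (G : SimpleGraph V) (𝒟 : Finset (Finset V)) (Q : Finset V → V → Finset V) (u z : V) : Prop :=
  u = z ∨ G.Adj u z ∨ ∃ D ∈ 𝒟, (∃ q ∈ Q D z, G.Adj u q) ∨ ∃ q ∈ Q D u, G.Adj z q

lemma Conf.symm {𝒟 : Finset (Finset V)} {Q : Finset V → V → Finset V} {u z : V}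
    (h : Conf G 𝒟 Q u z) : Conf G 𝒟 Q z u := by
  rcases h with h | h | ⟨D, hD, h | h⟩
  · exact Or.inl h.symm
  · exact Or.inr (Or.inl h.symm)
  · exact Or.inr (Or.inr ⟨D, hD, Or.inr h⟩)
  · exact Or.inr (Or.inr ⟨D, hD, Or.inl h⟩)

/-- For `v, z ∈ W` the two root paths in `D` meet at the root, so with `v` and `z` they form a
connected set of at most `2 * (r + 1) + 2` vertices. An induced path inside it is the required one.
-/
lemma exists_hub_of_cover {r : ℕ} {U W R : Finset V} {𝒟 : Finset (Finset V)} (hW : W ⊆ U)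
    (hR : R ⊆ U) (hWR : Disjoint W R)
    (hD : ∀ D ∈ 𝒟, IsRooted G r D ∧ D ⊆ U ∧ Disjoint D W ∧ (∀ z ∈ W, ∃ x ∈ D, G.Adj x z) ∧
      Apart G D R)
    (hDD : ∀ D ∈ 𝒟, ∀ D' ∈ 𝒟, D ≠ D' → Apart G D D') : ∃ Q, Hub G (r + 1) U W R 𝒟 Q := by
  have hex : ∀ D ∈ 𝒟, ∃ Q : V → Finset V, ∃ w, ∀ z ∈ W, Q z ⊆ D ∧ #(Q z) ≤ r + 1 ∧
      ∃ x ∈ Q z, G.Adj x z ∧ Relation.ReflTransGen (AdjIn G (Q z)) w x := by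
    intro D hDm
    obtain ⟨hroot, -, -, hcov, -⟩ := hD D hDm
    obtain ⟨w, hw⟩ := hroot.exists_root
    have hz : ∀ z ∈ W, ∃ Q : Finset V, Q ⊆ D ∧ #Q ≤ r + 1 ∧
        ∃ x ∈ Q, G.Adj x z ∧ Relation.ReflTransGen (AdjIn G Q) w x := by
      intro z hz
      obtain ⟨x, hx, hxz⟩ := hcov z hz
      obtain ⟨Q, h1, h2, h3, h4, h5⟩ := hw x hx
      exact ⟨Q, h1, h4, x, h2, hxz, h5⟩
    choose! Q hQ using hz
    exact ⟨Q, w, hQ⟩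
  choose! Q hQ using hex
  have hQD : ∀ D ∈ 𝒟, ∀ z ∈ W, Q D z ⊆ D := fun D h z hz => (hQ D h).choose_spec z hz |>.1
  have hQc : ∀ D ∈ 𝒟, ∀ z ∈ W, #(Q D z) ≤ r + 1 := fun D h z hz =>
    ((hQ D h).choose_spec z hz).2.1
  refine ⟨Q, hW, hR, hWR, fun D h => (hD D h).2.1, fun D h => (hD D h).2.2.1,
    fun D h => (hD D h).2.2.2.2, hDD, hQD, hQc, ?_⟩
  intro D hDm v hv z hz hvz hnadj
  obtain ⟨w, hw⟩ := hQ D hDm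
  obtain ⟨-, -, x, hx, hxv, hwx⟩ := hw v hv
  obtain ⟨-, -, x', hx', hxz, hwx'⟩ := hw z hz
  set Y := insert v (insert z (Q D v ∪ Q D z)) with hY
  have hsub1 : Q D v ⊆ Y := by
    intro a ha; simp [hY, ha]
  have hsub2 : Q D z ⊆ Y := by
    intro a ha; simp [hY, ha]
  have hvY : v ∈ Y := by simp [hY]
  have hzY : z ∈ Y := by simp [hY]
  have hreach : Relation.ReflTransGen (AdjIn G Y) v z := by
    have h1 : Relation.ReflTransGen (AdjIn G Y) w v :=
      (reflTransGen_adjIn_mono hsub1 hwx).tail ⟨hsub1 hx, hvY, hxv⟩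
    have h2 : Relation.ReflTransGen (AdjIn G Y) w z :=
      (reflTransGen_adjIn_mono hsub2 hwx').tail ⟨hsub2 hx', hzY, hxz⟩
    exact (reflTransGen_adjIn_symm h1).trans h2
  obtain ⟨p, L, hp, hp0, hpL, hpY⟩ := exists_indPath_of_reflTransGen hvY hreach
  have hL2 : 2 ≤ L := by
    rcases Nat.lt_or_ge L 2 with h | h
    · exfalso
      interval_cases L
      · exact hvz (hp0.symm.trans hpL)
      · apply hnadj; rw [← hp0, ← hpL, hp.2 0 1 (by omega) le_rfl]
    · exact h
  refine ⟨p, L, hp, hp0, hpL, hL2, ?_, fun i hi0 hiL => ?_⟩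
  · have h1 := hp.lt_card hpY
    have h2 : #Y ≤ #(Q D v) + #(Q D z) + 1 + 1 :=
      (card_insert_le _ _).trans (Nat.add_le_add_right ((card_insert_le _ _).trans
        (Nat.add_le_add_right (card_union_le _ _) _)) _)
    have := hQc D hDm v hv
    have := hQc D hDm z hz
    omega
  · have h1 := hpY i hiL.le
    simp only [hY, mem_insert] at h1
    rcases h1 with h | h | h
    · exact absurd (hp.1 i 0 hiL.le (by omega) (h.trans hp0.symm)) (by omega)
    · exact absurd (hp.1 i L hiL.le le_rfl (h.trans hpL.symm)) (by omega)
    · exact h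

/-- Half of the vertices of `W` have few conflicts. -/
lemma Hub.exists_generic {k : ℕ} {U W R : Finset V} {𝒟 : Finset (Finset V)}
    {Q : Finset V → V → Finset V} (hub : Hub G k U W R 𝒟 Q) {Δ : ℝ} (hΔ : 1 ≤ Δ)
    (hdeg : ∀ u ∈ U, (#(nv G u U) : ℝ) ≤ Δ) (hN : 1 ≤ #𝒟) (hk : 1 ≤ k) :
    ∃ W', (#W : ℝ) ≤ 2 * #W' ∧ Hub G k U W' R 𝒟 Q ∧
      ∀ u ∈ W', (#(W'.filter (Conf G 𝒟 Q u)) : ℝ) ≤ (3 * (#𝒟 * k) + 2 : ℝ) * Δ := by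
  obtain ⟨X, hX⟩ : ∃ X : V → Finset V, ∀ z, X z = 𝒟.biUnion fun D => Q D z := ⟨_, fun _ => rfl⟩
  have hXU : ∀ z ∈ W, X z ⊆ U := by
    intro z hz a ha
    rw [hX] at ha
    obtain ⟨D, hD, haD⟩ := mem_biUnion.1 ha
    exact hub.DU D hD (hub.Qsub D hD z hz haD)
  have hXc : ∀ z ∈ W, (#(X z) : ℝ) ≤ #𝒟 * k := by
    intro z hz
    rw [hX]
    exact_mod_cast card_biUnion_le_card_mul 𝒟 _ k fun D hD => hub.Qcard D hD z hz
  have hXn : ∀ z ∈ W, (#(nb G (X z) U) : ℝ) ≤ #𝒟 * k * Δ := fun z hz =>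
    (card_nb_le _ _ fun x hx => hdeg x (hXU z hz hx)).trans
      (mul_le_mul_of_nonneg_right (hXc z hz) (by linarith))
  obtain ⟨K, hKdef⟩ : ∃ K : V → V → Prop, ∀ z u, K z u ↔ u ∈ nb G (X z) U :=
    ⟨_, fun _ _ => Iff.rfl⟩
  have hK : ∀ z ∈ W, (#(W.filter (K z)) : ℝ) ≤ #𝒟 * k * Δ := by
    intro z hz
    refine le_trans ?_ (hXn z hz)
    exact_mod_cast card_le_card fun u hu => (hKdef z u).1 (mem_filter.1 hu).2
  obtain ⟨c, hc⟩ : ∃ c : ℝ, c = #𝒟 * k * Δ := ⟨_, rfl⟩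
  simp only [← hc] at hK hXn
  have hcpos : 0 < c := by
    rw [hc]
    have h1 : (1 : ℝ) ≤ #𝒟 := by exact_mod_cast hN
    have h2 : (1 : ℝ) ≤ k := by exact_mod_cast hk
    positivity
  -- The root paths of a given `z` have at most `c` neighbours, but a given `u` could be adjacent to
  -- the root paths of many `z`. By Markov, this exceeds `2 * c` for at most half of `W`, which is
  -- discarded.
  have hbad := card_bad_le (c' := 2 * c) hK
  obtain ⟨bad, hbaddef⟩ : ∃ bad, bad = W.filter fun b => 2 * c < (#(W.filter fun r => K r b) : ℝ) :=
    ⟨_, rfl⟩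
  rw [← hbaddef] at hbad
  have hbad' : 2 * (#bad : ℝ) ≤ #W := by
    have : c * (2 * #bad) ≤ c * #W := by linarith
    exact le_of_mul_le_mul_left this hcpos
  have hsub : W \ bad ⊆ W := sdiff_subset
  refine ⟨W \ bad, ?_, ⟨hsub.trans hub.WU, hub.RU, disjoint_of_subset_left hsub hub.WR, hub.DU,
    fun D hD => disjoint_of_subset_right hsub (hub.DW D hD), hub.DR, hub.DD,
    fun D hD z hz => hub.Qsub D hD z (hsub hz), fun D hD z hz => hub.Qcard D hD z (hsub hz),
    fun D hD v hv z hz => hub.Qpath D hD v (hsub hv) z (hsub hz)⟩, fun u hu => ?_⟩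
  · have := card_sdiff_ge W bad
    linarith
  · obtain ⟨huW, hub'⟩ := mem_sdiff.1 hu
    have hgood : (#(W.filter fun r => K r u) : ℝ) ≤ 2 * c := by
      by_contra hcon
      exact hub' (by rw [hbaddef]; exact mem_filter.2 ⟨huW, not_le.1 hcon⟩)
    have huU := hub.WU huW
    -- The conflicts of `u` are `u` and its neighbours (at most `2 * Δ`), the `z` whose root paths
    -- see `u` (at most `2 * c`), and the neighbours of the root paths of `u` (at most `c`).
    have hcov : (W \ bad).filter (Conf G 𝒟 Q u) ⊆
        ({u} ∪ nv G u U) ∪ ((W.filter fun r => K r u) ∪ nb G (X u) U) := by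
      intro z hz
      obtain ⟨hz, hconf⟩ := mem_filter.1 hz
      have hzU := hub.WU (hsub hz)
      simp only [mem_union, mem_singleton, mem_nv, mem_filter]
      rcases hconf with h | h | ⟨D, hD, ⟨q, hq, h⟩ | ⟨q, hq, h⟩⟩
      · exact Or.inl (Or.inl h.symm)
      · exact Or.inl (Or.inr ⟨hzU, h⟩)
      · exact Or.inr (Or.inl ⟨hsub hz, (hKdef z u).2
          (mem_nb.2 ⟨huU, q, by rw [hX]; exact mem_biUnion.2 ⟨D, hD, hq⟩, h.symm⟩)⟩)
      · exact Or.inr (Or.inr (mem_nb.2 ⟨hzU, q, by rw [hX]; exact mem_biUnion.2 ⟨D, hD, hq⟩, h.symm⟩))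
    have h1 : (#((W \ bad).filter (Conf G 𝒟 Q u)) : ℝ) ≤
        (1 + #(nv G u U)) + (#(W.filter fun r => K r u) + #(nb G (X u) U)) := by
      have := (card_le_card hcov).trans ((card_union_le _ _).trans
        (Nat.add_le_add (card_union_le _ _) (card_union_le _ _)))
      rw [card_singleton] at this
      exact_mod_cast this
    have h2 := hdeg u huU
    have h3 := hXn u huW
    have h4 : (3 * (#𝒟 * k) + 2 : ℝ) * Δ = 3 * c + 2 * Δ := by rw [hc]; ring
    rw [h4]
    linarith

end PurePairs

/-! ### Adding centers and threads inside a hub -/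

namespace PurePairs

open Finset
open scoped Classical

variable {V : Type*} {G : SimpleGraph V}

/-- A hub in a regular set, with all numerical conditions needed to add at most `f` vertices along
threads with at most `J` vertices. -/
structure Setup (G : SimpleGraph V) (α β s Δ ζ C C' y : ℝ) (k f J : ℕ) (U W R : Finset V)
    (𝒟 : Finset (Finset V)) (Q : Finset V → V → Finset V) : Prop where
  hub : Hub G k U W R 𝒟 Q
  coh : Coh G α β
  hα : 0 < α
  hs : 1 ≤ s
  hαβ : α * s ^ 2 = β
  hΔ : 1 ≤ Δ
  hΔβ : Δ ≤ β
  hdeg : ∀ u ∈ U, (#(nv G u U) : ℝ) ≤ Δ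
  hreg : ∀ Y ⊆ U, ζ ≤ #Y → ∃ y ∈ Y, Δ ≤ s * #(nv G y Y)
  hconf : ∀ u ∈ W, (#(W.filter (Conf G 𝒟 Q u)) : ℝ) ≤ C * Δ
  hC : 0 ≤ C
  hC'0 : 0 < C'
  hy : 8 * β ≤ y
  hyζ : 4 * ζ ≤ y
  hyW : 2 * (2 * k + 2) * y ≤ #W
  hfW : 2 * (f * (C + 1) * β) ≤ #W
  hyR : 2 * (y * 3 ^ (J + 1)) ≤ #R
  hfR : 4 * (f * β) ≤ #R
  hC' : 4 * (C + J + 1) * #U ≤ C' * y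
  hC'y : (C' + 3) * β ≤ y
  hC's : 2 * (C' + 2) < s

variable {α β s Δ ζ C C' y : ℝ} {k f J : ℕ} {U W R : Finset V} {𝒟 : Finset (Finset V)}
  {Q : Finset V → V → Finset V} {F : Finset V} {𝒰 : Finset (Finset V)}

/-- The invariant of the embedding process: `F` is the set of vertices used so far and `𝒰` the set
of members of `𝒟` not used so far. -/
structure State (G : SimpleGraph V) (U W : Finset V) (𝒟 : Finset (Finset V))
    (Q : Finset V → V → Finset V) (F : Finset V) (𝒰 : Finset (Finset V)) : Prop where
  FU : F ⊆ U
  sub : 𝒰 ⊆ 𝒟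
  far : ∀ u ∈ F, u ∉ W → ∀ D ∈ 𝒰, u ∉ D ∧ ∀ x ∈ D, ¬ G.Adj u x
  conf : ∀ u ∈ F, u ∈ W → ∀ u' ∈ F, u' ∈ W → u ≠ u' → ¬ Conf G 𝒟 Q u u'

lemma State.mono (h : State G U W 𝒟 Q F 𝒰) {F' : Finset V} {𝒰' : Finset (Finset V)} (hF : F' ⊆ F)
    (h𝒰 : 𝒰' ⊆ 𝒰) : State G U W 𝒟 Q F' 𝒰' :=
  ⟨hF.trans h.FU, h𝒰.trans h.sub, fun u hu huW D hD => h.far u (hF hu) huW D (h𝒰 hD),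
    fun u hu huW v hv hvW => h.conf u (hF hu) huW v (hF hv) hvW⟩

/-- The vertices of `W` that may be added to `F`. -/
noncomputable def cand (G : SimpleGraph V) (W : Finset V) (𝒟 : Finset (Finset V))
    (Q : Finset V → V → Finset V) (F : Finset V) : Finset V :=
  W.filter fun z => ∀ u ∈ F, ¬ G.Adj u z ∧ (u ∈ W → ¬ Conf G 𝒟 Q u z)

lemma mem_cand {z : V} : z ∈ cand G W 𝒟 Q F ↔
    z ∈ W ∧ ∀ u ∈ F, ¬ G.Adj u z ∧ (u ∈ W → ¬ Conf G 𝒟 Q u z) := mem_filter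

lemma notMem_of_mem_cand {z : V} (hz : z ∈ cand G W 𝒟 Q F) : z ∉ F := fun hF =>
  ((mem_cand.1 hz).2 z hF).2 (mem_cand.1 hz).1 (Or.inl rfl)

/-- Each used vertex rules out at most `(C + 1) * β` vertices of `W`, through its neighbours and its
conflicts, and `hfW` makes the total at most half of `W`. -/
lemma Setup.card_cand (S : Setup G α β s Δ ζ C C' y k f J U W R 𝒟 Q) (hF : F ⊆ U) (hf : #F ≤ f) :
    (#W : ℝ) ≤ 2 * #(cand G W 𝒟 Q F) := by
  have hβ : 0 ≤ β := by have := S.hΔ; have := S.hΔβ; linarith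
  have hCβ : C * Δ + Δ ≤ (C + 1) * β := by
    have := mul_le_mul_of_nonneg_left S.hΔβ S.hC
    have := S.hΔβ
    linarith
  have hcov : W ⊆ cand G W 𝒟 Q F ∪ F.biUnion fun u =>
      (if u ∈ W then W.filter (Conf G 𝒟 Q u) else ∅) ∪ nv G u U := by
    intro z hz
    by_cases hc : z ∈ cand G W 𝒟 Q F
    · exact mem_union_left _ hc
    · refine mem_union_right _ ?_
      simp only [mem_cand, not_and, not_forall] at hc
      obtain ⟨u, hu, hu'⟩ := hc hz
      refine mem_biUnion.2 ⟨u, hu, ?_⟩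
      by_cases hadj : G.Adj u z
      · exact mem_union_right _ (mem_nv.2 ⟨S.hub.WU hz, hadj⟩)
      · simp only [hadj, not_false_eq_true, forall_const, not_not] at hu'
        obtain ⟨huW, hcf⟩ := hu'
        refine mem_union_left _ ?_
        rw [if_pos huW]
        exact mem_filter.2 ⟨hz, hcf⟩
  have h1 : ∀ u ∈ F, ((#((if u ∈ W then W.filter (Conf G 𝒟 Q u) else ∅) ∪ nv G u U) : ℕ) : ℝ) ≤
      (C + 1) * β := by
    intro u hu
    have h2 : (#((if u ∈ W then W.filter (Conf G 𝒟 Q u) else ∅) ∪ nv G u U) : ℝ) ≤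
        #(if u ∈ W then W.filter (Conf G 𝒟 Q u) else ∅) + #(nv G u U) := by
      exact_mod_cast card_union_le _ _
    have h3 : (#(if u ∈ W then W.filter (Conf G 𝒟 Q u) else ∅) : ℝ) ≤ C * Δ := by
      split_ifs with h
      · exact S.hconf u h
      · have := S.hΔ
        have := S.hC
        simp only [card_empty, Nat.cast_zero]
        positivity
    have h4 := S.hdeg u (hF hu)
    linarith
  have h2 : (#(F.biUnion fun u => (if u ∈ W then W.filter (Conf G 𝒟 Q u) else ∅) ∪ nv G u U) : ℝ) ≤
      f * ((C + 1) * β) := by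
    calc (#(F.biUnion fun u => (if u ∈ W then W.filter (Conf G 𝒟 Q u) else ∅) ∪ nv G u U) : ℝ)
        ≤ ∑ u ∈ F, (#((if u ∈ W then W.filter (Conf G 𝒟 Q u) else ∅) ∪ nv G u U) : ℝ) := by
          exact_mod_cast card_biUnion_le
      _ ≤ ∑ _u ∈ F, (C + 1) * β := sum_le_sum h1
      _ = #F * ((C + 1) * β) := by rw [sum_const, nsmul_eq_mul]
      _ ≤ f * ((C + 1) * β) := by
          have : (#F : ℝ) ≤ f := by exact_mod_cast hf
          have := S.hC
          gcongr
  have h3 : (#W : ℝ) ≤ #(cand G W 𝒟 Q F) +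
      #(F.biUnion fun u => (if u ∈ W then W.filter (Conf G 𝒟 Q u) else ∅) ∪ nv G u U) := by
    exact_mod_cast (card_le_card hcov).trans (card_union_le _ _)
  have := S.hfW
  linarith

lemma State.insert_cand (h : State G U W 𝒟 Q F 𝒰) (hWU : W ⊆ U) {z : V}
    (hz : z ∈ cand G W 𝒟 Q F) : State G U W 𝒟 Q (insert z F) 𝒰 := by
  obtain ⟨hzW, hzF⟩ := mem_cand.1 hz
  refine ⟨insert_subset (hWU hzW) h.FU, h.sub, fun u hu huW => ?_, fun u hu huW u' hu' hu'W hne => ?_⟩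
  · rcases mem_insert.1 hu with rfl | hu
    · exact absurd hzW huW
    · exact h.far u hu huW
  · rcases mem_insert.1 hu with hu₁ | hu₁ <;> rcases mem_insert.1 hu' with hu₂ | hu₂
    · exact absurd (hu₁.trans hu₂.symm) hne
    · exact fun hc => (hzF u' hu₂).2 hu'W (hu₁ ▸ hc.symm)
    · exact fun hc => (hzF u hu₁).2 huW (hu₂ ▸ hc)
    · exact h.conf u hu₁ huW u' hu₂ hu'W hne

lemma Setup.exists_center (S : Setup G α β s Δ ζ C C' y k f J U W R 𝒟 Q)
    (h : State G U W 𝒟 Q F 𝒰) (hf : #F ≤ f) :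
    ∃ z ∈ W, z ∉ F ∧ (∀ u ∈ F, ¬ G.Adj u z) ∧ State G U W 𝒟 Q (insert z F) 𝒰 := by
  have h1 := S.card_cand h.FU hf
  have hβ : 0 < β := by have := S.hΔ; have := S.hΔβ; linarith
  have hy0 : 0 < y := by have := S.hy; linarith
  have h2 : 0 < 2 * (2 * (k : ℝ) + 2) * y := by positivity
  have h3 : 0 < (#(cand G W 𝒟 Q F) : ℝ) := by have := S.hyW; linarith
  obtain ⟨z, hz⟩ := card_pos.1 (Nat.cast_pos.1 h3)
  exact ⟨z, (mem_cand.1 hz).1, notMem_of_mem_cand hz, fun u hu => ((mem_cand.1 hz).2 u hu).1,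
    h.insert_cand S.hub.WU hz⟩

/-- Many candidates are joined to `v` through `D` by induced paths of the same length. -/
lemma Setup.exists_legs (S : Setup G α β s Δ ζ C C' y k f J U W R 𝒟 Q) (hF : F ⊆ U) (hf : #F ≤ f)
    {D : Finset V} (hD : D ∈ 𝒟) {v : V} (hv : v ∈ F) (hvW : v ∈ W) :
    ∃ (L : ℕ) (A : Finset V), 2 ≤ L ∧ L ≤ 2 * k + 1 ∧ A ⊆ cand G W 𝒟 Q F ∧ y ≤ #A ∧
      ∀ z ∈ A, ∃ p, IndPath G p L ∧ p 0 = v ∧ p L = z ∧ ∀ i, 0 < i → i < L → p i ∈ Q D v ∪ Q D z := by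
  have hex : ∀ z ∈ cand G W 𝒟 Q F, ∃ L, ∃ p, IndPath G p L ∧ p 0 = v ∧ p L = z ∧ 2 ≤ L ∧
      L ≤ 2 * k + 1 ∧ ∀ i, 0 < i → i < L → p i ∈ Q D v ∪ Q D z := by
    intro z hz
    obtain ⟨hzW, hzF⟩ := mem_cand.1 hz
    obtain ⟨p, L, h⟩ := S.hub.Qpath D hD v hvW z hzW
      (fun h => (hzF v hv).2 hvW (Or.inl h)) (hzF v hv).1
    exact ⟨L, p, h⟩
  choose! ℓ hℓ using hex
  have h1 := S.card_cand hF hf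
  have hmaps : ∀ z ∈ cand G W 𝒟 Q F, ℓ z ∈ range (2 * k + 2) := by
    intro z hz
    obtain ⟨p, -, -, -, -, h, -⟩ := hℓ z hz
    exact mem_range.2 (by omega)
  have hyc : ((#(range (2 * k + 2)) : ℕ) : ℝ) * y ≤ #(cand G W 𝒟 Q F) := by
    rw [card_range]; push_cast
    have := S.hyW
    linarith
  -- Leg lengths lie among the `2 * k + 2` values below `2 * k + 2`, so some length occurs for at
  -- least `y` candidates.
  obtain ⟨L, -, hLc⟩ := exists_le_card_fiber_of_nsmul_le_card_of_maps_to hmaps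
    ⟨0, by simp⟩ (b := y) (by rw [nsmul_eq_mul]; exact hyc)
  have hβ : 0 < β := by have := S.hΔ; have := S.hΔβ; linarith
  have hy0 : 0 < y := by have := S.hy; linarith
  obtain ⟨z₀, hz₀⟩ := card_pos.1 (Nat.cast_pos.1 (hy0.trans_le hLc))
  obtain ⟨hz₀c, hz₀L⟩ := mem_filter.1 hz₀
  obtain ⟨p₀, -, -, -, h2, h3, -⟩ := hℓ z₀ hz₀c
  refine ⟨L, _, hz₀L ▸ h2, hz₀L ▸ h3, filter_subset _ _, hLc, fun z hz => ?_⟩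
  obtain ⟨hzc, hzL⟩ := mem_filter.1 hz
  obtain ⟨p, hp, hp0, hpL, -, -, hpQ⟩ := hℓ z hzc
  rw [hzL] at hp hpL hpQ
  exact ⟨p, hp, hp0, hpL, hpQ⟩

/-- The adjacencies between a leg and the vertices used so far. -/
lemma State.adj_leg (h : State G U W 𝒟 Q F 𝒰) (hub : Hub G k U W R 𝒟 Q) {D : Finset V} (hD : D ∈ 𝒰)
    {v z : V} (hv : v ∈ F) (hvW : v ∈ W) (hz : z ∈ cand G W 𝒟 Q F) {p : ℕ → V} {L : ℕ}
    (hp : IndPath G p L) (hp0 : p 0 = v)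
    (hpQ : ∀ i, 0 < i → i < L → p i ∈ Q D v ∪ Q D z) {i : ℕ} (hi0 : 0 < i) (hiL : i < L) :
    p i ∈ D ∧ p i ∉ F ∧ ∀ u ∈ F, (G.Adj u (p i) ↔ u = v ∧ i = 1) := by
  obtain ⟨hzW, hzF⟩ := mem_cand.1 hz
  have hD' := h.sub hD
  have hpD : p i ∈ D := by
    rcases mem_union.1 (hpQ i hi0 hiL) with h | h
    · exact hub.Qsub D hD' v hvW h
    · exact hub.Qsub D hD' z hzW h
  have hpW : p i ∉ W := fun hW => disjoint_left.1 (hub.DW D hD') hpD hW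
  refine ⟨hpD, fun hF => (h.far _ hF hpW D hD).1 hpD, fun u hu => ?_⟩
  -- A used vertex outside `W` is anticomplete to the unused set `D`. One inside `W` that is
  -- adjacent to a leg would conflict with `v` or with `z`.
  by_cases huv : u = v
  · subst huv
    rw [← hp0, hp.2 0 i hi0 hiL.le]
    simp
  · simp only [huv, false_and, iff_false]
    intro hadj
    by_cases huW : u ∈ W
    · rcases mem_union.1 (hpQ i hi0 hiL) with hq | hq
      · exact h.conf u hu huW v hv hvW huv (Or.inr (Or.inr ⟨D, hD', Or.inl ⟨_, hq, hadj⟩⟩))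
      · exact (hzF u hu).2 huW (Or.inr (Or.inr ⟨D, hD', Or.inl ⟨_, hq, hadj⟩⟩))
    · exact (h.far u hu huW D hD).2 _ hpD hadj

set_option maxHeartbeats 1000000 in
/-- Two (possibly equal) centers can be joined by an induced path with `T + 1` inner vertices. -/
lemma Setup.exists_thread (S : Setup G α β s Δ ζ C C' y k f J U W R 𝒟 Q)
    (h : State G U W 𝒟 Q F 𝒰) (hf : #F ≤ f) {v v' : V} (hv : v ∈ F) (hvW : v ∈ W) (hv' : v' ∈ F)
    (hv'W : v' ∈ W) {D D' : Finset V} (hD : D ∈ 𝒰) (hD' : D' ∈ 𝒰) (hDD' : D ≠ D') {T : ℕ}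
    (hT : 4 * k + 3 ≤ T) (hTJ : T ≤ J) :
    ∃ p, IndPath G p T ∧ (∀ i ≤ T, p i ∉ F) ∧
      (∀ u ∈ F, ∀ i ≤ T, (G.Adj u (p i) ↔ (u = v ∧ i = 0) ∨ (u = v' ∧ i = T))) ∧
      State G U W 𝒟 Q (F ∪ (range (T + 1)).image p) ((𝒰.erase D).erase D') := by
  have hub := S.hub
  obtain ⟨L₁, A, hL₁2, hL₁k, hAc, hyA, hA⟩ := S.exists_legs h.FU hf (h.sub hD) hv hvW
  obtain ⟨L₂, B, hL₂2, hL₂k, hBc, hyB, hB⟩ := S.exists_legs h.FU hf (h.sub hD') hv' hv'W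
  -- Both leg lengths `a + 2` and `b + 2` are at most `2 * k + 1`, so `T ≥ 4 * k + 3` is exactly
  -- what leaves a link length `j + 3` with `j ≥ 0`. The thread omits `v` and `v'`: the index 0 is
  -- the neighbour of `v` and the index `T` that of `v'`.
  obtain ⟨a, rfl⟩ : ∃ a, L₁ = 1 + (a + 1) := ⟨L₁ - 2, by omega⟩
  obtain ⟨b, rfl⟩ : ∃ b, L₂ = 1 + (b + 1) := ⟨L₂ - 2, by omega⟩
  obtain ⟨j, rfl⟩ : ∃ j, T = (a + 1 + (j + 3)) + (b + 1) := ⟨T - a - b - 5, by omega⟩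
  have hAW : A ⊆ W := fun z hz => (mem_cand.1 (hAc hz)).1
  have hBW : B ⊆ W := fun z hz => (mem_cand.1 (hBc hz)).1
  -- the part of `R` far from `F`
  have hβ : 0 < β := by have := S.hΔ; have := S.hΔβ; linarith
  have hy0 : 0 < y := by have := S.hy; linarith
  set R' := R \ (F ∪ nb G F R) with hR'
  have hR'R : R' ⊆ R := sdiff_subset
  have hR'c : y * 3 ^ (j + 1) ≤ #R' := by
    have h1 := card_sdiff_ge R (F ∪ nb G F R)
    have h2 : (#(F ∪ nb G F R) : ℝ) ≤ #F + #(nb G F R) := by exact_mod_cast card_union_le _ _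
    have h3 := card_nb_le (G := G) F R (d := β) (fun x hx =>
      ((card_nv_mono x hub.RU).trans (S.hdeg x (h.FU hx))).trans S.hΔβ)
    have h4 : (#F : ℝ) ≤ f := by exact_mod_cast hf
    have h5 : (#F : ℝ) * β ≤ f * β := mul_le_mul_of_nonneg_right h4 hβ.le
    have h6 : (#F : ℝ) ≤ f * β := by
      have : (1 : ℝ) ≤ β := S.hΔ.trans S.hΔβ
      calc (#F : ℝ) ≤ #F * β := le_mul_of_one_le_right (by positivity) this
        _ ≤ _ := h5
    have h7 : y * 3 ^ (j + 1) ≤ y * 3 ^ (J + 1) :=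
      mul_le_mul_of_nonneg_left (pow_le_pow_right₀ (by norm_num) (by omega)) hy0.le
    have := S.hyR
    have := S.hfR
    linarith
  obtain ⟨l, hl, hl0, hlj, hlconf, hlR⟩ := S.coh.exists_link S.hα S.hs S.hαβ S.hΔ S.hΔβ S.hdeg S.hreg
    (A := A) (B := B) (R := R') (hAW.trans hub.WU) (hBW.trans hub.WU) (hR'R.trans hub.RU)
    (disjoint_of_subset_left hAW (disjoint_of_subset_right hR'R hub.WR))
    (disjoint_of_subset_left hBW (disjoint_of_subset_right hR'R hub.WR))
    (conf := Conf G 𝒟 Q) (C := C) (C' := C') (y := y)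
    (fun z hz => le_trans (by exact_mod_cast card_le_card (filter_subset_filter _ hBW))
      (S.hconf z (hAW hz)))
    (fun z => Or.inl rfl) j S.hC S.hC'0 S.hy S.hyζ hyA hyB hR'c
    (le_trans (by
      have : (j : ℝ) ≤ J := by exact_mod_cast (by omega : j ≤ J)
      gcongr) S.hC') S.hC'y S.hC's
  set z := l 0 with hz
  set z' := l (j + 3) with hz'
  have hzc := hAc hl0
  have hz'c := hBc hlj
  have hzW := hAW hl0
  have hz'W := hBW hlj
  obtain ⟨q₁, hq₁, hq₁0, hq₁L, hq₁Q⟩ := hA z hl0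
  obtain ⟨q₂, hq₂, hq₂0, hq₂L, hq₂Q⟩ := hB z' hlj
  have hleg₁ := fun i hi0 hiL => h.adj_leg hub hD hv hvW hzc hq₁ hq₁0 hq₁Q (i := i) hi0 hiL
  have hleg₂ := fun i hi0 hiL => h.adj_leg hub hD' hv' hv'W hz'c hq₂ hq₂0 hq₂Q (i := i) hi0 hiL
  have hDm := h.sub hD
  have hD'm := h.sub hD'
  have hp₁ : IndPath G (fun i => q₁ (1 + i)) (a + 1) := hq₁.shift
  have hp₂ : IndPath G (fun i => q₂ (1 + (b + 1 - i))) (b + 1) :=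
    (hq₂.shift (a := 1) (L := b + 1)).reverse
  have hlW : ∀ i, i ≤ j + 3 → l i ∈ W ∪ R := by
    intro i hi
    rcases Nat.eq_zero_or_pos i with rfl | h0
    · exact mem_union_left _ hzW
    · rcases hi.lt_or_eq with h | rfl
      · exact mem_union_right _ (hR'R (hlR i h0 h))
      · exact mem_union_left _ hz'W
  have hDl : ∀ E ∈ 𝒟, ∀ x ∈ E, ∀ i ≤ j + 3, x ≠ l i := by
    rintro E hE x hx i hi rfl
    rcases mem_union.1 (hlW i hi) with h | h
    · exact disjoint_left.1 (hub.DW E hE) hx h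
    · exact disjoint_left.1 (hub.DR E hE).1 hx h
  -- legs are anticomplete to the other end of the link and to its interior
  have hncz : ¬ Conf G 𝒟 Q z z' := hlconf
  have hleg₁l : ∀ i, 0 < i → i < 1 + (a + 1) → ∀ m, 0 < m → m ≤ j + 3 → ¬ G.Adj (q₁ i) (l m) := by
    intro i hi0 hi m hm0 hm hadj
    rcases hm.lt_or_eq with h' | rfl
    · exact (hub.DR D hDm).2 _ (hleg₁ i hi0 hi).1 _ (hR'R (hlR m hm0 h')) hadj
    · rcases mem_union.1 (hq₁Q i hi0 hi) with hq | hq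
      · exact ((mem_cand.1 hz'c).2 v hv).2 hvW (Or.inr (Or.inr ⟨D, hDm, Or.inr ⟨_, hq, hadj.symm⟩⟩))
      · exact hncz (Or.inr (Or.inr ⟨D, hDm, Or.inr ⟨_, hq, hadj.symm⟩⟩))
  have hleg₂l : ∀ i, 0 < i → i < 1 + (b + 1) → ∀ m, m < j + 3 → ¬ G.Adj (q₂ i) (l m) := by
    intro i hi0 hi m hm hadj
    rcases Nat.eq_zero_or_pos m with rfl | hm0
    · rcases mem_union.1 (hq₂Q i hi0 hi) with hq | hq
      · exact ((mem_cand.1 hzc).2 v' hv').2 hv'W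
          (Or.inr (Or.inr ⟨D', hD'm, Or.inr ⟨_, hq, hadj.symm⟩⟩))
      · exact hncz (Or.inr (Or.inr ⟨D', hD'm, Or.inl ⟨_, hq, hadj.symm⟩⟩))
    · exact (hub.DR D' hD'm).2 _ (hleg₂ i hi0 hi).1 _ (hR'R (hlR m hm0 hm)) hadj
  have hglue₁ := hp₁.glue hl (by rw [← hz]; exact hq₁L)
    (fun i m hi hm0 hm => hDl D hDm _ (hleg₁ (1 + i) (by omega) (by omega)).1 m hm)
    (fun i m hi hm0 hm => hleg₁l (1 + i) (by omega) (by omega) m hm0 hm)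
  set g₁ : ℕ → V := fun i => if i ≤ a + 1 then q₁ (1 + i) else l (i - (a + 1)) with hg₁
  have hg₁a : ∀ i, i < a + 1 → g₁ i = q₁ (1 + i) := fun i hi => by simp [hg₁, hi.le]
  have hg₁l : ∀ i, a + 1 ≤ i → g₁ i = l (i - (a + 1)) := by
    intro i hi
    rcases hi.lt_or_eq with h' | h'
    · simp [hg₁, not_le.2 h']
    · subst h'; simp only [hg₁, le_refl, if_true, Nat.sub_self]; exact hq₁L
  have hglue₂ := hglue₁.glue hp₂
    (by
      have : g₁ (a + 1 + (j + 3)) = z' := by rw [hg₁l _ (by omega), hz']; congr 1; omega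
      rw [this]; simp only [Nat.sub_zero]; exact hq₂L.symm)
    (fun i m hi hm0 hm => by
      have hm' := hleg₂ (1 + (b + 1 - m)) (by omega) (by omega)
      rcases Nat.lt_or_ge i (a + 1) with h' | h'
      · rw [hg₁a i h']
        intro he
        exact disjoint_left.1 (hub.DD D hDm D' hD'm hDD').1
          (hleg₁ (1 + i) (by omega) (by omega)).1 (he ▸ hm'.1)
      · rw [hg₁l i h']
        exact (hDl D' hD'm _ hm'.1 _ (by omega)).symm)
    (fun i m hi hm0 hm => by
      have hm' := hleg₂ (1 + (b + 1 - m)) (by omega) (by omega)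
      rcases Nat.lt_or_ge i (a + 1) with h' | h'
      · rw [hg₁a i h']
        exact (hub.DD D hDm D' hD'm hDD').2 _ (hleg₁ (1 + i) (by omega) (by omega)).1 _ hm'.1
      · rw [hg₁l i h']
        exact fun hadj => hleg₂l _ (by omega) (by omega) _ (by omega) hadj.symm)
  set g : ℕ → V := fun i => if i ≤ a + 1 + (j + 3) then g₁ i
    else q₂ (1 + (b + 1 - (i - (a + 1 + (j + 3))))) with hg
  -- the classification of the vertices of the thread
  have hclass : ∀ i ≤ a + 1 + (j + 3) + (b + 1),
      (i < a + 1 ∧ g i = q₁ (1 + i)) ∨ (i = a + 1 ∧ g i = z) ∨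
      (a + 1 < i ∧ i < a + 1 + (j + 3) ∧ g i ∈ R') ∨ (i = a + 1 + (j + 3) ∧ g i = z') ∨
      (a + 1 + (j + 3) < i ∧
        g i = q₂ (1 + (b + 1 - (i - (a + 1 + (j + 3)))))) := by
    intro i hi
    rcases Nat.lt_or_ge (a + 1 + (j + 3)) i with h' | h'
    · exact Or.inr (Or.inr (Or.inr (Or.inr ⟨h', by simp only [hg, not_le.2 h', if_false]⟩)))
    · have hgi : g i = g₁ i := by simp only [hg, h', if_true]
      rcases Nat.lt_or_ge i (a + 1) with h'' | h''
      · exact Or.inl ⟨h'', by rw [hgi, hg₁a i h'']⟩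
      · rw [hg₁l i h''] at hgi
        rcases h''.lt_or_eq with h3 | h3
        · rcases h'.lt_or_eq with h4 | h4
          · exact Or.inr (Or.inr (Or.inl ⟨h3, h4, by rw [hgi]; exact hlR _ (by omega) (by omega)⟩))
          · refine Or.inr (Or.inr (Or.inr (Or.inl ⟨h4, ?_⟩)))
            rw [hgi, hz']; congr 1; omega
        · refine Or.inr (Or.inl ⟨h3.symm, ?_⟩)
          rw [hgi, hz]; congr 1; omega
  refine ⟨g, hglue₂, fun i hi => ?_, fun u hu i hi => ?_, ?_⟩
  · rcases hclass i hi with ⟨h1, h2⟩ | ⟨h1, h2⟩ | ⟨h1, h1', h2⟩ | ⟨h1, h2⟩ | ⟨h1, h2⟩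
    · rw [h2]; exact (hleg₁ _ (by omega) (by omega)).2.1
    · rw [h2]; exact notMem_of_mem_cand hzc
    · exact fun hF => (mem_sdiff.1 h2).2 (mem_union_left _ hF)
    · rw [h2]; exact notMem_of_mem_cand hz'c
    · rw [h2]; exact (hleg₂ _ (by omega) (by omega)).2.1
  · rcases hclass i hi with ⟨h1, h2⟩ | ⟨h1, h2⟩ | ⟨h1, h1', h2⟩ | ⟨h1, h2⟩ | ⟨h1, h2⟩
    · rw [h2, (hleg₁ _ (by omega) (by omega)).2.2 u hu]
      constructor
      · rintro ⟨h3, h4⟩; exact Or.inl ⟨h3, by omega⟩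
      · rintro (⟨h3, h4⟩ | ⟨h3, h4⟩)
        · exact ⟨h3, by omega⟩
        · omega
    · rw [h2]
      refine iff_of_false ((mem_cand.1 hzc).2 u hu).1 ?_
      rintro (⟨-, h4⟩ | ⟨-, h4⟩) <;> omega
    · refine iff_of_false (fun hadj => (mem_sdiff.1 h2).2 (mem_union_right _
        (mem_nb.2 ⟨hR'R h2, u, hu, hadj⟩))) ?_
      rintro (⟨-, h4⟩ | ⟨-, h4⟩) <;> omega
    · rw [h2]
      refine iff_of_false ((mem_cand.1 hz'c).2 u hu).1 ?_
      rintro (⟨-, h4⟩ | ⟨-, h4⟩) <;> omega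
    · rw [h2, (hleg₂ _ (by omega) (by omega)).2.2 u hu]
      constructor
      · rintro ⟨h3, h4⟩; exact Or.inr ⟨h3, by omega⟩
      · rintro (⟨h3, h4⟩ | ⟨h3, h4⟩)
        · omega
        · exact ⟨h3, by omega⟩
  · -- the new state
    have hz'2 : z' ∈ cand G W 𝒟 Q (insert z F) := by
      refine mem_cand.2 ⟨hz'W, fun u hu => ?_⟩
      rcases mem_insert.1 hu with rfl | hu
      · exact ⟨fun hadj => hncz (Or.inr (Or.inl hadj)), fun _ => hncz⟩
      · exact (mem_cand.1 hz'c).2 u hu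
    have hst := (h.insert_cand hub.WU hzc).insert_cand hub.WU hz'2
    -- The only new vertices in `W` are `z` and `z'`. All others lie in `D`, `D'` or `R`, which are
    -- anticomplete to every set of the hub that remains unused.
    have hmem : ∀ u ∈ F ∪ (range (a + 1 + (j + 3) + (b + 1) + 1)).image g,
        u ∈ insert z' (insert z F) ∨ u ∈ D ∨ u ∈ R ∨ u ∈ D' := by
      intro u hu
      rcases mem_union.1 hu with hu | hu
      · exact Or.inl (mem_insert_of_mem (mem_insert_of_mem hu))
      · obtain ⟨i, hi, rfl⟩ := mem_image.1 hu
        have hi' := mem_range.1 hi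
        rcases hclass i (by omega) with ⟨h1, h2⟩ | ⟨h1, h2⟩ | ⟨h1, h1', h2⟩ | ⟨h1, h2⟩ | ⟨h1, h2⟩
        · rw [h2]; exact Or.inr (Or.inl (hleg₁ _ (by omega) (by omega)).1)
        · rw [h2]; exact Or.inl (mem_insert_of_mem (mem_insert_self _ _))
        · exact Or.inr (Or.inr (Or.inl (hR'R h2)))
        · rw [h2]; exact Or.inl (mem_insert_self _ _)
        · rw [h2]; exact Or.inr (Or.inr (Or.inr (hleg₂ _ (by omega) (by omega)).1))
    have hW : ∀ u ∈ F ∪ (range (a + 1 + (j + 3) + (b + 1) + 1)).image g, u ∈ W →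
        u ∈ insert z' (insert z F) := by
      intro u hu huW
      rcases hmem u hu with h1 | h1 | h1 | h1
      · exact h1
      · exact absurd huW (disjoint_left.1 (hub.DW D hDm) h1)
      · exact absurd h1 (disjoint_left.1 hub.WR huW)
      · exact absurd huW (disjoint_left.1 (hub.DW D' hD'm) h1)
    refine ⟨fun u hu => ?_, (erase_subset _ _).trans ((erase_subset _ _).trans h.sub),
      fun u hu huW E hE => ?_, fun u hu huW u' hu' hu'W => hst.conf u (hW u hu huW) huW u'
        (hW u' hu' hu'W) hu'W⟩
    · rcases hmem u hu with h1 | h1 | h1 | h1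
      · exact hst.FU h1
      · exact hub.DU D hDm h1
      · exact hub.RU h1
      · exact hub.DU D' hD'm h1
    · have hE𝒰 : E ∈ 𝒰 := mem_of_mem_erase (mem_of_mem_erase hE)
      have hEm := h.sub hE𝒰
      have hED' : E ≠ D' := ne_of_mem_erase hE
      have hED : E ≠ D := ne_of_mem_erase (mem_of_mem_erase hE)
      rcases hmem u hu with h1 | h1 | h1 | h1
      · exact hst.far u h1 huW E hE𝒰
      · exact ⟨disjoint_left.1 (hub.DD D hDm E hEm hED.symm).1 h1,
          fun x hx => (hub.DD D hDm E hEm hED.symm).2 u h1 x hx⟩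
      · exact ⟨disjoint_left.1 (hub.DR E hEm).symm.1 h1,
          fun x hx => (hub.DR E hEm).symm.2 u h1 x hx⟩
      · exact ⟨disjoint_left.1 (hub.DD D' hD'm E hEm hED'.symm).1 h1,
          fun x hx => (hub.DD D' hD'm E hEm hED'.symm).2 u h1 x hx⟩

end PurePairs

/-! ### Decomposition of a graph with large branch-length -/

namespace PurePairs

open Finset
open scoped Classical

section Decomposition

variable {X : Type*} {H : SimpleGraph X}

/-- Subsets `S` of the vertex set of `H` that can be built from the empty set by adding isolated
vertices (the centers, collected in `C`), long threads between centers, and paths attached to a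
center by one end. -/
inductive Buildable (H : SimpleGraph X) (k : ℕ) : Finset X → Finset X → Prop
  | empty : Buildable H k ∅ ∅
  | center {S C : Finset X} {x : X} (h : Buildable H k S C) (hx : x ∉ S)
      (hadj : ∀ u ∈ S, ¬ H.Adj u x) : Buildable H k (insert x S) (insert x C)
  | thread {S C : Finset X} {c c' : X} {p : ℕ → X} {T : ℕ} (h : Buildable H k S C) (hc : c ∈ C)
      (hc' : c' ∈ C) (hp : IndPath H p T) (hT : 4 * k + 3 ≤ T) (hpS : ∀ i ≤ T, p i ∉ S)
      (hadj : ∀ u ∈ S, ∀ i ≤ T, (H.Adj u (p i) ↔ (u = c ∧ i = 0) ∨ (u = c' ∧ i = T))) :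
      Buildable H k (S ∪ (range (T + 1)).image p) C
  | pendant {S C : Finset X} {c : X} {p : ℕ → X} {T : ℕ} (h : Buildable H k S C) (hc : c ∈ C)
      (hp : IndPath H p T) (hpS : ∀ i ≤ T, p i ∉ S)
      (hadj : ∀ u ∈ S, ∀ i ≤ T, (H.Adj u (p i) ↔ u = c ∧ i = 0)) :
      Buildable H k (S ∪ (range (T + 1)).image p) C

lemma Buildable.subset {k : ℕ} {S C : Finset X} (h : Buildable H k S C) : C ⊆ S := by
  induction h with
  | empty => exact Subset.rfl
  | center _ _ _ ih => exact insert_subset_insert _ ih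
  | thread _ _ _ _ _ _ _ ih => exact ih.trans subset_union_left
  | pendant _ _ _ _ _ ih => exact ih.trans subset_union_left

lemma buildable_of_independent {k : ℕ} (B : Finset X) (hB : ∀ u ∈ B, ∀ v ∈ B, ¬ H.Adj u v) :
    Buildable H k B B := by
  induction B using Finset.induction_on with
  | empty => exact .empty
  | insert x B hx ih =>
    exact .center (ih fun u hu v hv => hB u (mem_insert_of_mem hu) v (mem_insert_of_mem hv)) hx
      fun u hu => hB u (mem_insert_of_mem hu) x (mem_insert_self _ _)

lemma exists_walk_of_adj (f : ℕ → X) (n : ℕ) (hf : ∀ i < n, H.Adj (f i) (f (i + 1))) :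
    ∃ p : H.Walk (f 0) (f n), p.length = n ∧ p.support = (List.range (n + 1)).map f ∧
      ∀ e ∈ p.edges, ∃ i < n, e = s(f i, f (i + 1)) := by
  induction n generalizing f with
  | zero => exact ⟨.nil, rfl, by simp, by simp⟩
  | succ n ih =>
    obtain ⟨p, hp, hps, hpe⟩ := ih (fun i => f (i + 1)) fun i hi => hf (i + 1) (by omega)
    refine ⟨.cons (hf 0 (by omega)) p, by simp [hp], ?_, fun e he => ?_⟩
    · rw [SimpleGraph.Walk.support_cons, hps, List.range_succ_eq_map (n := n + 1)]
      simp [List.map_map, Function.comp_def]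
    · rw [SimpleGraph.Walk.edges_cons, List.mem_cons] at he
      rcases he with rfl | he
      · exact ⟨0, by omega, rfl⟩
      · obtain ⟨i, hi, rfl⟩ := hpe e he
        exact ⟨i + 1, by omega, rfl⟩

/-- An induced path together with a vertex adjacent to both of its ends contains a cycle. -/
lemma IndPath.exists_cycle {p : ℕ → X} {L : ℕ} (hp : IndPath H p L) (hL : 1 ≤ L) {v : X}
    (hv : ∀ i ≤ L, p i ≠ v) (h0 : H.Adj v (p 0)) (hLv : H.Adj (p L) v) :
    ∃ (w : X) (q : H.Walk w w), q.IsCycle ∧ q.length = L + 2 := by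
  obtain ⟨f, hf⟩ : ∃ f : ℕ → X, ∀ i, f i = if i ≤ L then p i else v := ⟨_, fun _ => rfl⟩
  have hfp : ∀ i ≤ L, f i = p i := fun i hi => by rw [hf, if_pos hi]
  have hfv : f (L + 1) = v := by rw [hf, if_neg (by omega)]
  have hinj : ∀ i ≤ L + 1, ∀ j ≤ L + 1, f i = f j → i = j := by
    intro i hi j hj hij
    rcases hi.lt_or_eq with hi' | rfl <;> rcases hj.lt_or_eq with hj' | rfl
    · rw [hfp i (by omega), hfp j (by omega)] at hij
      exact hp.1 i j (by omega) (by omega) hij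
    · rw [hfp i (by omega), hfv] at hij
      exact absurd hij (hv i (by omega))
    · rw [hfp j (by omega), hfv] at hij
      exact absurd hij.symm (hv j (by omega))
    · rfl
  obtain ⟨q, hq, hqs, hqe⟩ := exists_walk_of_adj (H := H) f (L + 1) (fun i hi => by
    rcases (Nat.lt_succ_iff.1 hi).lt_or_eq with h | rfl
    · rw [hfp i h.le, hfp (i + 1) h, hp.2 i (i + 1) (by omega) h]
    · rw [hfp i le_rfl, hfv]; exact hLv)
  have h0' : H.Adj (f (L + 1)) (f 0) := by rw [hfv, hfp 0 (by omega)]; exact h0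
  have hcyc : (SimpleGraph.Walk.cons h0' q).IsCycle := by
    rw [SimpleGraph.Walk.cons_isCycle_iff]
    constructor
    · rw [SimpleGraph.Walk.isPath_def, hqs]
      refine List.Nodup.map_on (fun i hi j hj => ?_) List.nodup_range
      rw [List.mem_range] at hi hj
      exact hinj i (by omega) j (by omega)
    · intro he
      obtain ⟨i, hi, he⟩ := hqe _ he
      rw [Sym2.eq_iff] at he
      rcases he with ⟨h1, h2⟩ | ⟨h1, h2⟩
      · have := hinj _ le_rfl i (by omega) h1; omega
      · have := hinj _ le_rfl (i + 1) (by omega) h1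
        have := hinj 0 (by omega) i (by omega) h2
        omega
  have hlen : (SimpleGraph.Walk.cons h0' q).length = L + 2 := by simp [hq]
  exact ⟨_, _, hcyc, hlen⟩

lemma exists_longest_indPath [Fintype X] {S : Finset X} (hS : S ≠ univ) :
    ∃ L, (∃ p, IndPath H p L ∧ ∀ i ≤ L, p i ∉ S) ∧
      ¬ ∃ p, IndPath H p (L + 1) ∧ ∀ i ≤ L + 1, p i ∉ S := by
  obtain ⟨x, hx⟩ : ∃ x, x ∉ S := by
    by_contra! h
    exact hS (eq_univ_iff_forall.2 h)
  have h0 : ∃ p, IndPath H p 0 ∧ ∀ i ≤ 0, p i ∉ S := ⟨fun _ => x, indPath_zero _, fun _ _ => hx⟩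
  refine ⟨_, Nat.findGreatest_spec (P := fun L => ∃ p, IndPath H p L ∧ ∀ i ≤ L, p i ∉ S)
    (Nat.zero_le (Fintype.card X)) h0, fun h => ?_⟩
  obtain ⟨p, hp, -⟩ := id h
  have hcard : Nat.findGreatest (fun L => ∃ p, IndPath H p L ∧ ∀ i ≤ L, p i ∉ S)
      (Fintype.card X) + 1 ≤ Fintype.card X := by
    set L := Nat.findGreatest (fun L => ∃ p, IndPath H p L ∧ ∀ i ≤ L, p i ∉ S) (Fintype.card X)
    have h1 : #((range (L + 1 + 1)).image p) = L + 1 + 1 := by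
      rw [card_image_of_injOn, card_range]
      intro i hi j hj hij
      simp only [coe_range, Set.mem_Iio] at hi hj
      exact hp.1 i j (by omega) (by omega) hij
    have h2 := card_le_univ ((range (L + 1 + 1)).image p)
    omega
  exact Nat.findGreatest_is_greatest (Nat.lt_succ_self _) hcard h

/-- The extension step of the decomposition of a graph with large branch-length. -/
lemma Buildable.exists_larger [Fintype X] {k : ℕ} {B S C : Finset X}
    (hdeg : ∀ x ∉ B, ∀ a b d, H.Adj x a → H.Adj x b → H.Adj x d → a ≠ b → a ≠ d → b ≠ d → False)
    (hdist : ∀ u ∈ B, ∀ v ∈ B, u ≠ v → H.Reachable u v → 4 * k + 5 ≤ H.dist u v)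
    (hcyc : ∀ (w : X) (q : H.Walk w w), q.IsCycle → 4 * k + 5 ≤ q.length)
    (h : Buildable H k S C) (hBC : B ⊆ C) (hSB : ∀ x ∉ S, ∀ u ∈ S, H.Adj u x → u ∈ B)
    (hS : S ≠ univ) :
    ∃ S' C', S ⊂ S' ∧ C ⊆ C' ∧ Buildable H k S' C' ∧
      ∀ u ∈ S', u ∉ S → ∀ x, H.Adj u x → x ∈ S' := by
  have hBS : B ⊆ S := hBC.trans h.subset
  -- Vertices outside `S` have degree at most two. A longest induced path avoiding `S` therefore
  -- exhausts its component of `H - S`, unless that component is a cycle, which has one more vertex.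
  obtain ⟨L, ⟨p, hp, hpS⟩, hmax⟩ := exists_longest_indPath (H := H) hS
  have hrev : ∀ p : ℕ → X, IndPath H p L → (∀ i ≤ L, p i ∉ S) →
      IndPath H (fun i => p (L - i)) L ∧ ∀ i ≤ L, p (L - i) ∉ S := fun p hp hpS =>
    ⟨hp.reverse, fun i _ => hpS _ (Nat.sub_le _ _)⟩
  have hnext : ∀ p : ℕ → X, IndPath H p L → ∀ i < L, H.Adj (p i) (p (i + 1)) := fun p hp i hi =>
    (hp.2 i (i + 1) (by omega) hi).2 rfl
  have hinner : ∀ p : ℕ → X, IndPath H p L → (∀ i ≤ L, p i ∉ S) → ∀ i, 0 < i → i < L → ∀ x,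
      H.Adj (p i) x → x = p (i - 1) ∨ x = p (i + 1) := by
    intro p hp hpS i hi0 hi x hx
    by_contra! hne
    refine hdeg (p i) (fun hB => hpS i hi.le (hBS hB)) (p (i - 1)) (p (i + 1)) x ?_
      (hnext p hp i hi) hx ?_ hne.1.symm hne.2.symm
    · have := hnext p hp (i - 1) (by omega)
      rw [Nat.sub_add_cancel hi0] at this
      exact this.symm
    · intro he
      have := hp.1 _ _ (by omega) (by omega) he
      omega
  -- By maximality `v` cannot prolong the path, so it has another neighbour on it. Inner path
  -- vertices have no neighbours off the path, so this neighbour is the other end, and `v` closes a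
  -- cycle.
  have hend : ∀ p : ℕ → X, IndPath H p L → (∀ i ≤ L, p i ∉ S) → ∀ v ∉ S, H.Adj (p L) v →
      (∀ i ≤ L, p i ≠ v) → 1 ≤ L ∧ H.Adj (p 0) v := by
    intro p hp hpS v hv hadj hne
    by_cases hex : ∃ i < L, H.Adj (p i) v
    · obtain ⟨i, hi, hiv⟩ := hex
      rcases Nat.eq_zero_or_pos i with rfl | hi0
      · exact ⟨hi, hiv⟩
      · rcases hinner p hp hpS i hi0 hi v hiv with h | h
        · exact absurd h.symm (hne _ (by omega))
        · exact absurd h.symm (hne _ (by omega))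
    · push Not at hex
      obtain ⟨q, hq, hqp, hqv⟩ := hp.snoc hne hadj hex
      refine absurd ⟨q, hq, fun i hi => ?_⟩ hmax
      rcases hi.lt_or_eq with h | rfl
      · rw [hqp i (by omega)]; exact hpS i (by omega)
      · rw [hqv]; exact hv
  have himg : ∀ p : ℕ → X, ∀ i ≤ L, p i ∈ (range (L + 1)).image p := fun p i hi =>
    mem_image_of_mem _ (mem_range.2 (by omega))
  -- Both `c` and `c'` are in `B`, and the path joins them by a walk of length `L + 2`, so their
  -- distance bound `4 * k + 5` becomes `L ≥ 4 * k + 3`.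
  have hlong : ∀ p : ℕ → X, IndPath H p L → (∀ i ≤ L, p i ∉ S) → ∀ c ∈ S, ∀ c' ∈ S, c ≠ c' →
      H.Adj c (p 0) → H.Adj c' (p L) → 4 * k + 3 ≤ L := by
    intro p hp hpS c hc c' hc' hne h0 hL
    obtain ⟨q, hq, -⟩ := exists_walk_of_adj p L (hnext p hp)
    have h1 := hdist c (hSB _ (hpS 0 (by omega)) c hc h0) c' (hSB _ (hpS L le_rfl) c' hc' hL) hne
      ((SimpleGraph.Walk.cons h0 (q.concat hL.symm)).reachable)
    have h2 := SimpleGraph.dist_le (SimpleGraph.Walk.cons h0 (q.concat hL.symm))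
    rw [SimpleGraph.Walk.length_cons, SimpleGraph.Walk.length_concat] at h2
    omega
  -- Two neighbours in `S` would give `p 0` degree three if `L > 0`, and would be branch vertices at
  -- distance at most two if `L = 0`.
  have huniq : ∀ p : ℕ → X, IndPath H p L → (∀ i ≤ L, p i ∉ S) → ∀ u ∈ S, ∀ u' ∈ S,
      H.Adj u (p 0) → H.Adj u' (p 0) → u = u' := by
    intro p hp hpS u hu u' hu' hadj hadj'
    by_contra hne
    rcases Nat.eq_zero_or_pos L with h0 | h0
    · have := hlong p hp hpS u hu u' hu' hne hadj (by rw [h0]; exact hadj')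
      omega
    · have h1 := hpS 1 h0
      exact hdeg (p 0) (fun hB => hpS 0 (by omega) (hBS hB)) u u' (p 1) hadj.symm hadj'.symm
        (hnext p hp 0 h0) hne (fun he => h1 (he ▸ hu)) (fun he => h1 (he ▸ hu'))
  have hinS : ∀ p : ℕ → X, IndPath H p L → (∀ i ≤ L, p i ∉ S) → ∀ i, 0 < i → i < L → ∀ u ∈ S,
      ¬ H.Adj u (p i) := by
    intro p hp hpS i hi0 hi u hu hadj
    rcases hinner p hp hpS i hi0 hi u hadj.symm with rfl | rfl
    · exact hpS _ (by omega) hu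
    · exact hpS _ (by omega) hu
  have hssub : ∀ (p : ℕ → X) (S' : Finset X), (∀ i ≤ L, p i ∉ S) → S ⊆ S' →
      S ⊂ S' ∪ (range (L + 1)).image p := by
    intro p S' hpS hS'
    refine (ssubset_iff_of_subset (hS'.trans subset_union_left)).2
      ⟨p 0, mem_union_right _ (himg p 0 (by omega)), hpS 0 (by omega)⟩
  by_cases hnc : ∀ p : ℕ → X, IndPath H p L → (∀ i ≤ L, p i ∉ S) → ∀ v ∉ S, H.Adj (p L) v →
      ∃ i ≤ L, p i = v
  · have hclosed : ∀ p : ℕ → X, IndPath H p L → (∀ i ≤ L, p i ∉ S) →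
        ∀ u ∈ S ∪ (range (L + 1)).image p, u ∉ S → ∀ x, H.Adj u x →
          x ∈ S ∪ (range (L + 1)).image p := by
      intro p hp hpS u hu huS x hx
      obtain ⟨i, hi, rfl⟩ := mem_image.1 ((mem_union.1 hu).resolve_left huS)
      have hi' := mem_range.1 hi
      by_cases hxS : x ∈ S
      · exact mem_union_left _ hxS
      · refine mem_union_right _ ?_
        rcases Nat.eq_zero_or_pos i with rfl | hi0
        · obtain ⟨j, hj, rfl⟩ := hnc _ (hrev p hp hpS).1 (hrev p hp hpS).2 x hxS (by simpa using hx)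
          exact himg p _ (Nat.sub_le _ _)
        · rcases (Nat.lt_succ_iff.1 hi').lt_or_eq with h' | rfl
          · rcases hinner p hp hpS i hi0 h' x hx with rfl | rfl
            · exact himg p _ (by omega)
            · exact himg p _ (by omega)
          · obtain ⟨j, hj, rfl⟩ := hnc p hp hpS x hxS hx
            exact himg p j hj
    have hpend : ∀ p : ℕ → X, IndPath H p L → (∀ i ≤ L, p i ∉ S) → ∀ c ∈ S, H.Adj c (p 0) →
        (0 < L → ∀ u ∈ S, ¬ H.Adj u (p L)) → ∃ S' C', S ⊂ S' ∧ C ⊆ C' ∧ Buildable H k S' C' ∧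
      ∀ u ∈ S', u ∉ S → ∀ x, H.Adj u x → x ∈ S' := by
      intro p hp hpS c hc h0 hL
      refine ⟨_, C, hssub p S hpS Subset.rfl, Subset.rfl,
        .pendant h (hBC (hSB _ (hpS 0 (by omega)) c hc h0)) hp hpS fun u hu i hi => ?_,
        hclosed p hp hpS⟩
      constructor
      · intro hadj
        rcases Nat.eq_zero_or_pos i with rfl | hi0
        · exact ⟨huniq p hp hpS u hu c hc hadj h0, rfl⟩
        · rcases hi.lt_or_eq with h' | rfl
          · exact absurd hadj (hinS p hp hpS i hi0 h' u hu)
          · exact absurd hadj (hL hi0 u hu)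
      · rintro ⟨rfl, rfl⟩; exact h0
    by_cases ha : ∃ c ∈ S, H.Adj c (p 0)
    · obtain ⟨c, hc, hcp⟩ := ha
      by_cases hb : 0 < L ∧ ∃ c' ∈ S, H.Adj c' (p L)
      · obtain ⟨hL, c', hc', hcp'⟩ := hb
        have hT : 4 * k + 3 ≤ L := by
          by_cases hne : c = c'
          · subst hne
            obtain ⟨w, q, hq, hql⟩ := hp.exists_cycle hL (v := c)
              (fun i hi he => hpS i hi (he ▸ hc)) hcp hcp'.symm
            have := hcyc w q hq
            omega
          · exact hlong p hp hpS c hc c' hc' hne hcp hcp'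
        refine ⟨_, C, hssub p S hpS Subset.rfl, Subset.rfl,
          .thread h (hBC (hSB _ (hpS 0 (by omega)) c hc hcp))
            (hBC (hSB _ (hpS L le_rfl) c' hc' hcp')) hp hT hpS fun u hu i hi => ?_,
          hclosed p hp hpS⟩
        constructor
        · intro hadj
          rcases Nat.eq_zero_or_pos i with rfl | hi0
          · exact Or.inl ⟨huniq p hp hpS u hu c hc hadj hcp, rfl⟩
          · rcases hi.lt_or_eq with h' | rfl
            · exact absurd hadj (hinS p hp hpS i hi0 h' u hu)
            · exact Or.inr ⟨huniq _ (hrev p hp hpS).1 (hrev p hp hpS).2 u hu c' hc'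
                (by simpa using hadj) (by simpa using hcp'), rfl⟩
        · rintro (⟨rfl, rfl⟩ | ⟨rfl, rfl⟩)
          · exact hcp
          · exact hcp'
      · push Not at hb
        exact hpend p hp hpS c hc hcp hb
    · push Not at ha
      by_cases hb : ∃ c' ∈ S, H.Adj c' (p L)
      · obtain ⟨c', hc', hcp'⟩ := hb
        exact hpend _ (hrev p hp hpS).1 (hrev p hp hpS).2 c' hc' (by simpa using hcp')
          (fun _ u hu => by simpa using ha u hu)
      · push Not at hb
        have hnone : ∀ u ∈ S, ∀ i ≤ L, ¬ H.Adj u (p i) := by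
          intro u hu i hi
          rcases Nat.eq_zero_or_pos i with rfl | hi0
          · exact ha u hu
          · rcases hi.lt_or_eq with h' | rfl
            · exact hinS p hp hpS i hi0 h' u hu
            · exact hb u hu
        -- No vertex of `S` is adjacent to the path: its first vertex becomes a center, and the
        -- rest, if any, a pendant path at it.
        have hcen := h.center (hpS 0 (by omega)) ha
        have hS' : ∀ S', S' = S ∪ (range (L + 1)).image p → Buildable H k S' (insert (p 0) C) →
            ∃ S' C', S ⊂ S' ∧ C ⊆ C' ∧ Buildable H k S' C' ∧
              ∀ u ∈ S', u ∉ S → ∀ x, H.Adj u x → x ∈ S' := by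
          rintro S' rfl hbd
          exact ⟨_, _, hssub p S hpS Subset.rfl, subset_insert _ _, hbd, hclosed p hp hpS⟩
        rcases Nat.eq_zero_or_pos L with h0 | h0
        · refine hS' _ ?_ hcen
          rw [h0]; ext x; simp [or_comm]
        · obtain ⟨M, rfl⟩ : ∃ M, L = 1 + M := ⟨L - 1, by omega⟩
          refine hS' _ ?_ (hcen.pendant (mem_insert_self _ _) hp.shift (fun i hi hm => ?_)
            fun u hu i hi => ?_)
          · ext x
            simp only [mem_union, mem_insert, mem_image, mem_range]
            constructor
            · rintro ((rfl | hx) | ⟨i, hi, rfl⟩)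
              · exact Or.inr ⟨0, by omega, rfl⟩
              · exact Or.inl hx
              · exact Or.inr ⟨1 + i, by omega, rfl⟩
            · rintro (hx | ⟨i, hi, rfl⟩)
              · exact Or.inl (Or.inr hx)
              · rcases Nat.eq_zero_or_pos i with rfl | hi0
                · exact Or.inl (Or.inl rfl)
                · exact Or.inr ⟨i - 1, by omega, by rw [Nat.add_sub_cancel' hi0]⟩
          · rcases mem_insert.1 hm with he | hm
            · have := hp.1 _ _ (by omega) (by omega) he; omega
            · exact hpS _ (by omega) hm
          · rcases mem_insert.1 hu with rfl | hu
            · rw [hp.2 0 (1 + i) (by omega) (by omega)]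
              simp
            · refine iff_of_false (hnone u hu _ (by omega)) ?_
              rintro ⟨rfl, -⟩
              exact hpS 0 (by omega) hu
  · push Not at hnc
    -- Here `p` and `v` form a cycle all of whose vertices have degree two, hence a whole component:
    -- `v` becomes a center and `p` a thread from `v` to itself.
    obtain ⟨p, hp, hpS, v, hvS, hLv, hne⟩ := hnc
    obtain ⟨hL, h0v⟩ := hend p hp hpS v hvS hLv hne
    have hT : 4 * k + 3 ≤ L := by
      obtain ⟨w, q, hq, hql⟩ := hp.exists_cycle hL hne h0v.symm hLv
      have := hcyc w q hq
      omega
    have hnbp : ∀ i ≤ L, ∀ x, H.Adj (p i) x → (∃ j ≤ L, x = p j) ∨ (x = v ∧ (i = 0 ∨ i = L)) := by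
      intro i hi x hx
      rcases Nat.eq_zero_or_pos i with rfl | hi0
      · by_contra! hcon
        exact hdeg (p 0) (fun hB => hpS 0 (by omega) (hBS hB)) v (p 1) x h0v (hnext p hp 0 hL) hx
          (hne 1 hL).symm (fun he => (hcon.2 he.symm).1 rfl) (hcon.1 1 hL).symm
      · rcases hi.lt_or_eq with h' | rfl
        · rcases hinner p hp hpS i hi0 h' x hx with rfl | rfl
          · exact Or.inl ⟨_, by omega, rfl⟩
          · exact Or.inl ⟨_, by omega, rfl⟩
        · by_contra! hcon
          have h1 := hnext p hp (i - 1) (by omega)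
          rw [Nat.sub_add_cancel hi0] at h1
          exact hdeg (p i) (fun hB => hpS i le_rfl (hBS hB)) v (p (i - 1)) x hLv h1.symm hx
            (hne _ (by omega)).symm (fun he => (hcon.2 he.symm).2 rfl) (hcon.1 _ (by omega)).symm
    have hnbv : ∀ x, H.Adj v x → x = p 0 ∨ x = p L := by
      intro x hx
      by_contra! hcon
      refine hdeg v (fun hB => hvS (hBS hB)) (p 0) (p L) x h0v.symm hLv.symm hx (fun he => ?_)
        hcon.1.symm hcon.2.symm
      have := hp.1 _ _ (by omega) le_rfl he
      omega
    have hcen := h.center hvS (fun u hu hadj => by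
      rcases hnbv u hadj.symm with rfl | rfl
      · exact hpS 0 (by omega) hu
      · exact hpS L le_rfl hu)
    refine ⟨_, _, hssub p (insert v S) hpS (subset_insert _ _), subset_insert _ _,
      hcen.thread (mem_insert_self _ _) (mem_insert_self _ _) hp hT (fun i hi hm => ?_)
        fun u hu i hi => ?_, fun u hu huS x hx => ?_⟩
    · rcases mem_insert.1 hm with he | hm
      · exact hne i hi he
      · exact hpS i hi hm
    · rcases mem_insert.1 hu with rfl | huS
      · constructor
        · intro hadj
          rcases hnbv _ hadj with he | he
          · exact Or.inl ⟨rfl, hp.1 _ _ hi (by omega) he⟩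
          · exact Or.inr ⟨rfl, hp.1 _ _ hi le_rfl he⟩
        · rintro (⟨-, rfl⟩ | ⟨-, rfl⟩)
          · exact h0v.symm
          · exact hLv.symm
      · refine iff_of_false (fun hadj => ?_) ?_
        · rcases hnbp i hi u hadj.symm with ⟨j, hj, rfl⟩ | ⟨rfl, -⟩
          · exact hpS j hj huS
          · exact hvS huS
        · rintro (⟨rfl, -⟩ | ⟨rfl, -⟩) <;> exact hvS huS
    · rcases mem_union.1 hu with hu | hu
      · rcases mem_insert.1 hu with rfl | hu
        · rcases hnbv x hx with rfl | rfl
          · exact mem_union_right _ (himg p 0 (by omega))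
          · exact mem_union_right _ (himg p L le_rfl)
        · exact absurd hu huS
      · obtain ⟨i, hi, rfl⟩ := mem_image.1 hu
        have hi' := mem_range.1 hi
        rcases hnbp i (by omega) x hx with ⟨j, hj, rfl⟩ | ⟨rfl, -⟩
        · exact mem_union_right _ (himg p j hj)
        · exact mem_union_left _ (mem_insert_self _ _)

/-- A graph with branch-length at least `4 * k + 5` and branch vertices `B` is buildable. -/
theorem exists_buildable [Fintype X] {k : ℕ} {B : Finset X}
    (hdeg : ∀ x ∉ B, ∀ a b d, H.Adj x a → H.Adj x b → H.Adj x d → a ≠ b → a ≠ d → b ≠ d → False)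
    (hdist : ∀ u ∈ B, ∀ v ∈ B, u ≠ v → H.Reachable u v → 4 * k + 5 ≤ H.dist u v)
    (hcyc : ∀ (w : X) (q : H.Walk w w), q.IsCycle → 4 * k + 5 ≤ q.length) :
    ∃ C, Buildable H k univ C := by
  have key : ∀ (m : ℕ) (S C : Finset X), Fintype.card X ≤ #S + m → Buildable H k S C → B ⊆ C →
      (∀ x ∉ S, ∀ u ∈ S, H.Adj u x → u ∈ B) → ∃ C, Buildable H k univ C := by
    intro m
    induction m with
    | zero =>
      intro S C hm h _ _
      exact ⟨C, (card_eq_iff_eq_univ S).1 (le_antisymm (card_le_univ S) hm) ▸ h⟩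
    | succ m ih =>
      intro S C hm h hBC hSB
      by_cases hS : S = univ
      · exact ⟨C, hS ▸ h⟩
      · obtain ⟨S', C', hSS', hCC', h', hcl⟩ := h.exists_larger hdeg hdist hcyc hBC hSB hS
        refine ih S' C' (by have := card_lt_card hSS'; omega) h' (hBC.trans hCC')
          fun x hx u hu hadj => ?_
        by_cases huS : u ∈ S
        · exact hSB x (fun hxS => hx (hSS'.1 hxS)) u huS hadj
        · exact absurd (hcl u hu huS x hadj) hx
  -- All branch vertices are made centers at the outset; they are independent because distinct ones
  -- in a component are at distance at least `4 * k + 5`.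
  refine key (Fintype.card X) B B (by omega) (buildable_of_independent B fun u hu v hv hadj => ?_)
    Subset.rfl fun x hx u hu _ => hu
  have := hdist u hu v hv hadj.ne hadj.reachable
  rw [SimpleGraph.dist_eq_one_iff_adj.2 hadj] at this
  omega

end Decomposition

end PurePairs

/-! ### Embedding a buildable graph -/

namespace PurePairs

open Finset
open scoped Classical

variable {V X : Type*} {G : SimpleGraph V} {H : SimpleGraph X}

/-- An induced embedding of `A` extends along an induced path. -/
lemma exists_extend_path {A : Finset X} {φ : X → V} {T : ℕ} {u : ℕ → X} {p : ℕ → V}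
    (hinj : ∀ x ∈ A, ∀ x' ∈ A, φ x = φ x' → x = x')
    (hadj : ∀ x ∈ A, ∀ x' ∈ A, (G.Adj (φ x) (φ x') ↔ H.Adj x x'))
    (hu : IndPath H u T) (huA : ∀ i ≤ T, u i ∉ A) (hp : IndPath G p T)
    (hpA : ∀ i ≤ T, p i ∉ A.image φ)
    (hup : ∀ x ∈ A, ∀ i ≤ T, (G.Adj (φ x) (p i) ↔ H.Adj x (u i))) :
    ∃ ψ : X → V, (∀ x ∈ A, ψ x = φ x) ∧
      (A ∪ (range (T + 1)).image u).image ψ = A.image φ ∪ (range (T + 1)).image p ∧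
      (∀ x ∈ A ∪ (range (T + 1)).image u, ∀ x' ∈ A ∪ (range (T + 1)).image u,
        ψ x = ψ x' → x = x') ∧
      (∀ x ∈ A ∪ (range (T + 1)).image u, ∀ x' ∈ A ∪ (range (T + 1)).image u,
        (G.Adj (ψ x) (ψ x') ↔ H.Adj x x')) := by
  obtain ⟨ψ, hψA, hψu⟩ : ∃ ψ : X → V, (∀ x ∈ A, ψ x = φ x) ∧ ∀ i ≤ T, ψ (u i) = p i := by
    refine ⟨fun x => if h : ∃ i ≤ T, u i = x then p h.choose else φ x, fun x hx => ?_,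
      fun i hi => ?_⟩
    · refine dif_neg ?_
      rintro ⟨i, hi, rfl⟩
      exact huA i hi hx
    · have h : ∃ j ≤ T, u j = u i := ⟨i, hi, rfl⟩
      exact (dif_pos h).trans (congrArg p (hu.1 _ _ h.choose_spec.1 hi h.choose_spec.2))
  have hmem : ∀ x ∈ A ∪ (range (T + 1)).image u, x ∈ A ∨ ∃ i ≤ T, x = u i := by
    intro x hx
    rcases mem_union.1 hx with hx | hx
    · exact Or.inl hx
    · obtain ⟨i, hi, rfl⟩ := mem_image.1 hx
      exact Or.inr ⟨i, Nat.lt_succ_iff.1 (mem_range.1 hi), rfl⟩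
  refine ⟨ψ, hψA, ?_, fun x hx x' hx' he => ?_, fun x hx x' hx' => ?_⟩
  · rw [image_union, image_image]
    congr 1
    · exact image_congr hψA
    · exact image_congr fun i hi => hψu i (Nat.lt_succ_iff.1 (mem_range.1 hi))
  · rcases hmem x hx with h | ⟨i, hi, rfl⟩ <;> rcases hmem x' hx' with h' | ⟨j, hj, rfl⟩
    · rw [hψA x h, hψA x' h'] at he
      exact hinj x h x' h' he
    · rw [hψA x h, hψu j hj] at he
      exact absurd (he ▸ mem_image_of_mem φ h) (hpA j hj)
    · rw [hψA x' h', hψu i hi] at he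
      exact absurd (he ▸ mem_image_of_mem φ h') (hpA i hi)
    · rw [hψu i hi, hψu j hj] at he
      rw [hp.1 i j hi hj he]
  · rcases hmem x hx with h | ⟨i, hi, rfl⟩ <;> rcases hmem x' hx' with h' | ⟨j, hj, rfl⟩
    · rw [hψA x h, hψA x' h', hadj x h x' h']
    · rw [hψA x h, hψu j hj, hup x h j hj]
    · rw [hψA x' h', hψu i hi, G.adj_comm, hup x' h' i hi, H.adj_comm]
    · rw [hψu i hi, hψu j hj]
      rcases lt_trichotomy i j with h | rfl | h
      · rw [hp.2 i j h hj, hu.2 i j h hj]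
      · exact iff_of_false G.irrefl H.irrefl
      · rw [G.adj_comm, H.adj_comm, hp.2 j i h hi, hu.2 j i h hi]

variable {α β s Δ ζ C C' y : ℝ} {k f J : ℕ} {U W R : Finset V} {𝒟 : Finset (Finset V)}
  {Q : Finset V → V → Finset V}

/-- A buildable set embeds into a graph that contains a sufficiently rich hub. -/
lemma Setup.exists_embedding [Fintype X] (S : Setup G α β s Δ ζ C C' y k f J U W R 𝒟 Q)
    (hf : Fintype.card X ≤ f) (hJ : Fintype.card X + 4 * k + 3 ≤ J)
    (h𝒟 : 2 * Fintype.card X ≤ #𝒟) {A Z : Finset X} (hA : Buildable H k A Z) :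
    ∃ (φ : X → V) (𝒰 : Finset (Finset V)), State G U W 𝒟 Q (A.image φ) 𝒰 ∧
      (∀ x ∈ A, ∀ x' ∈ A, φ x = φ x' → x = x') ∧
      (∀ x ∈ A, ∀ x' ∈ A, (G.Adj (φ x) (φ x') ↔ H.Adj x x')) ∧ (∀ x ∈ Z, φ x ∈ W) ∧
      2 * Fintype.card X ≤ #𝒰 + 2 * #A := by
  have hcardF : ∀ (A : Finset X) (φ : X → V), #(A.image φ) ≤ f := fun A φ =>
    card_image_le.trans ((card_le_univ A).trans hf)
  have hcardA : ∀ (A : Finset X) (u : ℕ → X) (T : ℕ), IndPath H u T → (∀ i ≤ T, u i ∉ A) →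
      #(A ∪ (range (T + 1)).image u) = #A + (T + 1) := by
    intro A u T hu huA
    rw [card_union_of_disjoint, card_image_of_injOn, card_range]
    · intro i hi j hj hij
      simp only [coe_range, Set.mem_Iio] at hi hj
      exact hu.1 i j (by omega) (by omega) hij
    · refine disjoint_right.2 fun x hx => ?_
      obtain ⟨i, hi, rfl⟩ := mem_image.1 hx
      exact huA i (Nat.lt_succ_iff.1 (mem_range.1 hi))
  have htwo : ∀ 𝒰 : Finset (Finset V), 2 ≤ #𝒰 → ∃ D ∈ 𝒰, ∃ D' ∈ 𝒰, D ≠ D' ∧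
      #𝒰 = #((𝒰.erase D).erase D') + 2 := by
    intro 𝒰 h
    obtain ⟨D, hD, D', hD', hne⟩ := one_lt_card.1 h
    refine ⟨D, hD, D', hD', hne, ?_⟩
    rw [card_erase_of_mem (mem_erase.2 ⟨hne.symm, hD'⟩), card_erase_of_mem hD]
    omega
  induction hA with
  | empty =>
    have hst : State G U W 𝒟 Q ∅ 𝒟 := ⟨empty_subset _, Subset.rfl, by simp, by simp⟩
    -- Only a default value for the map is needed; the existence of a center shows that `V` is
    -- nonempty.
    obtain ⟨z, -⟩ := S.exists_center hst (by simp)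
    exact ⟨fun _ => z, 𝒟, by simpa using hst, by simp, by simp, by simp, by simpa using h𝒟⟩
  | @center A Z x hA hx hxA ih =>
    obtain ⟨φ, 𝒰, hst, hinj, hadj, hW, hcard⟩ := ih
    obtain ⟨z, hzW, hzF, hzadj, hst'⟩ := S.exists_center hst (hcardF A φ)
    obtain ⟨ψ, hψA, hψi, hψinj, hψadj⟩ := exists_extend_path (T := 0) (u := fun _ => x)
      (p := fun _ => z) hinj hadj (indPath_zero _) (fun _ _ => hx) (indPath_zero _)
      (fun _ _ => hzF) (fun w hw _ _ => iff_of_false (hzadj _ (mem_image_of_mem _ hw)) (hxA w hw))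
    have h1 : A ∪ (range (0 + 1)).image (fun _ => x) = insert x A := by
      ext; simp
    have h2 : A.image φ ∪ (range (0 + 1)).image (fun _ => z) = insert z (A.image φ) := by
      ext; simp
    rw [h1, h2] at hψi
    rw [h1] at hψinj hψadj
    refine ⟨ψ, 𝒰, hψi ▸ hst', hψinj, hψadj, fun w hw => ?_, ?_⟩
    · rcases mem_insert.1 hw with rfl | hw
      · have h3 : ψ w ∈ insert z (A.image φ) := hψi ▸ mem_image_of_mem ψ (mem_insert_self _ _)
        rcases mem_insert.1 h3 with h3 | h3
        · exact h3 ▸ hzW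
        · obtain ⟨w', hw', he⟩ := mem_image.1 h3
          rw [← hψA w' hw'] at he
          have := hψinj w' (mem_insert_of_mem hw') w (mem_insert_self _ _) he
          exact absurd (this ▸ hw') hx
      · rw [hψA w (hA.subset hw)]; exact hW w hw
    · rw [card_insert_of_notMem hx]; omega
  | @thread A Z c c' u T hA hc hc' hu hT huA huadj ih =>
    obtain ⟨φ, 𝒰, hst, hinj, hadj, hW, hcard⟩ := ih
    have hcA := hcardA A u T hu huA
    have hle := card_le_univ (A ∪ (range (T + 1)).image u)
    -- The budget `2 * Fintype.card X ≤ #𝒰 + 2 * #A` guarantees two unused sets, and it persists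
    -- because a thread spends two of them and adds at least one vertex.
    obtain ⟨D, hD, D', hD', hne, h𝒰⟩ := htwo 𝒰 (by omega)
    obtain ⟨p, hp, hpF, hpadj, hst'⟩ := S.exists_thread hst (hcardF A φ)
      (mem_image_of_mem φ (hA.subset hc)) (hW c hc) (mem_image_of_mem φ (hA.subset hc'))
      (hW c' hc') hD hD' hne hT (by omega)
    obtain ⟨ψ, hψA, hψi, hψinj, hψadj⟩ := exists_extend_path hinj hadj hu huA hp hpF
      (fun x hx i hi => by
        rw [hpadj _ (mem_image_of_mem _ hx) i hi, huadj x hx i hi]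
        have h1 : ∀ w ∈ Z, (φ x = φ w ↔ x = w) := fun w hw =>
          ⟨hinj x hx w (hA.subset hw), fun h => by rw [h]⟩
        rw [h1 c hc, h1 c' hc'])
    refine ⟨ψ, _, hψi ▸ hst', hψinj, hψadj, fun w hw => ?_, by omega⟩
    rw [hψA w (hA.subset hw)]; exact hW w hw
  | @pendant A Z c u T hA hc hu huA huadj ih =>
    obtain ⟨φ, 𝒰, hst, hinj, hadj, hW, hcard⟩ := ih
    have hcA := hcardA A u T hu huA
    have hle := card_le_univ (A ∪ (range (T + 1)).image u)
    obtain ⟨D, hD, D', hD', hne, h𝒰⟩ := htwo 𝒰 (by omega)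
    -- A pendant path is an initial segment of a thread from `c` back to `c`. The extra `4 * k + 4`
    -- makes the thread long enough, and keeps its far end, the other neighbour of `c`, out of the
    -- segment.
    obtain ⟨p, hp, hpF, hpadj, hst'⟩ := S.exists_thread hst (hcardF A φ)
      (mem_image_of_mem φ (hA.subset hc)) (hW c hc) (mem_image_of_mem φ (hA.subset hc))
      (hW c hc) hD hD' hne (T := T + 4 * k + 4) (by omega) (by omega)
    obtain ⟨ψ, hψA, hψi, hψinj, hψadj⟩ := exists_extend_path hinj hadj hu huA
      (hp.take (by omega : T ≤ _)) (fun i hi => hpF i (by omega))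
      (fun x hx i hi => by
        rw [hpadj _ (mem_image_of_mem _ hx) i (by omega), huadj x hx i hi]
        have h1 : φ x = φ c ↔ x = c := ⟨hinj x hx c (hA.subset hc), fun h => by rw [h]⟩
        have h2 : i ≠ T + 4 * k + 4 := by omega
        simp only [h1, h2, and_false, or_false])
    refine ⟨ψ, _, hψi ▸ hst'.mono (union_subset_union Subset.rfl (image_subset_image
      (range_subset_range.2 (by omega)))) Subset.rfl, hψinj, hψadj, fun w hw => ?_, by omega⟩
    rw [hψA w (hA.subset hw)]; exact hW w hw

end PurePairs

/-! ### Choice of constants and assembly -/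

namespace PurePairs

open Finset
open scoped Classical

universe v

variable {X : Type*} {H : SimpleGraph X}

/-- The constants of the construction, for graphs on `h` vertices and hubs of radius `k`. -/
lemma exists_constants (h k : ℕ) : ∃ κ w C' δ : ℝ, 0 < κ ∧ κ ≤ 1 ∧ 0 < w ∧ w ≤ 1 ∧ 0 < C' ∧
    0 < δ ∧ δ ≤ 1 ∧ 4 * κ ≤ w ∧
    8 * δ ≤ w ∧ (C' + 3) * δ ≤ w ∧
    4 * ((3 * ((2 * h + 1) * k) + 2) + (h + 4 * k + 3 : ℕ) + 1) ≤ C' * w ∧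
    10 * δ * 4 ^ 2 ^ (2 * h + 2) * 2 ^ (2 * h + 2) ≤ 1 ∧
    2 * (2 * k + 2) * w ≤ 1 / (4 * 2 ^ (2 * h + 2) * 4 ^ 2 ^ (2 * h + 2)) ∧
    2 * (w * 3 ^ (h + 4 * k + 3 + 1)) ≤ 1 / (4 * 2 ^ (2 * h + 2) * 4 ^ 2 ^ (2 * h + 2)) ∧
    2 * (h * ((3 * ((2 * h + 1) * k) + 2) + 1) * δ) ≤
      1 / (4 * 2 ^ (2 * h + 2) * 4 ^ 2 ^ (2 * h + 2)) ∧
    4 * (h * δ) ≤ 1 / (4 * 2 ^ (2 * h + 2) * 4 ^ 2 ^ (2 * h + 2)) := by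
  obtain ⟨M, hM⟩ : ∃ M : ℝ, M = 2 ^ (2 * h + 2) := ⟨_, rfl⟩
  obtain ⟨E, hE⟩ : ∃ E : ℝ, E = 4 ^ 2 ^ (2 * h + 2) := ⟨_, rfl⟩
  obtain ⟨P, hP⟩ : ∃ P : ℝ, P = 3 ^ (h + 4 * k + 3 + 1) := ⟨_, rfl⟩
  obtain ⟨c, hc⟩ : ∃ c : ℝ, c = 3 * ((2 * h + 1) * k) + 2 := ⟨_, rfl⟩
  rw [← hM, ← hE, ← hP, ← hc]
  have hM1 : 1 ≤ M := hM ▸ one_le_pow₀ (by norm_num)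
  have hE1 : 1 ≤ E := hE ▸ one_le_pow₀ (by norm_num)
  have hP1 : 1 ≤ P := hP ▸ one_le_pow₀ (by norm_num)
  have hc0 : 0 ≤ c := by rw [hc]; positivity
  -- `b` is a lower bound for the densities of `W` and `R` in the regular set `U`. The other
  -- constants are densities in `U` too: `w` for `y`, `κ` for `ζ`, and `δ` as an upper bound for
  -- `β`.
  obtain ⟨b, hb⟩ : ∃ b : ℝ, b = 1 / (4 * M * E) := ⟨_, rfl⟩
  have hb0 : 0 < b := by rw [hb]; positivity
  have hME : 1 ≤ M * E := one_le_mul_of_one_le_of_one_le hM1 hE1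
  have hb1 : b ≤ 1 := by rw [hb]; exact (div_le_one (by positivity)).2 (by linarith)
  rw [← hb]
  obtain ⟨w, hw⟩ : ∃ w : ℝ, w = b / (2 * (2 * k + 2) * P) := ⟨_, rfl⟩
  have hk0 : (0 : ℝ) ≤ k := Nat.cast_nonneg k
  have hw0 : 0 < w := by rw [hw]; positivity
  have hwP : 2 * (2 * k + 2) * P * w = b := by rw [hw]; field_simp
  have h1 : 2 * (2 * k + 2) * w ≤ b := by
    rw [← hwP]
    have : 2 * (2 * (k : ℝ) + 2) * 1 ≤ 2 * (2 * k + 2) * P := by gcongr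
    nlinarith
  have h2 : 2 * (w * P) ≤ b := by
    rw [← hwP]
    have : 0 ≤ k * (P * w) := by positivity
    have : 0 ≤ P * w := by positivity
    nlinarith
  have hw1 : w ≤ b := by
    have : 0 ≤ k * w := by positivity
    nlinarith
  obtain ⟨C', hC'⟩ : ∃ C' : ℝ, C' = 4 * (c + (h + 4 * k + 3 : ℕ) + 1) / w := ⟨_, rfl⟩
  have hC'0 : 0 < C' := by rw [hC']; positivity
  -- `K` is the sum of all coefficients that `δ` meets, so `δ = w / K` satisfies every upper bound
  -- simultaneously.
  obtain ⟨K, hK⟩ : ∃ K : ℝ, K = 8 + (C' + 3) + 10 * E * M + 2 * (h * (c + 1)) + 4 * h := ⟨_, rfl⟩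
  have hh : (0 : ℝ) ≤ h := Nat.cast_nonneg h
  have hEM : 0 ≤ 10 * E * M := by positivity
  have hhc : 0 ≤ 2 * (h * (c + 1)) := by positivity
  have hK0 : 0 < K := by rw [hK]; linarith
  have hKδ : K * (w / K) = w := by field_simp
  have hδ : 0 < w / K := by positivity
  refine ⟨w / 4, w, C', w / K, by positivity, by linarith, hw0, by linarith, hC'0, hδ, ?_,
    by linarith, ?_, ?_, ?_, ?_, h1, h2, ?_, ?_⟩
  · refine (div_le_one hK0).2 ?_
    rw [hK]; linarith
  · exact (mul_le_mul_of_nonneg_right (by rw [hK]; linarith) hδ.le).trans_eq hKδ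
  · exact (mul_le_mul_of_nonneg_right (by rw [hK]; linarith) hδ.le).trans_eq hKδ
  · rw [hC']
    exact (div_mul_cancel₀ _ hw0.ne').ge
  · have : 10 * E * M * (w / K) ≤ K * (w / K) :=
      mul_le_mul_of_nonneg_right (by rw [hK]; linarith) hδ.le
    linarith
  · have : 2 * (h * (c + 1)) * (w / K) ≤ K * (w / K) :=
      mul_le_mul_of_nonneg_right (by rw [hK]; linarith) hδ.le
    linarith
  · have : 4 * (h : ℝ) * (w / K) ≤ K * (w / K) :=
      mul_le_mul_of_nonneg_right (by rw [hK]; linarith) hδ.le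
    linarith

set_option maxHeartbeats 800000 in
/-- Sparse coherent graphs contain all buildable graphs. -/
theorem exists_embedding_of_coh [Fintype X] {k : ℕ} (hk : 1 ≤ k) {Z : Finset X}
    (hZ : Buildable H k univ Z) :
    ∃ ε : ℝ, 0 < ε ∧ ∀ (V : Type v) [Fintype V] (G : SimpleGraph V) (s α : ℝ),
      1 ≤ s → s ^ (2 * k) = Fintype.card V → 1 ≤ ε * Fintype.card V →
      α * s ^ 2 = ε * Fintype.card V → Coh G α (ε * Fintype.card V) →
      (∀ v, (#(nv G v univ) : ℝ) ≤ ε * Fintype.card V) →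
      ∃ φ : X → V, Function.Injective φ ∧ ∀ x x', (G.Adj (φ x) (φ x') ↔ H.Adj x x') := by
  obtain ⟨κ, w, C', δ, hκ, hκ1, hw, hw1, hC', hδ, hδ1, hκw, hδw, hC'w, hCw, hδM, hwk, hwJ, hδh, hδh'⟩ :=
    exists_constants (Fintype.card X) k
  obtain ⟨h, hh⟩ : ∃ h, h = Fintype.card X := ⟨_, rfl⟩
  rw [← hh] at hCw hδM hwk hwJ hδh hδh'
  -- The condition `2 * (C' + 2) < s` is the same as `B < n`, since `s ^ (2 * k) = n`. It follows
  -- from `ε * B < 1 ≤ ε * n`.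
  obtain ⟨B, hB⟩ : ∃ B : ℝ, B = (2 * (C' + 2)) ^ (2 * k) := ⟨_, rfl⟩
  have hB0 : 0 < B := by rw [hB]; positivity
  -- The equation `ε * (3 + B) = δ * κ ^ (2 * k)` gives at once `β ≤ δ * #U`, the size condition of
  -- `Coh.exists_regular`, and `ε * B < 1`.
  obtain ⟨ε, hε⟩ : ∃ ε, ε = δ * κ ^ (2 * k) / (3 + B) := ⟨_, rfl⟩
  have hκk : 0 < κ ^ (2 * k) := by positivity
  have hκk1 : κ ^ (2 * k) ≤ 1 := pow_le_one₀ hκ.le hκ1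
  have hε0 : 0 < ε := by rw [hε]; positivity
  have hεB : ε * (3 + B) = δ * κ ^ (2 * k) := by rw [hε]; field_simp
  have hεB0 : 0 < ε * B := by positivity
  have hδκ : δ * κ ^ (2 * k) ≤ κ ^ (2 * k) := mul_le_of_le_one_left hκk.le hδ1
  have hεδ : ε ≤ δ * κ ^ (2 * k) := by linarith
  have hε3 : 3 * ε ≤ κ ^ (2 * k) := by linarith
  have hεB1 : ε * B < 1 := by linarith
  have hε1 : ε < 1 := by linarith
  refine ⟨ε, hε0, ?_⟩
  intro V _ G s α hs hsn hβ hαβ hcoh hdeg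
  obtain ⟨n, hn⟩ : ∃ n : ℝ, n = Fintype.card V := ⟨_, rfl⟩
  obtain ⟨β, hβe⟩ : ∃ β : ℝ, β = ε * n := ⟨_, rfl⟩
  rw [← hn] at hsn hβ hαβ hcoh hdeg
  rw [← hβe] at hβ hαβ hcoh hdeg
  have hn0 : 0 ≤ n := by rw [hn]; positivity
  have hs2 : 0 < s ^ 2 := by positivity
  have hα : 0 < α := by
    by_contra hcon
    have : α * s ^ 2 ≤ 0 := mul_nonpos_of_nonpos_of_nonneg (not_lt.1 hcon) hs2.le
    linarith
  have hαleβ : α ≤ β := by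
    rw [← hαβ]; exact le_mul_of_one_le_right hα.le (one_le_pow₀ hs)
  have hnpos : 0 < n := by
    rcases hn0.lt_or_eq with h | h
    · exact h
    · rw [hβe, ← h] at hβ; norm_num at hβ
  have hβn : β < n := by rw [hβe]; exact mul_lt_of_lt_one_left hnpos hε1
  obtain ⟨U, -, Δ, hUn, hΔ, hΔβ, hUΔ, hreg⟩ := hcoh.exists_regular hα hαleβ hβ hs hκ (2 * k)
    (by rw [hsn]; exact hβn) univ hdeg hκ1 (by
      rw [card_univ, ← hn, hβe, ← mul_assoc]
      exact mul_le_mul_of_nonneg_right hε3 hn0)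
  rw [card_univ, ← hn] at hUn
  obtain ⟨u, hu⟩ : ∃ u : ℝ, u = #U := ⟨_, rfl⟩
  rw [← hu] at hUn hreg
  have hu0 : 0 ≤ u := by rw [hu]; positivity
  have hβu : β ≤ δ * u := by
    calc β ≤ δ * κ ^ (2 * k) * n := by rw [hβe]; exact mul_le_mul_of_nonneg_right hεδ hn0
      _ = δ * (κ ^ (2 * k) * n) := by ring
      _ ≤ δ * u := mul_le_mul_of_nonneg_left hUn hδ.le
  -- the hub
  obtain ⟨M, hM⟩ : ∃ M : ℕ, M = 2 ^ (2 * h + 1 + 1) := ⟨_, rfl⟩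
  obtain ⟨E, hE⟩ : ∃ E : ℝ, E = 4 ^ 2 ^ (2 * h + 1 + 1) := ⟨_, rfl⟩
  have hMr : (2 : ℝ) ^ (2 * h + 2) = M := by rw [hM]; push_cast; rfl
  have hEr : (4 : ℝ) ^ 2 ^ (2 * h + 2) = E := by rw [hE]
  rw [hMr, hEr] at hδM hwk hwJ hδh hδh'
  have hM1 : 1 ≤ M := hM ▸ Nat.one_le_two_pow
  have hM1r : (1 : ℝ) ≤ M := by exact_mod_cast hM1
  have hE1 : 1 ≤ E := hE ▸ one_le_pow₀ (by norm_num)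
  have hEM : 0 < E * M := by positivity
  have hEMβ : 10 * (E * M) * β ≤ u := by
    calc 10 * (E * M) * β ≤ 10 * (E * M) * (δ * u) := by gcongr
      _ = (10 * δ * E * M) * u := by ring
      _ ≤ 1 * u := mul_le_mul_of_nonneg_right hδM hu0
      _ = u := one_mul u
  obtain ⟨q, hq⟩ : ∃ q : ℕ, q = #U / M := ⟨_, rfl⟩
  have hqU : M * q ≤ #U := by rw [hq]; exact Nat.mul_div_le _ _
  have hMu : 2 * M ≤ u := by
    have h1 : (1 : ℝ) * M ≤ E * M := mul_le_mul_of_nonneg_right hE1 (by positivity)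
    have h2 : E * M * 1 ≤ E * M * β := mul_le_mul_of_nonneg_left hβ hEM.le
    linarith
  have hqu : u ≤ 2 * M * q := by
    have h1 : #U < M * (q + 1) := by rw [hq]; exact Nat.lt_mul_div_succ _ hM1
    have h2 : u < M * (q + 1) := by rw [hu]; exact_mod_cast h1
    rw [mul_add, mul_one] at h2
    linarith
  have hqE : 5 * β * E ≤ q := by
    have h1 : 2 * M * (5 * β * E) ≤ 2 * M * q := by linarith
    exact le_of_mul_le_mul_left h1 (by positivity)
  -- Depth `k - 1` suffices because `(s ^ 2) ^ k = n > β = α * s ^ 2`. The embedding needs `2 * h`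
  -- sets; one more keeps the family nonempty even for `h = 0`.
  obtain ⟨W₀, R, 𝒟, hW₀U, hRU, hWR, hW₀, hR, h𝒟, hD, hDD⟩ := hcoh.exists_hub hα
    (one_le_pow₀ hs : (1 : ℝ) ≤ s ^ 2) hαβ (r := k - 1)
    (by
      have h1 : α * s ^ 2 ≤ (s ^ 2) ^ (k - 1) * s ^ 2 := by
        rw [hαβ, ← pow_succ, Nat.sub_add_cancel hk, ← pow_mul, hsn]
        exact hβn.le
      exact le_of_mul_le_mul_right h1 hs2)
    (U := U) (fun v => (card_nv_mono v (subset_univ U)).trans (hdeg v)) (2 * h + 1) (q := q)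
    (by rw [← hM]; exact hqU) (by rw [← hE]; exact hqE)
  rw [← hE] at hW₀ hR
  obtain ⟨Q, hub₀⟩ := exists_hub_of_cover hW₀U hRU hWR hD hDD
  rw [Nat.sub_add_cancel hk] at hub₀
  obtain ⟨W, hW₀W, hub, hconf⟩ := hub₀.exists_generic hΔ hUΔ (by omega) hk
  obtain ⟨b, hb⟩ : ∃ b : ℝ, b = 1 / (4 * M * E) := ⟨_, rfl⟩
  rw [← hb] at hwk hwJ hδh hδh'
  have hb0 : 0 < b := by rw [hb]; positivity
  have hbq : 2 * (b * u) ≤ q / E := by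
    rw [le_div_iff₀ (by positivity), hb]
    calc 2 * (1 / (4 * M * E) * u) * E = u / (2 * M) := by field_simp; ring
      _ ≤ q := by rw [div_le_iff₀ (by positivity)]; linarith
  have hbu : 0 ≤ b * u := by positivity
  have hbW : b * u ≤ #W := by linarith
  have hbR : b * u ≤ #R := by linarith
  have hmul : ∀ {a : ℝ}, a ≤ b → a * u ≤ b * u := fun h => mul_le_mul_of_nonneg_right h hu0
  have hβpos : 0 ≤ β := by linarith
  have hS : Setup G α β s Δ (κ * u) (3 * ((2 * h + 1) * k) + 2) C' (w * u) k h (h + 4 * k + 3)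
      U W R 𝒟 Q := by
    refine ⟨hub, hcoh, hα, hs, hαβ, hΔ, hΔβ, hUΔ, hreg, ?_, by positivity, hC', ?_, ?_, ?_, ?_, ?_,
      ?_, ?_, ?_, ?_⟩
    · rw [h𝒟] at hconf
      push_cast at hconf
      exact hconf
    · have := mul_le_mul_of_nonneg_right hδw hu0
      linarith
    · have := mul_le_mul_of_nonneg_right hκw hu0
      linarith
    · have := hmul hwk
      linarith
    · have h1 := hmul hδh
      have h2 : 2 * (h * ((3 * ((2 * h + 1) * k) + 2) + 1) * β) ≤
          2 * (h * ((3 * ((2 * h + 1) * k) + 2) + 1) * (δ * u)) := by gcongr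
      linarith
    · have := hmul hwJ
      linarith
    · have h1 := hmul hδh'
      have h2 : 4 * (h * β) ≤ 4 * (h * (δ * u)) := by gcongr
      linarith
    · rw [← hu]
      have := mul_le_mul_of_nonneg_right hCw hu0
      linarith
    · have h1 := mul_le_mul_of_nonneg_right hC'w hu0
      have h2 : (C' + 3) * β ≤ (C' + 3) * (δ * u) := by gcongr
      linarith
    · have h1 : B < n := by
        have h2 : ε * B < ε * n := by linarith
        exact lt_of_mul_lt_mul_left h2 hε0.le
      rw [hB, ← hsn] at h1
      exact lt_of_pow_lt_pow_left₀ _ (by linarith) h1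
  obtain ⟨φ, -, -, hinj, hadj, -⟩ := hS.exists_embedding (by rw [hh]) (by rw [hh]) (by omega) hZ
  exact ⟨φ, fun x x' => hinj x (mem_univ _) x' (mem_univ _),
    fun x x' => hadj x (mem_univ _) x' (mem_univ _)⟩

end PurePairs

/-! ### Translation to the stated hypotheses -/

namespace PurePairs

open Finset
open scoped Classical

lemma exists_buildable_of_degree {X : Type*} [Fintype X] {H : SimpleGraph X} [DecidableRel H.Adj]
    {k : ℕ}
    (hdist : ∀ u v, u ≠ v → 3 ≤ H.degree u → 3 ≤ H.degree v → H.Reachable u v →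
      4 * k + 5 ≤ H.dist u v)
    (hcyc : ∀ (w : X) (q : H.Walk w w), q.IsCycle → 4 * k + 5 ≤ q.length) :
    ∃ Z, Buildable H k univ Z := by
  refine exists_buildable (B := univ.filter fun x => 3 ≤ H.degree x)
    (fun x hx a b d ha hb hd hab had hbd => hx (mem_filter.2 ⟨mem_univ x, ?_⟩))
    (fun u hu v hv huv => hdist u v huv (mem_filter.1 hu).2 (mem_filter.1 hv).2) hcyc
  have hsub : ({a, b, d} : Finset X) ⊆ H.neighborFinset x := by
    intro z hz
    simp only [mem_insert, mem_singleton] at hz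
    rcases hz with rfl | rfl | rfl <;> simpa
  rw [← H.card_neighborFinset_eq_degree, ← card_eq_three.2 ⟨a, b, d, hab, had, hbd, rfl⟩]
  exact card_le_card hsub

variable {V : Type*} {G : SimpleGraph V}

lemma IsCoherent.coh {α β : ℝ} (h : IsCoherent G α β) : Coh G α β := by
  intro A B hAB hadj hA
  by_contra hB
  exact h ⟨A, B, ⟨hAB, hadj⟩, hA, not_lt.1 hB⟩

variable [Fintype V] [DecidableRel G.Adj] {ε : ℝ}

lemma IsSparse.card_nv_le (h : IsSparse G ε) (v : V) :
    (#(nv G v univ) : ℝ) ≤ ε * Fintype.card V := by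
  have h1 : nv G v univ = G.neighborFinset v := by ext x; simp [mem_nv]
  rw [h1, G.card_neighborFinset_eq_degree]
  exact (h v).le

/-- Sparse coherent graphs with more than one vertex are large. -/
lemma IsSparse.one_le (h : IsSparse G ε) (hε : 0 < ε) {c : ℝ} (hc : 0 < c)
    (hV : 1 < Fintype.card V)
    (hcoh : IsCoherent G (ε * (Fintype.card V : ℝ) ^ (1 - c)) (ε * Fintype.card V)) :
    1 ≤ ε * Fintype.card V := by
  by_contra! hlt
  obtain ⟨a, b, hab⟩ := Fintype.exists_pair_of_one_lt_card hV
  have hn : (1 : ℝ) ≤ Fintype.card V := by exact_mod_cast hV.le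
  -- If `ε * n < 1`, sparsity makes the graph edgeless, and two single vertices already violate
  -- coherence.
  refine hcoh ⟨{a}, {b}, ⟨by simpa using hab, ?_⟩, ?_, by simpa using hlt.le⟩
  · intro x hx z hz hadj
    have h1 : 0 < G.degree x := (G.degree_pos_iff_exists_adj x).2 ⟨z, hadj⟩
    have h2 : (1 : ℝ) ≤ G.degree x := by exact_mod_cast h1
    linarith [h x]
  · have h1 : (Fintype.card V : ℝ) ^ (1 - c) ≤ Fintype.card V := by
      simpa using Real.rpow_le_rpow_of_exponent_le hn (by linarith : 1 - c ≤ 1)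
    simp only [card_singleton, Nat.cast_one]
    exact (mul_le_mul_of_nonneg_left h1 hε.le).trans hlt.le

end PurePairs

theorem mainTheorem2 (c : ℝ) (hc : 0 < c) (hcint : ∃ k : ℤ, 1 / c = (k : ℝ))
    {W : Type*} [Fintype W] (H : SimpleGraph W) [DecidableRel H.Adj]
    (hH : PurePairs.HasBranchLengthAtLeast H (4 / c + 5)) :
    ∃ ε : ℝ, 0 < ε ∧
      ∀ (V : Type*) [Fintype V] (G : SimpleGraph V) [DecidableRel G.Adj],
        1 < Fintype.card V →
        PurePairs.IsSparse G ε →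
        PurePairs.IsCoherent G (ε * (Fintype.card V : ℝ) ^ (1 - c)) (ε * (Fintype.card V : ℝ)) →
        H.IsIndContained G := by
  obtain ⟨k, hk, hck⟩ : ∃ k : ℕ, 1 ≤ k ∧ 1 / c = k := by
    obtain ⟨m, hm⟩ := hcint
    have hm0 : 0 < m := by
      have : (0 : ℝ) < m := hm ▸ one_div_pos.2 hc
      exact_mod_cast this
    lift m to ℕ using hm0.le
    exact ⟨m, by omega, by simpa using hm⟩
  have hk4 : 4 / c + 5 = ((4 * k + 5 : ℕ) : ℝ) := by
    push_cast
    rw [← hck]; ring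
  have hck' : c * k = 1 := by rw [← hck]; field_simp
  obtain ⟨hcyc, hdist⟩ := hH
  rw [hk4] at hcyc hdist
  obtain ⟨Z, hZ⟩ := PurePairs.exists_buildable_of_degree (k := k) (H := H)
    (fun u v huv hu hv h => by exact_mod_cast hdist u v huv hu hv h)
    (fun w q hq => by exact_mod_cast hcyc w q hq)
  obtain ⟨ε, hε, hmain⟩ := PurePairs.exists_embedding_of_coh hk hZ
  refine ⟨ε, hε, fun V _ G _ hV hsparse hcoh => ?_⟩
  have hn1 : (1 : ℝ) < Fintype.card V := by exact_mod_cast hV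
  have hβ : 1 ≤ ε * Fintype.card V := hsparse.one_le hε hc hV hcoh
  have hn0 : (0 : ℝ) < Fintype.card V := by linarith
  -- Here `s = n ^ (c / 2)`: since `c * k = 1`, `s ^ (2 * k) = n`, and `s ^ 2 = n ^ c` is the ratio
  -- of the two coherence bounds.
  obtain ⟨φ, hφ, hadj⟩ := hmain V G ((Fintype.card V : ℝ) ^ (c / 2))
    (ε * (Fintype.card V : ℝ) ^ (1 - c)) (Real.one_le_rpow hn1.le (by positivity))
    (by
      rw [← Real.rpow_natCast, ← Real.rpow_mul hn0.le]
      push_cast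
      rw [show c / 2 * (2 * k) = c * k by ring, hck', Real.rpow_one])
    hβ
    (by
      rw [← Real.rpow_natCast, ← Real.rpow_mul hn0.le, mul_assoc, ← Real.rpow_add hn0]
      push_cast
      rw [show 1 - c + c / 2 * 2 = 1 by ring, Real.rpow_one])
    hcoh.coh (fun v => hsparse.card_nv_le v)
  exact ⟨⟨⟨φ, hφ⟩, fun {x x'} => hadj x x'⟩⟩
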